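/- Let $E/F$ be an unramified quadratic extension of non-archimedean local fields of characteristic zero, with Galois involution $\sigma$, let $q$ be the residue cardinality of $F$, and $|\cdot|_F,|\cdot|_E$ the normalized absolute values. Let $a,b\ge 0$, $n=a+b$. For each $m$ let $V_m=E^m$ carry the Hermitian form with matrix $I_m$, and set $\Lambda_m=\mathcal O_E^m$, $K_m=\mathrm{GL}_m(\mathcal O_E)$, $\mathcal Herm(V_m)=\{y\in M_m(E):y^*=y\}$ with $y^*={}^t\sigma(y)$, $X_m=\mathcal Herm(V_m)\cap \mathrm{GL}_m(E)$. Let $\mathcal H_m$ be the algebra of compactly supported $K_m$-bi-invariant functions on $\mathrm{GL}_m(E)$. The Haar measures on $\mathrm{GL}_m(E)$, $U(V_m)$ and $M_{a\times b}(E)$ give volume one to $K_m$, $U(V_m)\cap K_m$ and $M_{a\times b}(\mathcal O_E)$; stabilizers of regular semisimple elements (tori) carry the Haar measure giving volume one to their maximal compact subgroup. *Hecke algebras.* For $f\in\mathcal H_m$ let $(f*\mathbf 1_0)(y)=\int_{\mathrm{GL}_m(E)}f(g^{-1})\mathbf 1_0(gyg^*)\,dg$, where $\mathbf 1_0$ is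 the indicator function of $\{kk^*:k\in K_m\}$; this is a function on $\mathcal Herm(V_m)$ supported in $X_m$. The same definition applies to $\mathcal H_a\otimes\mathcal H_b$, viewed as functions on $\mathrm{GL}_a(E)\times\mathrm{GL}_b(E)$. Let $\xi_{(a,b)}:\mathcal H_n\to\mathcal H_a\otimes\mathcal H_b$ be the map $$\xi_{(a,b)}(f)(m_1,m_2)=|\det m_1|_E^{b/2}|\det m_2|_E^{a/2}\,f^P(m_1,m_2),$$ $$f^P(m_1,m_2)=\bigl(|\det m_1|_E^{b}|\det m_2|_E^{-a}\bigr)^{1/2}\int_{M_{a\times b}(E)}\int_{K_n}f\!\left(k\begin{pmatrix}m_1&\\&m_2\end{pmatrix}\begin{pmatrix}1&x\\&1\end{pmatrix}k^{-1}\right)dk\,dx .$$ For $d\ge0$ let $\mathbf 1_d\in\mathcal H_m$ be the sum of the indicator functions of the double cosets $K_m\varpi^\lambda K_m$, $\lambda_1\ge\dots\ge\lambda_m\ge0$, $\sum\lambda_i=d$. *Endoscopic transfer.* Regular semisimple $y\in\mathcal Herm(V_n)$ and $(y_a,y_b)\in\mathcal Herm(V_a)\oplus\mathcal Herm(V_b)$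 (distinct eigenvalues in $\mathfrak{gl}_n$) match if $y$ and $\mathrm{diag}(y_a,y_b)$ are $\mathrm{GL}_n(E)$-conjugate. Stable conjugacy is conjugacy under $U(V)(\overline F)$. For $y'$ stably conjugate to $y$, with $gyg^{-1}=y'$, $g\in\mathrm{GL}_n(E)$, let $\mathrm{inv}(y,y')$ be the class of $g^*g$ in $F[y]^\times/\mathrm{Nm}\,E[y]^\times=H^1(F,T_y)$, and let $\kappa$ be the character of this group that is trivial on the factors coming from $y_a$ and is the non-trivial character on each factor $\mathbb Z/2$ coming from $y_b$. Put $\mathrm{Orb}^\kappa(f,y)=\sum_{y'}\kappa(\mathrm{inv}(y,y'))\,\mathrm{Orb}(f,y')$, over the rational classes in the stable class of $y$, and $SO=\mathrm{Orb}^1$. The transfer factor is $\Delta((y_a,y_b),y)=\kappa(\mathrm{inv}(\mathrm{diag}(y_a,y_b),y))\,\eta_{E/F}(D)|D|_F$ for matching elements, $D$ being the resultant of the characteristic polynomials of $y_a$ and $y_b$ (and $0$ otherwise). Functions $f$ and $f'$ on $\mathcal Herm(V_n)$ and $\mathcal Herm(V_a)\oplus\mathcal Herm(V_b)$ are smooth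 transfers if $SO(f',(y_a,y_b))=\Delta((y_a,y_b),y)\mathrm{Orb}^\kappa(f,y)$ for all matching regular semisimple elements, and $SO(f',(y_a,y_b))=0$ if no such $y$ matches $(y_a,y_b)$. *Relative transfer.* For Hermitian forms $\alpha\in X_a,\beta\in X_b$, let $U(V_n)\times U(V_n)$ act on $\mathrm{End}(V_n)$, and $(U(V_a)\times U(V_\alpha))\times(U(V_b)\times U(V_\beta))$ on $\mathrm{Hom}(V_\alpha,V_a)\oplus\mathrm{Hom}(V_\beta,V_b)$, by $(g,h)\cdot X=gXh^{-1}$. Let $r(X)=XX^\tau$, with $X^\tau$ the adjoint of $X$. Regular semisimple $X$ and $(X_a,X_b)$ match if $r(X)$ and $(r(X_a),r(X_b))$ match. Relative transfer of $f$ and $f'$ is defined as above, with relative orbital integrals over these groups, $\mathrm{inv}(X,X')=\mathrm{inv}(r(X),r(X'))$ and $\Delta_{rel}=\Delta(r(\cdot),r(\cdot))$. For $X$ invertible put $r_!(f)(r(X))=\int_{U(V_n)}f(Xu)\,du$, and extend by zero to $\mathcal Herm(V_n)$. Consider the two statements (A) for every $\varphi\in\mathcal H_n$, $\varphi*\mathbf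 1_0$ and $\xi_{(a,b)}(\varphi)*\mathbf 1_0$ are smooth transfers; (B) the test functions $\mathbf 1_{\mathrm{End}(\Lambda_n)}$ and $\mathbf 1_{\mathrm{End}(\Lambda_a)}\otimes\mathbf 1_{\mathrm{End}(\Lambda_b)}$ match for $(\alpha,\beta)=(I_a,I_b)$, and $\mathbf 1_{\mathrm{End}(\Lambda_n)}$ matches $0$ for all $(\alpha,\beta)$ that are not equivalent to $(I_a,I_b)$. **Proposition.** (A) implies (B). Moreover: 1. Let $\Phi=r_!(\mathbf 1_{\mathrm{End}(\Lambda_n)})$ and let $\Phi_m$ be its restriction to $\{h\in X_n:|\det h|_F=q^{-m}\}$, extended by zero. Then $\Phi_m=0$ if $m$ is odd or negative, $\Phi_{2d}=\mathbf 1_d*\mathbf 1_0$ for all $d\ge0$, and $\Phi=\sum_{d\ge0}\mathbf 1_d*\mathbf 1_0$ pointwise. 2. The map $\xi_{(a,b)}$ is the one dual to parabolic induction twisted by $|\det|_E^{b/2}\boxtimes|\det|_E^{a/2}$: for all $f\in\mathcal H_n$, $s'\in\mathbb C^a$, $s''\in\mathbb C^b$, $\mathrm{Sat}(\xi_{(a,b)}(f))(s',s'')=\mathrm{Sat}(f)(s'+\tfrac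 b2,s''+\tfrac a2)$, where on $\mathrm{GL}_m(E)$ one puts $\mathrm{Sat}(f)(s)=\int f(g)\prod_i|a_i|_E^{s_i+(m+1-2i)/2}dg$, with $g\in N\,\mathrm{diag}(a_1,\dots,a_m)K_m$ the Iwasawa decomposition ($N$ upper triangular unipotent). 3. $\xi_{(a,b)}(\mathbf 1_d)=\sum_{d_a+d_b=d}\mathbf 1_{d_a}\otimes\mathbf 1_{d_b}$ for all $d\ge0$. -/

import Mathlib

open MeasureTheory
open scoped TensorProduct Matrix Polynomial ValuativeRel

namespace RelFL

noncomputable section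

/-! ### Orbital integrals for a group acting on a set -/

section Orbital

variable {G Y : Type*} [Group G]

/-- The stabilizer of `y` for the action `ρ`. -/
def stab (ρ : G →* Equiv.Perm Y) (y : Y) : Subgroup G :=
  (MulAction.stabilizer (Equiv.Perm Y) y).comap ρ

/-- Rational orbits: `y` and `y'` are equivalent if `ρ g y = y'` for some `g`. -/
def orbitSetoid (ρ : G →* Equiv.Perm Y) : Setoid Y := MulAction.orbitRel ρ.range Y

/-- The elements lying in a compact subgroup. For the group of points of a torus over a
non-archimedean local field this is the unique maximal compact subgroup. -/
def compactElements (T : Type*) [Group T] [TopologicalSpace T] : Set T :=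
  {t | ∃ K : Subgroup T, IsCompact (K : Set T) ∧ t ∈ K}

open Classical in
/-- The Haar measure which gives `C` volume one. -/
def normalizedHaar (G : Type*) [Group G] [TopologicalSpace G] [MeasurableSpace G]
    (C : Set G) : Measure G :=
  if h : ∃ μ : Measure G, μ.IsHaarMeasure ∧ μ C = 1 then h.choose else 0

open Classical in
/-- The additive Haar measure which gives `C` volume one. -/
def normalizedAddHaar (A : Type*) [AddGroup A] [TopologicalSpace A] [MeasurableSpace A]
    (C : Set A) : Measure A :=
  if h : ∃ μ : Measure A, μ.IsAddHaarMeasure ∧ μ C = 1 then h.choose else 0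

/-- Weil's formula: `ν` is the quotient of the measure `μ` on `G` by the measure `μT` on `T`, i.e.
`∫_{G/T} ∫_T Θ(x t) dt dν(x) = ∫_G Θ(g) dμ(g)` for every measurable `Θ ≥ 0`. -/
def IsQuotientMeasure [MeasurableSpace G] (μ : Measure G) (T : Subgroup G) (μT : Measure T)
    (ν : Measure (G ⧸ T)) : Prop :=
  ∀ Θ : G → ENNReal, Measurable Θ →
    ∫⁻ x : G ⧸ T, ∫⁻ t : T, Θ (x.out * t) ∂μT ∂ν = ∫⁻ g, Θ g ∂μ

open Classical in
/-- The quotient measure on `G ⧸ T`. -/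
def quotientMeasure [MeasurableSpace G] (μ : Measure G) (T : Subgroup G) (μT : Measure T) :
    Measure (G ⧸ T) :=
  if h : ∃ ν, IsQuotientMeasure μ T μT ν then h.choose else 0

variable [TopologicalSpace G] [MeasurableSpace G]

/-- The orbital integral of `f` over the `G`-orbit of `y`. The stabilizer (a torus in all
applications) carries the Haar measure giving its maximal compact subgroup volume one. After the
substitution `g ↦ g⁻¹` this is the integral of `f (g⁻¹ • y)` over `G_y \ G`. -/
def orbInt (μ : Measure G) (ρ : G →* Equiv.Perm Y) (f : Y → ℂ) (y : Y) : ℂ :=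
  ∫ x : G ⧸ stab ρ y, f (ρ x.out y)
    ∂(quotientMeasure μ (stab ρ y) (normalizedHaar (stab ρ y) (compactElements (stab ρ y))))

open Classical in
/-- `∑ κ(y') Orb(f, y')`, over the rational orbits of those `y'` which satisfy `st`. -/
def weightedOrbInt (μ : Measure G) (ρ : G →* Equiv.Perm Y) (st : Y → Prop) (κ : Y → ℂ)
    (f : Y → ℂ) : ℂ :=
  ∑ᶠ ω : Quotient (orbitSetoid ρ), if st ω.out then κ ω.out * orbInt μ ρ f ω.out else 0

/-- The componentwise action of a product. -/
def prodAction {G₁ G₂ Y₁ Y₂ : Type*} [Group G₁] [Group G₂]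
    (ρ₁ : G₁ →* Equiv.Perm Y₁) (ρ₂ : G₂ →* Equiv.Perm Y₂) :
    G₁ × G₂ →* Equiv.Perm (Y₁ × Y₂) :=
  MonoidHom.mk' (fun g => Equiv.prodCongr (ρ₁ g.1) (ρ₂ g.2)) (by
    intro g h; ext y <;> simp)

/-- Locally constant with compact support. -/
def IsTestFunction {Y : Type*} [TopologicalSpace Y] (f : Y → ℂ) : Prop :=
  IsLocallyConstant f ∧ HasCompactSupport f

end Orbital

/-! ### Hermitian forms, unitary groups, Hermitian matrices -/

section Hermitian

variable {R : Type*} [CommRing R]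

/-- The conjugate transpose with respect to `s`. -/
def conjT {m n : Type*} (s : R →+* R) (A : Matrix m n R) : Matrix n m R := (A.map s)ᵀ

theorem conjT_mul {l m n : Type*} [Fintype m] (s : R →+* R) (A : Matrix l m R)
    (B : Matrix m n R) : conjT s (A * B) = conjT s B * conjT s A := by
  simp [conjT, Matrix.map_mul, Matrix.transpose_mul]

theorem conjT_one {n : Type*} [DecidableEq n] (s : R →+* R) :
    conjT s (1 : Matrix n n R) = 1 := by
  simp [conjT, Matrix.map_one]

theorem conjT_conjT {m n : Type*} (s : R →+* R) (hs : ∀ x, s (s x) = x) (A : Matrix m n R) :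
    conjT s (conjT s A) = A := by
  ext i j; simp [conjT, hs]

/-- The unitary group of the form `⟨u, v⟩ = u^* x v`. -/
def unitary {n : ℕ} (s : R →+* R) (x : Matrix (Fin n) (Fin n) R) :
    Subgroup (GL (Fin n) R) where
  carrier := {g | conjT s g.val * x * g.val = x}
  one_mem' := by simp [conjT_one]
  mul_mem' := by
    intro g h hg hh
    simp only [Set.mem_ofPred_eq, Units.val_mul, conjT_mul] at *
    calc _ = conjT s h.val * (conjT s g.val * x * g.val) * h.val := by simp only [mul_assoc]
      _ = x := by rw [hg, hh]
  inv_mem' := by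
    intro g hg
    simp only [Set.mem_ofPred_eq] at *
    have h1 : conjT s (g⁻¹).val * conjT s g.val = 1 := by
      rw [← conjT_mul, Units.mul_inv, conjT_one]
    calc conjT s (g⁻¹).val * x * (g⁻¹).val
        = conjT s (g⁻¹).val * (conjT s g.val * x * g.val) * (g⁻¹).val := by rw [hg]
      _ = (conjT s (g⁻¹).val * conjT s g.val) * x * (g.val * (g⁻¹).val) := by
          simp only [mul_assoc]
      _ = x := by rw [h1, Units.mul_inv, one_mul, mul_one]

/-- `Herm(V_n)`, the endomorphisms of `R^n` self-adjoint for the form with matrix `1`. -/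
def Herm (s : R →+* R) (n : ℕ) : Type _ :=
  {y : Matrix (Fin n) (Fin n) R // conjT s y = y}

theorem unitary_inv {n : ℕ} {s : R →+* R} (g : unitary (n := n) s 1) :
    conjT s g.1.val = (g.1⁻¹).val := by
  have h : conjT s g.1.val * 1 * g.1.val = 1 := g.2
  rw [mul_one] at h
  exact Units.eq_inv_of_mul_eq_one_right h

theorem unitary_inv' {n : ℕ} {s : R →+* R} (g : unitary (n := n) s 1) :
    conjT s (g.1⁻¹).val = g.1.val := by
  have h := unitary_inv (g⁻¹)
  simpa using h

theorem conj_mem {n : ℕ} {s : R →+* R} (g : unitary (n := n) s 1) (y : Herm s n) :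
    conjT s (g.1.val * y.1 * (g.1⁻¹).val) = g.1.val * y.1 * (g.1⁻¹).val := by
  rw [conjT_mul, conjT_mul, unitary_inv, unitary_inv', y.2, mul_assoc]

/-- The adjoint action `y ↦ g y g⁻¹` of `U(V_n)` on `Herm(V_n)`. -/
def hermAction (s : R →+* R) (n : ℕ) : unitary (n := n) s 1 →* Equiv.Perm (Herm s n) :=
  MonoidHom.toHomPerm
    { toFun := fun g y => ⟨g.1.val * y.1 * (g.1⁻¹).val, conj_mem g y⟩
      map_one' := by
        funext y; apply Subtype.ext
        change (1 : Matrix (Fin n) (Fin n) R) * y.1 * (1 : GL (Fin n) R)⁻¹.val = y.1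
        simp
      map_mul' := by
        intro g h; funext y; apply Subtype.ext
        change (g.1 * h.1).val * y.1 * ((g.1 * h.1)⁻¹).val =
          g.1.val * (h.1.val * y.1 * (h.1⁻¹).val) * (g.1⁻¹).val
        simp only [mul_inv_rev, Units.val_mul, mul_assoc] }

/-- The action `X ↦ g X h⁻¹` of `U(V_n) × U(V_α)` on `Hom(V_α, V_n)`. -/
def homAction {n : ℕ} (s : R →+* R) (α : Matrix (Fin n) (Fin n) R) :
    unitary (n := n) s 1 × unitary s α →* Equiv.Perm (Matrix (Fin n) (Fin n) R) :=
  MonoidHom.toHomPerm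
    { toFun := fun g X => g.1.1.val * X * (g.2.1⁻¹).val
      map_one' := by
        funext X
        change (1 : Matrix (Fin n) (Fin n) R) * X * (1 : GL (Fin n) R)⁻¹.val = X
        simp
      map_mul' := by
        intro g h; funext X
        change (g.1.1 * h.1.1).val * X * ((g.2.1 * h.2.1)⁻¹).val =
          g.1.1.val * (h.1.1.val * X * (h.2.1⁻¹).val) * (g.2.1⁻¹).val
        simp only [mul_inv_rev, Units.val_mul, mul_assoc] }

/-- Nondegenerate Hermitian forms on `R^n`, i.e. the points of `X_n`. -/
def HermForm (s : R →+* R) (n : ℕ) : Type _ := {x : GL (Fin n) R // conjT s x.val = x.val}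

/-- The form `I_n`. -/
def HermForm.one (s : R →+* R) (n : ℕ) : HermForm s n := ⟨1, by simp [conjT_one]⟩

/-- `α` lies in the orbit of `I_n` under `g ∗ x = g x g^*`. -/
def HermForm.IsSplit {s : R →+* R} {n : ℕ} (α : HermForm s n) : Prop :=
  ∃ g : GL (Fin n) R, g.val * conjT s g.val = α.1.val

/-- `X^τ`, the adjoint of `X : V_α → V_n`. -/
def adj {s : R →+* R} {n : ℕ} (α : HermForm s n) (X : Matrix (Fin n) (Fin n) R) :
    Matrix (Fin n) (Fin n) R := (α.1⁻¹).val * conjT s X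

/-- The contraction `r(X) = X X^τ`. -/
def contraction {s : R →+* R} (hs : ∀ x, s (s x) = x) {n : ℕ} (α : HermForm s n)
    (X : Matrix (Fin n) (Fin n) R) : Herm s n :=
  ⟨X * adj α X, by
    have h : conjT s (α.1⁻¹).val = (α.1⁻¹).val := by
      apply Units.eq_inv_of_mul_eq_one_right
      calc conjT s (α.1⁻¹).val * α.1.val = conjT s (α.1⁻¹).val * conjT s α.1.val := by rw [α.2]
        _ = 1 := by rw [← conjT_mul, Units.mul_inv, conjT_one]
    rw [adj, conjT_mul, conjT_mul, conjT_conjT s hs, h, mul_assoc]⟩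

/-- Regular semisimple: the eigenvalues are distinct. -/
def IsRSS {n : ℕ} (y : Matrix (Fin n) (Fin n) R) : Prop := y.charpoly.Separable

/-- Regular semisimple elements of `𝔲(V_n ⊕ V_α)₁ = Hom(V_α, V_n)`: those `X` for which the
element `(0, X; -X^τ, 0)` of `𝔲(V_n ⊕ V_α)` is regular semisimple. -/
def IsRelRSS {s : R →+* R} {n : ℕ} (α : HermForm s n) (X : Matrix (Fin n) (Fin n) R) : Prop :=
  (Matrix.fromBlocks 0 X (-(adj α X)) 0).charpoly.Separable

/-- A `2 × 2` block matrix as a matrix of size `a + b`. -/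
def blk {a b : ℕ} (A : Matrix (Fin a) (Fin a) R) (B : Matrix (Fin a) (Fin b) R)
    (C : Matrix (Fin b) (Fin a) R) (D : Matrix (Fin b) (Fin b) R) :
    Matrix (Fin (a + b)) (Fin (a + b)) R :=
  Matrix.reindex finSumFinEquiv finSumFinEquiv (Matrix.fromBlocks A B C D)

theorem conjT_blk {a b : ℕ} (s : R →+* R) (A : Matrix (Fin a) (Fin a) R)
    (D : Matrix (Fin b) (Fin b) R) :
    conjT s (blk A 0 0 D) = blk (conjT s A) 0 0 (conjT s D) := by
  ext i j
  simp only [conjT, blk, Matrix.transpose_apply, Matrix.map_apply, Matrix.reindex_apply,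
    Matrix.submatrix_apply]
  cases finSumFinEquiv.symm i <;> cases finSumFinEquiv.symm j <;> simp

/-- The embedding `Herm(V_a) ⊕ Herm(V_b) → Herm(V_a ⊕ V_b) = Herm(V_{a+b})`. -/
def hermDiag {s : R →+* R} {a b : ℕ} (ya : Herm s a) (yb : Herm s b) : Herm s (a + b) :=
  ⟨blk ya.1 0 0 yb.1, by rw [conjT_blk, ya.2, yb.2]⟩

/-- `y` and `(y_a, y_b)` match: they are `GL_{a+b}`-conjugate. -/
def Match {s : R →+* R} {a b : ℕ} (y : Herm s (a + b)) (ya : Herm s a) (yb : Herm s b) : Prop :=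
  ∃ g : GL (Fin (a + b)) R, g.val * y.1 = (hermDiag ya yb).1 * g.val

end Hermitian

/-! ### The quadratic extension `E/F` with its Galois involution: stable conjugacy and `κ` -/

section Stable

variable {F E : Type*} [Field F] [Field E] [Algebra F E] (σ : E ≃ₐ[F] E)

/-- `σ` as a ring endomorphism. -/
abbrev sig : E →+* E := (σ : E →+* E)

variable (F E) in
/-- `E ⊗ F̄`, so that `U(V)(F̄)` consists of matrices over this ring. -/
abbrev Ebar : Type _ := E ⊗[F] AlgebraicClosure F

/-- The involution `σ ⊗ id`. -/
def sbar : Ebar F E →+* Ebar F E :=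
  (Algebra.TensorProduct.map (σ : E →ₐ[F] E)
    (AlgHom.id F (AlgebraicClosure F))).toRingHom

variable (F E) in
/-- Scalar extension `E → E ⊗ F̄`. -/
def toBar : E →+* Ebar F E := (Algebra.TensorProduct.includeLeft : E →ₐ[F] Ebar F E).toRingHom

/-- Stable conjugacy in `Herm(V_n)`: conjugacy under `U(V_n)(F̄)`. For `y` regular semisimple the
stabilizer is a torus, hence connected, and there is no condition on the cocycle. -/
def StablyConj {n : ℕ} (y y' : Herm (sig σ) n) : Prop :=
  ∃ g ∈ unitary (n := n) (sbar σ) 1,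
    g.val * y.1.map (toBar F E) = y'.1.map (toBar F E) * g.val

/-- Stable conjugacy in `Hom(V_α, V_n)`: conjugacy under `(U(V_n) × U(V_α))(F̄)`. -/
def RelStablyConj {n : ℕ} (α : HermForm (sig σ) n) (X X' : Matrix (Fin n) (Fin n) E) : Prop :=
  ∃ g ∈ unitary (n := n) (sbar σ) 1, ∃ h ∈ unitary (sbar σ) (α.1.val.map (toBar F E)),
    g.val * X.map (toBar F E) = X'.map (toBar F E) * h.val

/-- For `y, y'` stably conjugate and regular semisimple, choose `g ∈ GL_n(E)` with
`g y g⁻¹ = y'`. Then `g^* g` lies in `F[y]^×`, and `inv(y, y')` is its class in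
`F[y]^× / Nm E[y]^× = H¹(F, T_y)`. The component of this class in the factor of `F[y] = ∏ F_i`
attached to the irreducible factor `p` of the characteristic polynomial is trivial if it is a norm
from `E ⊗ F_i = E[t]/(p)`. -/
def InvTrivialAt {n : ℕ} (y y' : Herm (sig σ) n) (p : F[X]) : Prop :=
  ∃ g : GL (Fin n) E, g.val * y.1 = y'.1 * g.val ∧
    ∃ f : F[X], Polynomial.aeval y.1 f = conjT (sig σ) g.val * g.val ∧
      ∃ h : E[X], p.map (algebraMap F E) ∣ f.map (algebraMap F E) - h * h.map (sig σ)

open Classical in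
/-- `κ(inv(y, y'))`: the product over the factors `ℤ/2` of `H¹(F, T_y)` arising from `S₁(b)`, that
is from the irreducible factors `p` of the characteristic polynomial of `y_b` such that `F[t]/(p)`
does not contain `E`, i.e. `p` stays irreducible over `E`. -/
def kappa {n b : ℕ} (yb : Herm (sig σ) b) (y y' : Herm (sig σ) n) : ℂ :=
  ∏ᶠ p ∈ {p : F[X] | p.Monic ∧ Irreducible p ∧ Irreducible (p.map (algebraMap F E)) ∧
      p.map (algebraMap F E) ∣ yb.1.charpoly},
    if InvTrivialAt σ y y' p then (1 : ℂ) else -1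

open Classical in
/-- The character `η_{E/F}` on nonzero elements of `F ⊆ E`. -/
def etaF (x : E) : ℂ := if ∃ z : E, z * σ z = x then 1 else -1

end Stable

/-! ### Local fields: valuations, compact open subgroups, measures -/

section Local

variable (K : Type*) [Field K] [ValuativeRel K] [TopologicalSpace K] [IsNonarchimedeanLocalField K]

/-- The normalized additive valuation (with junk value `0` at `0`). -/
def ord (x : K) : ℤ :=
  -WithZero.log (IsNonarchimedeanLocalField.valueGroupWithZeroIsoInt K (ValuativeRel.valuation K x))

/-- The cardinality of the residue field. -/
def resCard : ℕ := Nat.card 𝓀[K]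

open Classical in
/-- The normalized absolute value. -/
def absK (x : K) : ℝ := if x = 0 then 0 else (resCard K : ℝ) ^ (-ord K x)

/-- `GL_n(𝒪)`. -/
def maxK (n : ℕ) : Subgroup (GL (Fin n) K) :=
  (Matrix.GeneralLinearGroup.map (n := Fin n) (𝒪[K]).subtype).range

/-- Integral matrices; for `m = n` this is `End(Λ_n)`, where `Λ_n = 𝒪^n`. -/
def intMat (m n : ℕ) : Set (Matrix (Fin m) (Fin n) K) := {X | ∀ i j, X i j ∈ 𝒪[K]}

variable {K}

instance instMeasurableSpaceGL (n : ℕ) : MeasurableSpace (GL (Fin n) K) := borel _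

instance instBorelSpaceGL (n : ℕ) : BorelSpace (GL (Fin n) K) := ⟨rfl⟩

variable (K)

/-- Haar measure on `GL_n` with `vol GL_n(𝒪) = 1`. -/
def muGL (n : ℕ) : Measure (GL (Fin n) K) := normalizedHaar _ (maxK K n : Set _)

/-- Haar measure on `U(V_n)` with `vol U(Λ_n) = 1`, where `U(Λ_n) = U(V_n) ∩ GL_n(𝒪)`. -/
def muU {K : Type*} [Field K] [ValuativeRel K] [TopologicalSpace K]
    [IsNonarchimedeanLocalField K] (s : K →+* K) (n : ℕ) :
    Measure (unitary (n := n) s (1 : Matrix (Fin n) (Fin n) K)) :=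
  normalizedHaar _ {u | u.1 ∈ maxK K n}

/-! ### Spherical Hecke algebras -/

variable {K}

/-- Elements of the spherical Hecke algebra of `GL_n`: compactly supported and bi-invariant under
`GL_n(𝒪)` (an open subgroup, so that local constancy is automatic). -/
def IsSpherical {n : ℕ} (f : GL (Fin n) K → ℂ) : Prop :=
  HasCompactSupport f ∧ ∀ k ∈ maxK K n, ∀ k' ∈ maxK K n, ∀ g, f (k * g * k') = f g

/-- The double coset `GL_n(𝒪) ϖ^l GL_n(𝒪)`. -/
def doubleCoset {n : ℕ} (l : Fin n → ℕ) : Set (GL (Fin n) K) :=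
  {g | ∃ k ∈ maxK K n, ∃ k' ∈ maxK K n, ∃ t : Fin n → Kˣ, (∀ i, ord K (t i : K) = l i) ∧
    g.val = k.val * Matrix.diagonal (fun i => (t i : K)) * k'.val}

open Classical in
/-- `P⁺_{n,d}`: weakly decreasing sequences in `ℤ_{≥0}^n` with sum `d`. -/
def domWeights (n d : ℕ) : Finset (Fin n → ℕ) :=
  (Finset.piAntidiag Finset.univ d).filter Antitone

variable (K) in
/-- `𝟏_d`, the sum over `P⁺_{n,d}` of the indicator functions of the double cosets. -/
def oneD (n d : ℕ) (g : GL (Fin n) K) : ℂ :=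
  ∑ l ∈ domWeights n d, (doubleCoset l).indicator 1 g

/-- `g = u t k` with `u` upper triangular unipotent, `t` diagonal with valuations `l`, and
`k ∈ GL_n(𝒪)`. -/
def IsIwasawa {n : ℕ} (g : GL (Fin n) K) (l : Fin n → ℤ) : Prop :=
  ∃ u : Matrix (Fin n) (Fin n) K, u.BlockTriangular id ∧ (∀ i, u i i = 1) ∧
    ∃ t : Fin n → Kˣ, (∀ i, ord K (t i : K) = l i) ∧ ∃ k ∈ maxK K n,
      g.val = u * Matrix.diagonal (fun i => (t i : K)) * k.val

open Classical in
/-- The valuations of the diagonal entries in the Iwasawa decomposition. -/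
def iwasawa {n : ℕ} (g : GL (Fin n) K) : Fin n → ℤ :=
  if h : ∃ l, IsIwasawa g l then h.choose else 0

/-- `∏ |a_i|^{s_i + (n+1-2i)/2}` for `g = u a k`, where `i = 1, …, n`. -/
def satakeKernel {n : ℕ} (s : Fin n → ℂ) (g : GL (Fin n) K) : ℂ :=
  ∏ i, (resCard K : ℂ) ^ (-(iwasawa g i : ℂ) * (s i + ((n : ℂ) + 1 - 2 * ((i : ℂ) + 1)) / 2))

/-- The Satake transform on `GL_n`. -/
def satake {n : ℕ} (f : GL (Fin n) K → ℂ) (s : Fin n → ℂ) : ℂ :=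
  ∫ g, f g * satakeKernel s g ∂(muGL K n)

/-- The Satake transform on `GL_a × GL_b`. -/
def satake₂ {a b : ℕ} (f : GL (Fin a) K × GL (Fin b) K → ℂ) (sa : Fin a → ℂ)
    (sb : Fin b → ℂ) : ℂ :=
  ∫ m, f m * (satakeKernel sa m.1 * satakeKernel sb m.2) ∂((muGL K a).prod (muGL K b))

/-- The element `diag(m₁, m₂) (1, x; 0, 1)` of the parabolic subgroup. -/
def parab {a b : ℕ} (m₁ : GL (Fin a) K) (m₂ : GL (Fin b) K) (x : Matrix (Fin a) (Fin b) K) :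
    GL (Fin (a + b)) K :=
  Matrix.GeneralLinearGroup.mkOfDetNeZero (blk m₁.val 0 0 m₂.val * blk 1 x 0 1) (by
    simpa [blk, Matrix.det_mul] using
      And.intro (Matrix.isUnit_det_of_left_inverse m₁.inv_val).ne_zero
        (Matrix.isUnit_det_of_left_inverse m₂.inv_val).ne_zero)

/-- The parabolic descent `f^P` from `GL_{a+b}` to `GL_a × GL_b`. -/
def parabolicDescent {a b : ℕ} (f : GL (Fin (a + b)) K → ℂ)
    (m : GL (Fin a) K × GL (Fin b) K) : ℂ :=
  letI : MeasurableSpace (Matrix (Fin a) (Fin b) K) := borel _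
  (((absK K m.1.val.det ^ b * (absK K m.2.val.det ^ a)⁻¹) ^ (1 / 2 : ℝ) : ℝ) : ℂ) *
    ∫ x : Matrix (Fin a) (Fin b) K, ∫ k in (maxK K (a + b) : Set (GL (Fin (a + b)) K)),
      f (k * parab m.1 m.2 x * k⁻¹) ∂(muGL K (a + b)) ∂(normalizedAddHaar _ (intMat K a b))

/-- The morphism `ξ_{(a,b)}`: parabolic descent, twisted by `|det m₁|^{b/2} |det m₂|^{a/2}`. The
target `H(GL_a) ⊗ H(GL_b)` is realized as functions on `GL_a × GL_b`. -/
def xi {a b : ℕ} (f : GL (Fin (a + b)) K → ℂ) (m : GL (Fin a) K × GL (Fin b) K) : ℂ :=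
  ((absK K m.1.val.det ^ ((b : ℝ) / 2) * absK K m.2.val.det ^ ((a : ℝ) / 2) : ℝ) : ℂ) *
    parabolicDescent f m

/-- `𝟏_0`, the indicator function of `X_n(𝒪_F) = GL_n(𝒪_E) ∗ I_n`. -/
def oneZero (s : K →+* K) (n : ℕ) : Matrix (Fin n) (Fin n) K → ℂ :=
  {y | ∃ k ∈ maxK K n, y = k.val * conjT s k.val}.indicator 1

/-- `f ∗ 𝟏_0`, where `(f ∗ φ)(y) = ∫ f(g⁻¹) φ(g y g^*) dg`, extended by zero to `Herm(V_n)`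
(the formula vanishes when `det y = 0`). -/
def convOne {n : ℕ} (s : K →+* K) (f : GL (Fin n) K → ℂ) (y : Herm s n) : ℂ :=
  ∫ g, f g⁻¹ * oneZero s n (g.val * y.1 * conjT s g.val) ∂(muGL K n)

/-- The analogue `f_a ⊗ f_b ↦ (f_a ∗ 𝟏_0) ⊗ (f_b ∗ 𝟏_0)` for functions on `GL_a × GL_b`. -/
def convOne₂ {a b : ℕ} (s : K →+* K) (f : GL (Fin a) K × GL (Fin b) K → ℂ)
    (y : Herm s a × Herm s b) : ℂ :=
  ∫ g, f g⁻¹ * (oneZero s a (g.1.val * y.1.1 * conjT s g.1.val) *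
    oneZero s b (g.2.val * y.2.1 * conjT s g.2.val)) ∂((muGL K a).prod (muGL K b))

open Classical in
/-- `r_!(f)(r(X)) = ∫_{U(V_n)} f(X u) du` for `X` invertible, extended by zero. -/
def rPush {n : ℕ} (s : K →+* K) (f : Matrix (Fin n) (Fin n) K → ℂ) (h : Herm s n) : ℂ :=
  if hX : ∃ X : GL (Fin n) K, X.val * conjT s X.val = h.1 then
    ∫ u : unitary (n := n) s (1 : Matrix (Fin n) (Fin n) K), f (hX.choose.val * u.1.val) ∂(muU s n)
  else 0

variable (K) in
/-- `𝟏_{End(Λ_n)}`. -/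
def oneEnd (n : ℕ) : Matrix (Fin n) (Fin n) K → ℂ := (intMat K n n).indicator 1

variable (K) in
/-- `𝟏_{End(Λ_a)} ⊗ 𝟏_{End(Λ_b)}`. -/
def oneEnd₂ (a b : ℕ) (X : Matrix (Fin a) (Fin a) K × Matrix (Fin b) (Fin b) K) : ℂ :=
  oneEnd K a X.1 * oneEnd K b X.2

open Classical in
/-- `Φ_m`: the restriction of `Φ = r_!(𝟏_{End(Λ_n)})` to `{h ∈ X_n : |det h|_F = q^{-m}}`. The
valuation of `F` is the restriction of the one of `E`, as `E/F` is unramified. -/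
def phiGraded {n : ℕ} (s : K →+* K) (m : ℤ) (h : Herm s n) : ℂ :=
  if h.1.det ≠ 0 ∧ ord K h.1.det = m then rPush s (oneEnd K n) h else 0

end Local

/-! ### Endoscopic transfer -/

section Transfer

variable {F E : Type*} [Field F] [ValuativeRel F] [TopologicalSpace F]
  [IsNonarchimedeanLocalField F] [Field E] [ValuativeRel E] [TopologicalSpace E]
  [IsNonarchimedeanLocalField E] [Algebra F E] (σ : E ≃ₐ[F] E)

variable (F E) in
/-- `E/F` is unramified: the ramification index is one. -/
def IsUnramified : Prop := ∀ x : F, ord E (algebraMap F E x) = ord F x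

/-- The value of the Langlands--Shelstad--Kottwitz transfer factor at the base point. At
`y₀ = diag(y_a, y_b) ∈ Herm(V_a ⊕ V_b)` it is `η(D) |D|_F`, where `D` is the resultant of the
characteristic polynomials of `y_a` and `y_b`; at `y` stably conjugate to `y₀` it is multiplied by
`κ(inv(y₀, y))`. The valuation of `D ∈ F` may be taken in `E`, as `E/F` is unramified. -/
def baseFactor {a b : ℕ} (ya : Herm (sig σ) a) (yb : Herm (sig σ) b) : ℂ :=
  etaF σ (Polynomial.resultant ya.1.charpoly yb.1.charpoly) *
    (resCard F : ℂ) ^ (-ord E (Polynomial.resultant ya.1.charpoly yb.1.charpoly))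

open Classical in
/-- The transfer factor `Δ((y_a, y_b), y)`; it vanishes unless `y` matches `(y_a, y_b)`. -/
def transferFactor {a b : ℕ} (ya : Herm (sig σ) a) (yb : Herm (sig σ) b)
    (y : Herm (sig σ) (a + b)) : ℂ :=
  if Match y ya yb then kappa σ yb (hermDiag ya yb) y * baseFactor σ ya yb else 0

/-- `Orb^κ(f, y)` on `Herm(V_n)`; `κ` is the character attached to the `b`-part of the datum. -/
def kappaOrb {n b : ℕ} (yb : Herm (sig σ) b) (f : Herm (sig σ) n → ℂ) (y : Herm (sig σ) n) : ℂ :=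
  weightedOrbInt (muU (sig σ) n) (hermAction (sig σ) n) (StablyConj σ y) (kappa σ yb y) f

/-- `SO(f', (y_a, y_b))` on `Herm(V_a) ⊕ Herm(V_b)`. -/
def stableOrb {a b : ℕ} (f' : Herm (sig σ) a × Herm (sig σ) b → ℂ)
    (y : Herm (sig σ) a × Herm (sig σ) b) : ℂ :=
  weightedOrbInt ((muU (sig σ) a).prod (muU (sig σ) b))
    (prodAction (hermAction (sig σ) a) (hermAction (sig σ) b))
    (fun y' => StablyConj σ y.1 y'.1 ∧ StablyConj σ y.2 y'.2) (fun _ => 1) f'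

/-- `f` on `Herm(V_{a+b})` and `f'` on `Herm(V_a) ⊕ Herm(V_b)` are smooth transfers: their orbital
integrals match. A pair is regular semisimple if it is so in `𝔤𝔩_{a+b}`. -/
def IsTransfer {a b : ℕ} (f : Herm (sig σ) (a + b) → ℂ)
    (f' : Herm (sig σ) a × Herm (sig σ) b → ℂ) : Prop :=
  (∀ (y : Herm (sig σ) (a + b)) (ya : Herm (sig σ) a) (yb : Herm (sig σ) b),
    IsRSS y.1 → IsRSS (hermDiag ya yb).1 → Match y ya yb →
      stableOrb σ f' (ya, yb) = transferFactor σ ya yb y * kappaOrb σ yb f y) ∧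
  (∀ (ya : Herm (sig σ) a) (yb : Herm (sig σ) b), IsRSS (hermDiag ya yb).1 →
    (¬ ∃ y : Herm (sig σ) (a + b), IsRSS y.1 ∧ Match y ya yb) → stableOrb σ f' (ya, yb) = 0)

variable (hσ : ∀ x : E, sig σ (sig σ x) = x)

/-- `RO^κ(f, X)` on `Hom(V_n, V_n)`, with `inv(X, X') = inv(r(X), r(X'))`. -/
def relKappaOrb {n b : ℕ} (yb : Herm (sig σ) b) (f : Matrix (Fin n) (Fin n) E → ℂ)
    (X : Matrix (Fin n) (Fin n) E) : ℂ :=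
  weightedOrbInt ((muU (sig σ) n).prod (muU (sig σ) n))
    (homAction (n := n) (sig σ) 1) (RelStablyConj σ (HermForm.one (sig σ) n) X)
    (fun X' => kappa σ yb (contraction hσ (HermForm.one (sig σ) n) X)
      (contraction hσ (HermForm.one (sig σ) n) X')) f

/-- `SRO(f', (X_a, X_b))` on `Hom(V_α, V_a) ⊕ Hom(V_β, V_b)`, for given Haar measures on `U(V_α)`
and `U(V_β)`. -/
def relStableOrb {a b : ℕ} (α : HermForm (sig σ) a) (β : HermForm (sig σ) b)
    (μα : Measure (unitary (sig σ) α.1.val)) (μβ : Measure (unitary (sig σ) β.1.val))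
    (f' : Matrix (Fin a) (Fin a) E × Matrix (Fin b) (Fin b) E → ℂ)
    (X : Matrix (Fin a) (Fin a) E × Matrix (Fin b) (Fin b) E) : ℂ :=
  weightedOrbInt (((muU (sig σ) a).prod μα).prod ((muU (sig σ) b).prod μβ))
    (prodAction (homAction (sig σ) α.1.val) (homAction (sig σ) β.1.val))
    (fun X' => RelStablyConj σ α X.1 X'.1 ∧ RelStablyConj σ β X.2 X'.2) (fun _ => 1) f'

/-- The pair `(X_a, X_b)` is regular semisimple, its image in `𝔤𝔩_{a+b}` included. -/
def IsPairRSS {a b : ℕ} (α : HermForm (sig σ) a) (β : HermForm (sig σ) b)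
    (Xa : Matrix (Fin a) (Fin a) E) (Xb : Matrix (Fin b) (Fin b) E) : Prop :=
  IsRelRSS α Xa ∧ IsRelRSS β Xb ∧ IsRSS (hermDiag (contraction hσ α Xa) (contraction hσ β Xb)).1

/-- `X` matches `(X_a, X_b)` if their contractions match. -/
def RelMatch {a b : ℕ} (α : HermForm (sig σ) a) (β : HermForm (sig σ) b)
    (X : Matrix (Fin (a + b)) (Fin (a + b)) E)
    (Xa : Matrix (Fin a) (Fin a) E) (Xb : Matrix (Fin b) (Fin b) E) : Prop :=
  Match (contraction hσ (HermForm.one (sig σ) (a + b)) X) (contraction hσ α Xa)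
    (contraction hσ β Xb)

/-- `f` on `End(V_{a+b})` and `f'` on `Hom(V_α, V_a) ⊕ Hom(V_β, V_b)` match. -/
def IsRelTransfer {a b : ℕ} (α : HermForm (sig σ) a) (β : HermForm (sig σ) b)
    (μα : Measure (unitary (sig σ) α.1.val)) (μβ : Measure (unitary (sig σ) β.1.val))
    (f : Matrix (Fin (a + b)) (Fin (a + b)) E → ℂ)
    (f' : Matrix (Fin a) (Fin a) E × Matrix (Fin b) (Fin b) E → ℂ) : Prop :=
  (∀ X Xa Xb, IsRelRSS (HermForm.one (sig σ) (a + b)) X → IsPairRSS σ hσ α β Xa Xb →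
    RelMatch σ hσ α β X Xa Xb →
      relStableOrb σ α β μα μβ f' (Xa, Xb) =
        transferFactor σ (contraction hσ α Xa) (contraction hσ β Xb)
          (contraction hσ (HermForm.one (sig σ) (a + b)) X) *
        relKappaOrb σ hσ (contraction hσ β Xb) f X) ∧
  (∀ Xa Xb, IsPairRSS σ hσ α β Xa Xb →
    (¬ ∃ X, IsRelRSS (HermForm.one (sig σ) (a + b)) X ∧ RelMatch σ hσ α β X Xa Xb) →
      relStableOrb σ α β μα μβ f' (Xa, Xb) = 0)

/-- The fundamental lemma for the Hecke algebra, for the datum `U(V_a) × U(V_b)`. -/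
def EndoscopicBaseChange (a b : ℕ) : Prop :=
  ∀ φ : GL (Fin (a + b)) E → ℂ, IsSpherical φ →
    IsTransfer (a := a) (b := b) σ (convOne (sig σ) φ) (convOne₂ (sig σ) (xi φ))

/-- The relative fundamental lemma, for the data `(U(V_a) × U(V_b), α, β)`. Matching with `0` does
not depend on the normalization of the measures on `U(V_α)` and `U(V_β)`, which are arbitrary. -/
def RelativeFundamentalLemma (a b : ℕ) : Prop :=
  IsTestFunction (oneEnd E (a + b)) ∧ IsTestFunction (oneEnd₂ E a b) ∧
  IsRelTransfer σ hσ (HermForm.one (sig σ) a) (HermForm.one (sig σ) b)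
    (muU (sig σ) a) (muU (sig σ) b) (oneEnd E (a + b)) (oneEnd₂ E a b) ∧
  ∀ (α : HermForm (sig σ) a) (β : HermForm (sig σ) b), ¬ (α.IsSplit ∧ β.IsSplit) →
    ∀ (μα : Measure (unitary (sig σ) α.1.val)) (μβ : Measure (unitary (sig σ) β.1.val)),
      μα.IsHaarMeasure → μβ.IsHaarMeasure →
        IsRelTransfer σ hσ α β μα μβ (oneEnd E (a + b)) 0

end Transfer

end

end RelFL

set_option linter.unusedSectionVars false
set_option linter.style.haveILetI false

namespace RelFL

noncomputable section


section LocalBasics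

variable {K : Type*} [Field K] [ValuativeRel K] [TopologicalSpace K] [IsNonarchimedeanLocalField K]

/-! ### The normalized valuation -/

local notation "vint" => IsNonarchimedeanLocalField.valueGroupWithZeroIsoInt

theorem ord_mul {x y : K} (hx : x ≠ 0) (hy : y ≠ 0) : ord K (x * y) = ord K x + ord K y := by
  have h1 : vint K (ValuativeRel.valuation K x) ≠ 0 := by simpa using hx
  have h2 : vint K (ValuativeRel.valuation K y) ≠ 0 := by simpa using hy
  simp only [ord, map_mul, WithZero.log_mul h1 h2]; ring

@[simp] theorem ord_one : ord K (1 : K) = 0 := by simp [ord]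

@[simp] theorem ord_inv (x : K) : ord K x⁻¹ = -ord K x := by
  simp [ord, map_inv₀, WithZero.log_inv]

@[simp] theorem ord_neg (x : K) : ord K (-x) = ord K x := by simp [ord, Valuation.map_neg]

theorem ord_pow {x : K} (hx : x ≠ 0) (n : ℕ) : ord K (x ^ n) = n * ord K x := by
  induction n with
  | zero => simp
  | succ n ih => rw [pow_succ, ord_mul (pow_ne_zero _ hx) hx, ih]; push_cast; ring

theorem ord_prod {ι : Type*} (s : Finset ι) (f : ι → K) (hf : ∀ i ∈ s, f i ≠ 0) :
    ord K (∏ i ∈ s, f i) = ∑ i ∈ s, ord K (f i) := by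
  classical
  induction s using Finset.induction_on with
  | empty => simp
  | insert a s ha ih =>
    rw [Finset.prod_insert ha, Finset.sum_insert ha, ord_mul (hf a (by simp))
      (Finset.prod_ne_zero_iff.2 fun i hi => hf i (by simp [hi])),
      ih fun i hi => hf i (by simp [hi])]

theorem mem_integer_iff {x : K} : x ∈ 𝒪[K] ↔ x = 0 ∨ 0 ≤ ord K x := by
  by_cases hx : x = 0
  · simp [hx]
  have h1 : vint K (ValuativeRel.valuation K x) ≠ 0 := by simpa using hx
  have h2 : x ∈ 𝒪[K] ↔ ValuativeRel.valuation K x ≤ 1 := Iff.rfl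
  rw [h2, ← map_le_map_iff (vint K), map_one, ← WithZero.log_le_log h1 one_ne_zero]
  simp [hx, ord]

theorem mem_integer_iff_of_ne {x : K} (hx : x ≠ 0) : x ∈ 𝒪[K] ↔ 0 ≤ ord K x := by
  simp [mem_integer_iff, hx]

theorem exists_ord_eq (n : ℤ) : ∃ x : Kˣ, ord K (x : K) = n := by
  obtain ⟨y, hy⟩ := ValuativeRel.valuation_surjective ((vint K).symm (WithZero.exp (-n)))
  have hy0 : y ≠ 0 := by
    rintro rfl
    have h := congrArg (vint K) hy
    rw [map_zero, map_zero, OrderMonoidIso.apply_symm_apply] at h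
    exact WithZero.exp_ne_zero h.symm
  exact ⟨Units.mk0 y hy0, by simp [ord, hy]⟩

theorem mul_mem_integer_iff {x c : K} (hx : x ≠ 0) (hc : c ≠ 0) :
    c * x ∈ 𝒪[K] ↔ -ord K c ≤ ord K x := by
  rw [mem_integer_iff_of_ne (mul_ne_zero hc hx), ord_mul hc hx]; constructor <;> intro h <;> linarith

theorem resCard_gt_one : 1 < resCard K := by
  have : Nontrivial 𝓀[K] := inferInstance
  exact Finite.one_lt_card

theorem absK_of_ne {x : K} (hx : x ≠ 0) : absK K x = (resCard K : ℝ) ^ (-ord K x) := by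
  simp [absK, hx]

/-! ### Topology -/

instance instT2SpaceLocalField : T2Space K := by
  apply IsTopologicalAddGroup.t2Space_of_zero_sep
  intro x hx
  refine ⟨{y | ValuativeRel.valuation K y < ValuativeRel.valuation K x},
    (IsValuativeTopology.hasBasis_nhds_zero' K).mem_of_mem (by simpa using hx), by simp⟩

theorem isCompact_integer : IsCompact (𝒪[K] : Set K) :=
  isCompact_iff_compactSpace.mpr (inferInstanceAs (CompactSpace 𝒪[K]))

theorem isOpen_integer : IsOpen (𝒪[K] : Set K) := by
  have h : (𝒪[K] : Set K) ∈ nhds (0 : K) := by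
    refine Filter.mem_of_superset
      ((IsValuativeTopology.hasBasis_nhds_zero' K).mem_of_mem (one_ne_zero)) ?_
    intro x hx
    exact le_of_lt (show ValuativeRel.valuation K x < 1 from hx)
  exact AddSubgroup.isOpen_of_mem_nhds (Subring.toAddSubgroup 𝒪[K]) h

theorem hasBasis_nhds_zero_ord :
    (nhds (0 : K)).HasBasis (fun _ : ℕ => True) (fun n => {x | x = 0 ∨ (n : ℤ) ≤ ord K x}) := by
  refine ⟨fun t => ?_⟩
  constructor
  · intro ht
    obtain ⟨γ, hγ, h⟩ := (IsValuativeTopology.hasBasis_nhds_zero' K).mem_iff.1 ht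
    obtain ⟨c, rfl⟩ := ValuativeRel.valuation_surjective γ
    have hc : c ≠ 0 := by simpa using hγ
    refine ⟨(ord K c + 1).toNat, trivial, fun x hx => h ?_⟩
    rcases hx with rfl | hx
    · simpa [zero_lt_iff] using hc
    by_cases hx0 : x = 0
    · simpa [hx0, zero_lt_iff] using hc
    have h1 : vint K (ValuativeRel.valuation K x) ≠ 0 := by simpa using hx0
    have h2 : vint K (ValuativeRel.valuation K c) ≠ 0 := by simpa using hc
    change ValuativeRel.valuation K x < ValuativeRel.valuation K c
    rw [← map_lt_map_iff (vint K), ← WithZero.log_lt_log h1 h2]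
    have := Int.self_le_toNat (ord K c + 1)
    simp only [ord] at hx this
    linarith
  · rintro ⟨n, -, h⟩
    obtain ⟨c, hc⟩ := exists_ord_eq (K := K) (-n)
    have h1 : (fun x : K => (c : K) * x) ⁻¹' (𝒪[K] : Set K) ∈ nhds (0 : K) :=
      (isOpen_integer.preimage (continuous_const_mul (c : K))).mem_nhds (by simp)
    refine Filter.mem_of_superset h1 fun x hx => h ?_
    by_cases hx0 : x = 0
    · exact Or.inl hx0
    · right
      have := (mul_mem_integer_iff hx0 c.ne_zero).1 hx
      rw [hc] at this; simpa using this

theorem exists_mul_integer (x : K) : ∃ n : ℕ, ∀ c : K, c ≠ 0 → (n : ℤ) ≤ ord K c → c * x ∈ 𝒪[K] := by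
  by_cases hx : x = 0
  · exact ⟨0, by simp [hx]⟩
  · refine ⟨(-ord K x).toNat, fun c hc h => (mul_mem_integer_iff hx hc).2 ?_⟩
    have := Int.self_le_toNat (-ord K x)
    linarith

instance instSecondCountableLocalField : SecondCountableTopology K := by
  letI := IsTopologicalAddGroup.rightUniformSpace K
  haveI := isUniformAddGroup_of_addCommGroup (G := K)
  haveI : (nhds (0 : K)).IsCountablyGenerated := hasBasis_nhds_zero_ord.isCountablyGenerated
  haveI := IsUniformAddGroup.uniformity_countably_generated (α := K)
  letI := UniformSpace.pseudoMetricSpace K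
  haveI : SigmaCompactSpace K := by
    choose c hc using fun n : ℕ => exists_ord_eq (K := K) n
    refine ⟨⟨fun n => (fun x => (c n : K)⁻¹ * x) '' (𝒪[K] : Set K),
      fun n => isCompact_integer.image (continuous_const_mul _), ?_⟩⟩
    refine Set.eq_univ_of_forall fun x => ?_
    obtain ⟨n, hn⟩ := exists_mul_integer x
    exact Set.mem_iUnion.2 ⟨n, c n * x, hn _ (c n).ne_zero (hc n).ge, by simp⟩
  exact EMetric.secondCountable_of_sigmaCompact K

instance instLocallyCompactMatrix (m n : ℕ) : LocallyCompactSpace (Matrix (Fin m) (Fin n) K) :=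
  inferInstanceAs (LocallyCompactSpace (Fin m → Fin n → K))

instance instSecondCountableMatrix (m n : ℕ) :
    SecondCountableTopology (Matrix (Fin m) (Fin n) K) :=
  inferInstanceAs (SecondCountableTopology (Fin m → Fin n → K))

instance instT2Matrix (m n : ℕ) : T2Space (Matrix (Fin m) (Fin n) K) :=
  inferInstanceAs (T2Space (Fin m → Fin n → K))

instance instLocallyCompactGL (n : ℕ) : LocallyCompactSpace (GL (Fin n) K) :=
  inferInstanceAs (LocallyCompactSpace (Matrix (Fin n) (Fin n) K)ˣ)

instance instIsTopologicalGroupGL (n : ℕ) : IsTopologicalGroup (GL (Fin n) K) :=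
  inferInstanceAs (IsTopologicalGroup (Matrix (Fin n) (Fin n) K)ˣ)

instance instT2GL (n : ℕ) : T2Space (GL (Fin n) K) :=
  inferInstanceAs (T2Space (Matrix (Fin n) (Fin n) K)ˣ)

instance instSecondCountableGL (n : ℕ) : SecondCountableTopology (GL (Fin n) K) := by
  haveI : SecondCountableTopology (Matrix (Fin n) (Fin n) K)ᵐᵒᵖ :=
    MulOpposite.opHomeomorph.symm.isEmbedding.secondCountableTopology
  exact (Units.isEmbedding_embedProduct (M := Matrix (Fin n) (Fin n) K)).secondCountableTopology

theorem continuous_GL_val {n : ℕ} : Continuous (fun g : GL (Fin n) K => g.val) :=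
  Units.continuous_val

theorem isOpen_intMat (m n : ℕ) : IsOpen (intMat K m n) := by
  have : intMat K m n = ⋂ i, ⋂ j, (fun X : Matrix (Fin m) (Fin n) K => X i j) ⁻¹' (𝒪[K] : Set K) := by
    ext X; simp [intMat]
  rw [this]
  exact isOpen_iInter_of_finite fun i => isOpen_iInter_of_finite fun j =>
    isOpen_integer.preimage (continuous_id.matrix_elem i j)

theorem isCompact_intMat (m n : ℕ) : IsCompact (intMat K m n) := by
  have : intMat K m n = Set.univ.pi fun _ => Set.univ.pi fun _ => (𝒪[K] : Set K) := by
    ext X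
    exact ⟨fun h i _ j _ => h i j, fun h i j => h i trivial j trivial⟩
  rw [this]
  exact isCompact_univ_pi fun _ => isCompact_univ_pi fun _ => isCompact_integer

theorem intMat_mul {l m n : ℕ} {A : Matrix (Fin l) (Fin m) K} {B : Matrix (Fin m) (Fin n) K}
    (hA : A ∈ intMat K l m) (hB : B ∈ intMat K m n) : A * B ∈ intMat K l n := fun i j => by
  rw [Matrix.mul_apply]
  exact sum_mem fun k _ => mul_mem (hA i k) (hB k j)

theorem intMat_add {m n : ℕ} {A B : Matrix (Fin m) (Fin n) K}
    (hA : A ∈ intMat K m n) (hB : B ∈ intMat K m n) : A + B ∈ intMat K m n := fun i j =>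
  add_mem (hA i j) (hB i j)

theorem intMat_one (n : ℕ) : (1 : Matrix (Fin n) (Fin n) K) ∈ intMat K n n := fun i j => by
  rw [Matrix.one_apply]; split_ifs
  · exact one_mem _
  · exact zero_mem _

theorem det_mem_integer {n : ℕ} {A : Matrix (Fin n) (Fin n) K} (hA : A ∈ intMat K n n) :
    A.det ∈ 𝒪[K] := by
  rw [Matrix.det_apply]
  refine sum_mem fun τ _ => ?_
  rw [Units.smul_def]
  exact zsmul_mem (prod_mem fun i _ => hA _ _) _

theorem mem_maxK_iff {n : ℕ} {g : GL (Fin n) K} :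
    g ∈ maxK K n ↔ g.val ∈ intMat K n n ∧ (g⁻¹).val ∈ intMat K n n := by
  constructor
  · rintro ⟨k, rfl⟩
    refine ⟨fun i j => (k.val i j).2, fun i j => ?_⟩
    rw [← map_inv]
    exact ((k⁻¹).val i j).2
  · rintro ⟨h1, h2⟩
    have hinj : Function.Injective
        (fun A : Matrix (Fin n) (Fin n) 𝒪[K] => A.map (𝒪[K]).subtype) :=
      Matrix.map_injective Subtype.val_injective
    refine ⟨⟨Matrix.of fun i j => ⟨g.val i j, h1 i j⟩, Matrix.of fun i j => ⟨(g⁻¹).val i j, h2 i j⟩,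
      hinj ?_, hinj ?_⟩, ?_⟩
    · change ((Matrix.of fun i j => (⟨g.val i j, h1 i j⟩ : 𝒪[K])) *
        (Matrix.of fun i j => (⟨(g⁻¹).val i j, h2 i j⟩ : 𝒪[K]))).map (𝒪[K]).subtype =
          (1 : Matrix (Fin n) (Fin n) 𝒪[K]).map (𝒪[K]).subtype
      rw [Matrix.map_mul, Matrix.map_one _ (map_zero _) (map_one _)]
      exact g.mul_inv
    · change ((Matrix.of fun i j => (⟨(g⁻¹).val i j, h2 i j⟩ : 𝒪[K])) *
        (Matrix.of fun i j => (⟨g.val i j, h1 i j⟩ : 𝒪[K]))).map (𝒪[K]).subtype =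
          (1 : Matrix (Fin n) (Fin n) 𝒪[K]).map (𝒪[K]).subtype
      rw [Matrix.map_mul, Matrix.map_one _ (map_zero _) (map_one _)]
      exact g.inv_mul
    · apply Units.ext; ext i j; rfl

theorem det_ne_zero_GL {n : ℕ} (g : GL (Fin n) K) : g.val.det ≠ 0 :=
  (Matrix.isUnit_det_of_left_inverse g.inv_val).ne_zero

theorem det_inv_GL {n : ℕ} (g : GL (Fin n) K) : (g⁻¹).val.det = (g.val.det)⁻¹ := by
  have h : (g⁻¹).val.det * g.val.det = 1 := by rw [← Matrix.det_mul, g.inv_mul, Matrix.det_one]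
  exact eq_inv_of_mul_eq_one_left h

theorem ord_det_of_mem_maxK {n : ℕ} {g : GL (Fin n) K} (hg : g ∈ maxK K n) :
    ord K g.val.det = 0 := by
  obtain ⟨h1, h2⟩ := mem_maxK_iff.1 hg
  have h3 := (mem_integer_iff_of_ne (det_ne_zero_GL g)).1 (det_mem_integer h1)
  have h4 := (mem_integer_iff_of_ne (det_ne_zero_GL g⁻¹)).1 (det_mem_integer h2)
  rw [det_inv_GL, ord_inv] at h4
  omega

theorem ord_det_mul_GL {n : ℕ} (g h : GL (Fin n) K) :
    ord K (g * h).val.det = ord K g.val.det + ord K h.val.det := by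
  rw [Units.val_mul, Matrix.det_mul, ord_mul (det_ne_zero_GL g) (det_ne_zero_GL h)]

theorem ord_det_inv_GL {n : ℕ} (g : GL (Fin n) K) :
    ord K (g⁻¹).val.det = -ord K g.val.det := by
  rw [det_inv_GL, ord_inv]

theorem maxK_eq_preimage (n : ℕ) : (maxK K n : Set (GL (Fin n) K)) =
    {g | g.val ∈ intMat K n n ∧ (g⁻¹).val ∈ intMat K n n} := by
  ext g; exact mem_maxK_iff

theorem isOpen_maxK (n : ℕ) : IsOpen (maxK K n : Set (GL (Fin n) K)) := by
  rw [maxK_eq_preimage]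
  exact ((isOpen_intMat n n).preimage continuous_GL_val).inter
    ((isOpen_intMat n n).preimage (continuous_GL_val.comp continuous_inv))

/-- The invertible matrices `g` such that `c g` and `c g⁻¹` are integral form a compact set. -/
theorem isCompact_GL_bounded (n : ℕ) {c : K} (hc : c ≠ 0) :
    IsCompact {g : GL (Fin n) K | c • g.val ∈ intMat K n n ∧ c • (g⁻¹).val ∈ intMat K n n} := by
  have h1 : IsCompact ((fun X : Matrix (Fin n) (Fin n) K => c • X) ⁻¹' intMat K n n) := by
    have : ((fun X : Matrix (Fin n) (Fin n) K => c • X) ⁻¹' intMat K n n) =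
        (fun X : Matrix (Fin n) (Fin n) K => c⁻¹ • X) '' intMat K n n := by
      ext X; constructor
      · intro h; exact ⟨_, h, by simp [smul_smul, hc]⟩
      · rintro ⟨Y, hY, rfl⟩; simpa [smul_smul, hc] using hY
    rw [this]
    exact (isCompact_intMat n n).image (continuous_const_smul _)
  have h2 := h1.prod ((h1.image MulOpposite.continuous_op))
  have h3 := (Units.isClosedEmbedding_embedProduct
    (α := Matrix (Fin n) (Fin n) K)).isCompact_preimage h2
  convert h3 using 1
  ext g
  constructor
  · exact fun h => ⟨h.1, _, h.2, rfl⟩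
  · rintro ⟨h1, Y, h2, h3⟩
    have h4 : Y = (g⁻¹).val := MulOpposite.op_injective h3
    exact ⟨h1, h4 ▸ h2⟩

theorem isCompact_maxK (n : ℕ) : IsCompact (maxK K n : Set (GL (Fin n) K)) := by
  rw [maxK_eq_preimage]
  simpa using isCompact_GL_bounded (K := K) n one_ne_zero

end LocalBasics


section HaarGeneral

variable {G : Type*} [Group G] [TopologicalSpace G] [IsTopologicalGroup G] [LocallyCompactSpace G]
  [MeasurableSpace G] [BorelSpace G]

/-! ### Normalized Haar measures -/

theorem normalizedHaar_spec {C : Set G} (hC : IsCompact C) (ho : IsOpen C) (hn : C.Nonempty) :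
    (normalizedHaar G C).IsHaarMeasure ∧ normalizedHaar G C C = 1 := by
  have h : ∃ μ : Measure G, μ.IsHaarMeasure ∧ μ C = 1 :=
    ⟨Measure.haarMeasure ⟨⟨C, hC⟩, by simpa [ho.interior_eq] using hn⟩, inferInstance,
      Measure.haarMeasure_self (K₀ := ⟨⟨C, hC⟩, by simpa [ho.interior_eq] using hn⟩)⟩
  rw [normalizedHaar, dif_pos h]
  exact h.choose_spec

theorem normalizedAddHaar_spec {A : Type*} [AddGroup A] [TopologicalSpace A]
    [IsTopologicalAddGroup A] [LocallyCompactSpace A] [MeasurableSpace A] [BorelSpace A]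
    {C : Set A} (hC : IsCompact C) (ho : IsOpen C) (hn : C.Nonempty) :
    (normalizedAddHaar A C).IsAddHaarMeasure ∧ normalizedAddHaar A C C = 1 := by
  have h : ∃ μ : Measure A, μ.IsAddHaarMeasure ∧ μ C = 1 :=
    ⟨Measure.addHaarMeasure ⟨⟨C, hC⟩, by simpa [ho.interior_eq] using hn⟩, inferInstance,
      Measure.addHaarMeasure_self (K₀ := ⟨⟨C, hC⟩, by simpa [ho.interior_eq] using hn⟩)⟩
  rw [normalizedAddHaar, dif_pos h]
  exact h.choose_spec

@[to_additive]
theorem haar_unique_of_eq [SecondCountableTopology G] {μ ν : Measure G} [μ.IsHaarMeasure]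
    [ν.IsHaarMeasure] {C : Set G} (h0 : μ C ≠ 0) (hT : μ C ≠ ⊤) (h : ν C = μ C) : ν = μ := by
  have h1 := Measure.isMulLeftInvariant_eq_smul ν μ
  have h2 : (ν.haarScalarFactor μ) = 1 := by
    rw [h1] at h
    simp only [Measure.smul_apply, ENNReal.smul_def, smul_eq_mul] at h
    have h3 := (ENNReal.mul_eq_right h0 hT).1 h
    exact_mod_cast h3
  rw [h1, h2, one_smul]

theorem normalizedHaar_eq_zero {C : Set G}
    (h : ¬ ∃ μ : Measure G, μ.IsHaarMeasure ∧ μ C = 1) : normalizedHaar G C = 0 := by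
  rw [normalizedHaar, dif_neg h]

/-! ### Integrals of functions that are invariant under an open subgroup -/

variable [SecondCountableTopology G]

@[to_additive countable_addQuotient_of_isOpen]
theorem countable_quotient_of_isOpen {K : Subgroup G} (hK : IsOpen (K : Set G)) :
    Countable (G ⧸ K) := by
  haveI := QuotientGroup.discreteTopology hK
  haveI : SecondCountableTopology (G ⧸ K) := inferInstance
  exact (TopologicalSpace.separableSpace_iff_countable).1 inferInstance

@[to_additive integral_eq_tsum_addQuotient]
theorem integral_eq_tsum_quotient {μ : Measure G} [μ.IsMulLeftInvariant] {K : Subgroup G}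
    (hK : IsOpen (K : Set G)) (hμ : μ K = 1) (φ : G → ℂ)
    (hφ : ∀ g, ∀ k ∈ K, φ (g * k) = φ g) :
    ∫ g, φ g ∂μ = ∑' x : G ⧸ K, φ x.out := by
  haveI := countable_quotient_of_isOpen hK
  have hdisc : ∀ s : Set (G ⧸ K), MeasurableSet s := fun s => by
    haveI := QuotientGroup.discreteTopology hK
    have h1 : IsOpen ((QuotientGroup.mk : G → G ⧸ K) ⁻¹' s) :=
      (isOpen_discrete s).preimage continuous_quot_mk
    exact h1.measurableSet
  haveI : DiscreteMeasurableSpace (G ⧸ K) := ⟨hdisc⟩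
  have hmk : Measurable (QuotientGroup.mk : G → G ⧸ K) := fun s hs => hs
  have hmap : μ.map (QuotientGroup.mk : G → G ⧸ K) = Measure.count := by
    apply Measure.ext_of_singleton
    intro x
    rw [Measure.map_apply hmk (hdisc _), Measure.count_singleton]
    have : (QuotientGroup.mk : G → G ⧸ K) ⁻¹' {x} = (fun g => x.out⁻¹ * g) ⁻¹' (K : Set G) := by
      ext g
      simp only [Set.mem_preimage, Set.mem_singleton_iff]
      rw [eq_comm, ← QuotientGroup.out_eq' x]
      rw [QuotientGroup.eq]
      simp
    rw [this, measure_preimage_mul, hμ]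
  have hfac : φ = (fun x : G ⧸ K => φ x.out) ∘ (QuotientGroup.mk : G → G ⧸ K) := by
    funext g
    have h1 : ((g : G ⧸ K).out)⁻¹ * g ∈ K := by
      rw [← QuotientGroup.eq, QuotientGroup.out_eq']
    have h2 := hφ (g : G ⧸ K).out _ h1
    rw [mul_inv_cancel_left] at h2
    exact h2
  have h3 : ∫ g, φ g ∂μ = ∫ x : G ⧸ K, φ x.out ∂Measure.count := by
    rw [← hmap, integral_map hmk.aemeasurable (Measurable.of_discrete).aestronglyMeasurable]
    conv_lhs => rw [hfac]
    rfl
  rw [h3]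
  by_cases hs : Summable (fun x : G ⧸ K => φ x.out)
  · have hi : Integrable (fun x : G ⧸ K => φ x.out) Measure.count := by
      rw [integrable_count_iff]; exact hs.norm
    rw [integral_countable hi]
    simp [Measure.real]
  · rw [tsum_eq_zero_of_not_summable hs]
    apply integral_undef
    rw [integrable_count_iff]
    exact fun h => hs h.of_norm

/-! ### Unimodular groups -/

theorem map_mul_right_eq_smul (μ : Measure G) [μ.IsHaarMeasure] (g : G) :
    μ.map (· * g) = Measure.modularCharacterFun g • μ := by
  rw [Measure.modularCharacterFun_eq_haarScalarFactor μ g]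
  exact Measure.isMulLeftInvariant_eq_smul _ μ

open scoped Pointwise in
/-- The modular character is trivial on elements whose powers stay in a compact set. -/
theorem modularCharacter_eq_one_of_pow_mem {g : G} {D : Set G} (hD : IsCompact D)
    (hg : ∀ m : ℕ, g ^ m ∈ D) : Measure.modularCharacter g = 1 := by
  have key : ∀ (x : G) (D : Set G), IsCompact D → (∀ m : ℕ, x ^ m ∈ D) →
      1 ≤ Measure.modularCharacter x := by
    intro x D hD hx
    obtain ⟨C, hC, hC1⟩ := exists_compact_mem_nhds (1 : G)
    let μ : Measure G := Measure.haar
    have hC0 : μ C ≠ 0 := (Measure.measure_pos_of_mem_nhds μ hC1).ne'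
    have hfin : μ (C * D) ≠ ⊤ := (hC.mul hD).measure_ne_top
    have hpow : ∀ m : ℕ, μ C ≤ (Measure.modularCharacter x ^ m : NNReal) * μ (C * D) := by
      intro m
      have h1 := congrArg (fun ν => ν (C * D)) (map_mul_right_eq_smul μ (x ^ m))
      simp only [Measure.smul_apply, ENNReal.smul_def, smul_eq_mul] at h1
      have h2 : Measure.modularCharacterFun (x ^ m) = Measure.modularCharacter x ^ m := by
        rw [← map_pow]; rfl
      rw [h2, show (fun y : G => y * x ^ m) = Homeomorph.mulRight (x ^ m) from rfl,
        (Homeomorph.mulRight (x ^ m)).measurableEmbedding.map_apply] at h1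
      rw [← h1]
      exact measure_mono fun c hc => Set.mul_mem_mul hc (hx m)
    by_contra hlt
    push Not at hlt
    have hlim : Filter.Tendsto (fun m : ℕ =>
        ((Measure.modularCharacter x ^ m : NNReal) : ENNReal) * μ (C * D)) Filter.atTop (nhds 0) := by
      have h1 := NNReal.tendsto_pow_atTop_nhds_zero_of_lt_one hlt
      have h2 : Filter.Tendsto (fun m : ℕ =>
        ((Measure.modularCharacter x ^ m : NNReal) : ENNReal)) Filter.atTop (nhds 0) := by
        rw [← ENNReal.coe_zero]
        exact ENNReal.tendsto_coe.2 h1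
      have h3 := ENNReal.Tendsto.mul_const h2 (b := μ (C * D)) (Or.inr hfin)
      simpa using h3
    exact hC0 (le_antisymm (ge_of_tendsto' hlim hpow) bot_le)
  have h1 := key g D hD hg
  have h2 := key g⁻¹ D⁻¹ hD.inv fun m => by simpa using hg m
  have h3 : Measure.modularCharacter g * Measure.modularCharacter g⁻¹ = 1 := by
    rw [← map_mul, mul_inv_cancel, map_one]
  refine le_antisymm ?_ h1
  calc Measure.modularCharacter g ≤ Measure.modularCharacter g * Measure.modularCharacter g⁻¹ :=
        le_mul_of_one_le_right zero_le h2
    _ = 1 := h3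

theorem isMulRightInvariant_of_modularCharacter
    (h : ∀ g : G, Measure.modularCharacter g = 1) (μ : Measure G) [μ.IsHaarMeasure] :
    μ.IsMulRightInvariant := ⟨fun g => by
  rw [map_mul_right_eq_smul μ g, show Measure.modularCharacterFun g = 1 from h g, one_smul]⟩

open scoped Pointwise in
theorem isInvInvariant_of_isMulRightInvariant (μ : Measure G) [μ.IsHaarMeasure]
    [μ.IsMulRightInvariant] : μ.IsInvInvariant := by
  refine ⟨?_⟩
  obtain ⟨C, hC, hC1⟩ := exists_compact_mem_nhds (1 : G)
  haveI : (μ.inv).IsHaarMeasure := {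
    lt_top_of_isCompact := fun K hK => by
      rw [Measure.inv_apply]; exact hK.inv.measure_lt_top
    open_pos := fun U hU hne => by
      rw [Measure.inv_apply]
      exact (hU.inv.measure_pos μ (by simpa using hne)).ne' }
  have hD : C ∩ C⁻¹ ∈ nhds (1 : G) := Filter.inter_mem hC1 (by simpa using inv_mem_nhds_one G hC1)
  refine haar_unique_of_eq (C := C ∩ C⁻¹) (Measure.measure_pos_of_mem_nhds μ hD).ne'
    (ne_top_of_le_ne_top hC.measure_ne_top (measure_mono Set.inter_subset_left)) ?_
  rw [Measure.inv_apply, Set.inter_inv, inv_inv, Set.inter_comm]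

end HaarGeneral


section OrbitalIntegrals

/-! ### Quotient measures through section functions -/

section Quotient

variable {G : Type*} [Group G] [TopologicalSpace G] [IsTopologicalGroup G] [LocallyCompactSpace G]
  [SecondCountableTopology G] [T2Space G] [MeasurableSpace G] [BorelSpace G]

/-- Weil's formula, for a function `w` with `∫_T w(gt) dt = 1`. -/
def WeilFormula (μ : Measure G) (T : Subgroup G) (μT : Measure T) (w : G → ENNReal) : Prop :=
  ∀ Θ : G → ENNReal, Measurable Θ →
    ∫⁻ g, w g * ∫⁻ t : T, Θ (g * t) ∂μT ∂μ = ∫⁻ g, Θ g ∂μ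

theorem measurable_lintegral_mul_subgroup {T : Subgroup G} {μT : Measure T} [SFinite μT]
    {Θ : G → ENNReal} (hΘ : Measurable Θ) : Measurable fun g => ∫⁻ t : T, Θ (g * t) ∂μT := by
  have h : Measurable fun p : G × T => Θ (p.1 * p.2) :=
    hΘ.comp (measurable_fst.mul (measurable_subtype_coe.comp measurable_snd))
  exact h.lintegral_prod_right'

theorem lintegral_out_mul {T : Subgroup G} {μT : Measure T} [μT.IsMulLeftInvariant]
    (Θ : G → ENNReal) (g : G) :
    ∫⁻ t : T, Θ ((g : G ⧸ T).out * t) ∂μT = ∫⁻ t : T, Θ (g * t) ∂μT := by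
  have h1 : ((g : G ⧸ T).out)⁻¹ * g ∈ T := by rw [← QuotientGroup.eq, QuotientGroup.out_eq']
  rw [← lintegral_mul_left_eq_self (fun t : T => Θ ((g : G ⧸ T).out * t)) ⟨_, h1⟩]
  simp [mul_assoc]

theorem isQuotientMeasure_unique {μ : Measure G} {T : Subgroup G} {μT : Measure T}
    [μT.IsMulLeftInvariant] {w : G → ENNReal} (hw : Measurable w)
    (hw1 : ∀ g, ∫⁻ t : T, w (g * t) ∂μT = 1) {ν : Measure (G ⧸ T)}
    (hν : IsQuotientMeasure μ T μT ν) : ν = (μ.withDensity w).map QuotientGroup.mk := by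
  have hmk : Measurable (QuotientGroup.mk : G → G ⧸ T) := fun s hs => hs
  ext S hS
  rw [Measure.map_apply hmk hS, withDensity_apply _ (hmk hS)]
  have h := hν (((QuotientGroup.mk : G → G ⧸ T) ⁻¹' S).indicator w) (hw.indicator (hmk hS))
  rw [lintegral_indicator (hmk hS)] at h
  rw [← h, ← setLIntegral_one, ← lintegral_indicator hS]
  refine lintegral_congr fun x => ?_
  have hx : ∀ t : T, ((x.out * t : G) : G ⧸ T) = x := fun t => by
    rw [QuotientGroup.mk_mul_of_mem _ t.2, QuotientGroup.out_eq']
  by_cases hxS : x ∈ S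
  · rw [Set.indicator_of_mem hxS, ← hw1 x.out]
    exact lintegral_congr fun t => (Set.indicator_of_mem (by simpa [hx] using hxS) _).symm
  · rw [Set.indicator_of_notMem hxS, ← lintegral_zero (μ := μT)]
    exact lintegral_congr fun t => (Set.indicator_of_notMem (by simpa [hx] using hxS) _).symm

theorem isQuotientMeasure_map_withDensity_iff {μ : Measure G} {T : Subgroup G} {μT : Measure T}
    [μT.IsMulLeftInvariant] [SFinite μT] {w : G → ENNReal} (hw : Measurable w) :
    IsQuotientMeasure μ T μT ((μ.withDensity w).map QuotientGroup.mk) ↔ WeilFormula μ T μT w := by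
  have hmk : Measurable (QuotientGroup.mk : G → G ⧸ T) := fun s hs => hs
  refine forall₂_congr fun Θ hΘ => ?_
  have hm := measurable_lintegral_mul_subgroup (μT := μT) hΘ
  have hm' : Measurable fun x : G ⧸ T => ∫⁻ t : T, Θ (x.out * t) ∂μT := by
    intro s hs
    have : (QuotientGroup.mk : G → G ⧸ T) ⁻¹' ((fun x : G ⧸ T => ∫⁻ t : T, Θ (x.out * t) ∂μT) ⁻¹' s)
        = (fun g => ∫⁻ t : T, Θ (g * t) ∂μT) ⁻¹' s := by
      ext g; simp [lintegral_out_mul]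
    exact (this ▸ hm hs : MeasurableSet
      ((QuotientGroup.mk : G → G ⧸ T) ⁻¹' ((fun x : G ⧸ T => ∫⁻ t : T, Θ (x.out * t) ∂μT) ⁻¹' s)))
  rw [lintegral_map hm' hmk]
  simp only [lintegral_out_mul]
  rw [lintegral_withDensity_eq_lintegral_mul _ hw hm]
  rfl

open Classical in
theorem quotientMeasure_eq {μ : Measure G} {T : Subgroup G} {μT : Measure T}
    [μT.IsMulLeftInvariant] [SFinite μT] {w : G → ENNReal} (hw : Measurable w)
    (hw1 : ∀ g, ∫⁻ t : T, w (g * t) ∂μT = 1) :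
    quotientMeasure μ T μT =
      if WeilFormula μ T μT w then (μ.withDensity w).map QuotientGroup.mk else 0 := by
  rw [quotientMeasure]
  split_ifs with h1 h2 h2
  · exact isQuotientMeasure_unique hw hw1 h1.choose_spec
  · refine absurd ((isQuotientMeasure_map_withDensity_iff hw).1 ?_) h2
    rw [← isQuotientMeasure_unique hw hw1 h1.choose_spec]
    exact h1.choose_spec
  · exact absurd ⟨_, (isQuotientMeasure_map_withDensity_iff hw).2 h2⟩ h1
  · rfl

theorem quotientMeasure_zero {μ : Measure G} [NeZero μ] {T : Subgroup G} :
    quotientMeasure μ T 0 = 0 := by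
  rw [quotientMeasure, dif_neg]
  rintro ⟨ν, hν⟩
  have h := hν 1 measurable_one
  have h2 : μ Set.univ = 0 := by simpa using h.symm
  exact NeZero.ne μ (Measure.measure_univ_eq_zero.1 h2)

/-- Section functions exist for closed subgroups of groups with a compact open subgroup. -/
theorem exists_section {K T : Subgroup G} (hK : IsOpen (K : Set G)) (hKc : IsCompact (K : Set G))
    (hT : IsClosed (T : Set G)) (μT : Measure T) [μT.IsHaarMeasure] [SFinite μT] :
    ∃ w : G → ENNReal, Measurable w ∧ ∀ g, ∫⁻ t : T, w (g * t) ∂μT = 1 := by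
  haveI := countable_quotient_of_isOpen hK
  have hdisc : ∀ s : Set (G ⧸ K), MeasurableSet s := fun s => by
    haveI := QuotientGroup.discreteTopology hK
    have h1 : IsOpen ((QuotientGroup.mk : G → G ⧸ K) ⁻¹' s) :=
      (isOpen_discrete s).preimage continuous_quot_mk
    exact h1.measurableSet
  haveI : DiscreteMeasurableSpace (G ⧸ K) := ⟨hdisc⟩
  have hmk : Measurable (QuotientGroup.mk : G → G ⧸ K) := fun s hs => hs
  obtain ⟨a, ha0, hasum⟩ := ENNReal.exists_pos_sum_of_countable' one_ne_zero (G ⧸ K)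
  let w0 : G → ENNReal := fun g => a (g : G ⧸ K)
  have hw0 : Measurable w0 := (Measurable.of_discrete (f := a)).comp hmk
  let W : G → ENNReal := fun g => ∫⁻ t : T, w0 (g * t) ∂μT
  have hW : Measurable W := measurable_lintegral_mul_subgroup hw0
  let c : ENNReal := μT ((↑) ⁻¹' (K : Set G))
  have hc : c ≠ 0 := ((hK.preimage continuous_subtype_val).measure_pos μT ⟨1, by simp⟩).ne'
  have hcT : c ≠ ⊤ := (hT.isClosedEmbedding_subtypeVal.isCompact_preimage hKc).measure_ne_top
  have hWsum : ∀ g, W g = ∑' x : G ⧸ K, a x * μT {t : T | ((g * t : G) : G ⧸ K) = x} := by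
    intro g
    have hm : Measurable fun t : T => ((g * t : G) : G ⧸ K) :=
      hmk.comp (measurable_subtype_coe.const_mul g)
    have h1 : W g = ∫⁻ x, a x ∂(μT.map fun t : T => ((g * t : G) : G ⧸ K)) := by
      rw [lintegral_map Measurable.of_discrete hm]
    rw [h1, lintegral_countable']
    refine tsum_congr fun x => ?_
    rw [Measure.map_apply hm (hdisc _)]
    rfl
  have hle : ∀ g x, μT {t : T | ((g * t : G) : G ⧸ K) = x} ≤ c := by
    intro g x
    rcases Set.eq_empty_or_nonempty {t : T | ((g * t : G) : G ⧸ K) = x} with h | ⟨t0, ht0⟩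
    · rw [h]; simp
    · have h1 : {t : T | ((g * t : G) : G ⧸ K) = x} ⊆
          (fun t => t0⁻¹ * t) ⁻¹' ((↑) ⁻¹' (K : Set G)) := by
        intro t ht
        have h2 : ((g * t0 : G) : G ⧸ K) = ((g * t : G) : G ⧸ K) := ht0.trans ht.symm
        rw [QuotientGroup.eq] at h2
        simpa [mul_assoc] using h2
      calc _ ≤ μT ((fun t => t0⁻¹ * t) ⁻¹' ((↑) ⁻¹' (K : Set G))) := measure_mono h1
        _ = c := measure_preimage_mul _ _ _
  have hWtop : ∀ g, W g ≠ ⊤ := by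
    intro g
    rw [hWsum]
    refine ne_top_of_le_ne_top (ENNReal.mul_ne_top
      (ne_top_of_lt hasum) hcT) ?_
    rw [← ENNReal.tsum_mul_right]
    exact ENNReal.tsum_le_tsum fun x => mul_le_mul_right (hle g x) _
  have hWpos : ∀ g, W g ≠ 0 := by
    intro g
    rw [hWsum]
    refine fun h => ?_
    have h1 := ENNReal.tsum_eq_zero.1 h (g : G ⧸ K)
    have h2 : {t : T | ((g * t : G) : G ⧸ K) = (g : G ⧸ K)} = (↑) ⁻¹' (K : Set G) := by
      ext t
      simp only [Set.mem_ofPred_eq, Set.mem_preimage]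
      rw [eq_comm, QuotientGroup.eq]
      simp
    rw [h2] at h1
    exact (mul_ne_zero (ha0 _).ne' hc) h1
  refine ⟨fun g => w0 g * (W g)⁻¹, hw0.mul hW.inv, fun g => ?_⟩
  have hWinv : ∀ t : T, W (g * t) = W g := fun t => by
    simp only [W]
    rw [← lintegral_mul_left_eq_self (fun s : T => w0 (g * s)) t]
    simp [mul_assoc]
  simp only [hWinv]
  rw [lintegral_mul_const' _ _ (ENNReal.inv_ne_top.2 (hWpos g))]
  exact ENNReal.mul_inv_cancel (hWpos g) (hWtop g)

end Quotient

end OrbitalIntegrals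


section OrbitalIntegralTransfer

/-! ### Comparison of orbital integrals for two groups -/

theorem mem_stab {G Y : Type*} [Group G] {ρ : G →* Equiv.Perm Y} {y : Y} {g : G} :
    g ∈ stab ρ y ↔ ρ g y = y := Iff.rfl

theorem image_compactElements {T T' : Type*} [Group T] [TopologicalSpace T] [Group T']
    [TopologicalSpace T'] (E : T' ≃ₜ* T) :
    E ⁻¹' compactElements T = compactElements T' := by
  ext t
  constructor
  · rintro ⟨K, hK, ht⟩
    refine ⟨K.comap E.toMulEquiv.toMonoidHom, ?_, ht⟩
    exact E.toHomeomorph.isClosedEmbedding.isCompact_preimage hK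
  · rintro ⟨K, hK, ht⟩
    exact ⟨K.map E.toMulEquiv.toMonoidHom, hK.image E.continuous, t, ht, rfl⟩

section Haar

variable {T T' : Type*} [Group T] [TopologicalSpace T] [IsTopologicalGroup T]
  [LocallyCompactSpace T] [SecondCountableTopology T] [MeasurableSpace T] [BorelSpace T]
  [Group T'] [TopologicalSpace T'] [IsTopologicalGroup T'] [MeasurableSpace T'] [BorelSpace T']

theorem map_normalizedHaar (E : T' ≃ₜ* T) :
    (normalizedHaar T' (compactElements T')).map E = normalizedHaar T (compactElements T) := by
  have hm : ∀ (μ : Measure T') (s : Set T), μ.map E s = μ (E ⁻¹' s) := fun μ s =>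
    E.toHomeomorph.measurableEmbedding.map_apply μ s
  have hm' : ∀ (μ : Measure T) (s : Set T'), μ.map E.symm s = μ (E.symm ⁻¹' s) := fun μ s =>
    E.symm.toHomeomorph.measurableEmbedding.map_apply μ s
  by_cases h' : ∃ μ : Measure T', μ.IsHaarMeasure ∧ μ (compactElements T') = 1
  · have h1 : (normalizedHaar T' (compactElements T')).IsHaarMeasure ∧
        normalizedHaar T' (compactElements T') (compactElements T') = 1 := by
      rw [normalizedHaar, dif_pos h']; exact h'.choose_spec
    haveI := h1.1
    have h2 : ((normalizedHaar T' (compactElements T')).map E).IsHaarMeasure :=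
      E.toMulEquiv.isHaarMeasure_map _ E.continuous E.symm.continuous
    have h3 : (normalizedHaar T' (compactElements T')).map E (compactElements T) = 1 := by
      rw [hm, image_compactElements, h1.2]
    have h : ∃ μ : Measure T, μ.IsHaarMeasure ∧ μ (compactElements T) = 1 := ⟨_, h2, h3⟩
    have h4 : (normalizedHaar T (compactElements T)).IsHaarMeasure ∧
        normalizedHaar T (compactElements T) (compactElements T) = 1 := by
      rw [normalizedHaar, dif_pos h]; exact h.choose_spec
    haveI := h4.1
    exact haar_unique_of_eq (C := compactElements T) (by rw [h4.2]; exact one_ne_zero)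
      (by rw [h4.2]; exact ENNReal.one_ne_top) (by rw [h3, h4.2])
  · have h : ¬ ∃ μ : Measure T, μ.IsHaarMeasure ∧ μ (compactElements T) = 1 := by
      rintro ⟨μ, hμ, h1⟩
      refine h' ⟨μ.map E.symm, E.symm.toMulEquiv.isHaarMeasure_map _ E.symm.continuous
        E.continuous, ?_⟩
      rw [hm', image_compactElements E.symm, h1]
    rw [normalizedHaar, dif_neg h', normalizedHaar, dif_neg h, Measure.map_zero]

end Haar

variable {G Y : Type*} [Group G] [TopologicalSpace G] [IsTopologicalGroup G]
  [LocallyCompactSpace G] [SecondCountableTopology G] [T2Space G] [MeasurableSpace G]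
  [BorelSpace G]

open Classical in
theorem orbInt_eq_of_section (μ : Measure G) (ρ : G →* Equiv.Perm Y) (f : Y → ℂ)
    (F : Y → ENNReal) (y : Y) (hf : ∀ g, f (ρ g y) = ((F (ρ g y)).toReal : ℂ))
    (hF : ∀ g, F (ρ g y) ≠ ⊤) (hFm : Measurable fun g => F (ρ g y))
    (μT : Measure (stab ρ y)) (hμT : μT = normalizedHaar _ (compactElements (stab ρ y)))
    [μT.IsMulLeftInvariant] [SFinite μT] {w : G → ENNReal} (hw : Measurable w)
    (hw1 : ∀ g, ∫⁻ t : stab ρ y, w (g * t) ∂μT = 1) :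
    orbInt μ ρ f y = if WeilFormula μ (stab ρ y) μT w
      then ((∫⁻ g, w g * F (ρ g y) ∂μ).toReal : ℂ) else 0 := by
  rw [orbInt, ← hμT, quotientMeasure_eq hw hw1]
  split_ifs with h
  · have hmk : Measurable (QuotientGroup.mk : G → G ⧸ stab ρ y) := fun s hs => hs
    have hout : ∀ g : G, ρ (g : G ⧸ stab ρ y).out y = ρ g y := fun g => by
      have h1 : ((g : G ⧸ stab ρ y).out)⁻¹ * g ∈ stab ρ y := by
        rw [← QuotientGroup.eq, QuotientGroup.out_eq']
      rw [mem_stab, map_mul, Equiv.Perm.mul_apply] at h1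
      rw [map_inv, Equiv.Perm.inv_eq_iff_eq] at h1
      exact h1.symm
    have hm' : Measurable fun x : G ⧸ stab ρ y => F (ρ x.out y) := by
      intro s hs
      have : (QuotientGroup.mk : G → G ⧸ stab ρ y) ⁻¹'
          ((fun x : G ⧸ stab ρ y => F (ρ x.out y)) ⁻¹' s) = (fun g => F (ρ g y)) ⁻¹' s := by
        ext g; simp [hout]
      exact (this ▸ hFm hs : MeasurableSet ((QuotientGroup.mk : G → G ⧸ stab ρ y) ⁻¹'
          ((fun x : G ⧸ stab ρ y => F (ρ x.out y)) ⁻¹' s)))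
    simp only [hf]
    rw [integral_complex_ofReal, integral_toReal hm'.aemeasurable
      (Filter.Eventually.of_forall fun x => (hF _).lt_top), lintegral_map hm' hmk]
    simp only [hout]
    rw [lintegral_withDensity_eq_lintegral_mul _ hw hFm]
    rfl
  · simp

theorem orbInt_eq_zero_of_not_exists (μ : Measure G) [NeZero μ] (ρ : G →* Equiv.Perm Y)
    (f : Y → ℂ) (y : Y) (h : normalizedHaar _ (compactElements (stab ρ y)) = 0) :
    orbInt μ ρ f y = 0 := by
  rw [orbInt, h, quotientMeasure_zero, integral_zero_measure]

/-- If `G' = G × H`, and the stabilizers of `X` in `G'` and of `y` in `G` are identified via the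
projection to `G`, then the orbital integral of `f'` over the orbit of `X` is the orbital integral
over the orbit of `y` of the function obtained from `f'` by integration over `H`. -/
theorem orbInt_transfer {G' H Y' : Type*}
    [Group G'] [TopologicalSpace G'] [IsTopologicalGroup G']
    [LocallyCompactSpace G'] [SecondCountableTopology G'] [T2Space G'] [MeasurableSpace G']
    [BorelSpace G']
    [Group H] [TopologicalSpace H] [IsTopologicalGroup H]
    [LocallyCompactSpace H] [SecondCountableTopology H] [T2Space H] [MeasurableSpace H]
    [BorelSpace H]
    (μ : Measure G) [μ.IsHaarMeasure] [μ.IsMulRightInvariant]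
    (μH : Measure H) [μH.IsHaarMeasure] [μH.IsMulRightInvariant] (μ' : Measure G')
    (e : G' ≃ₜ* G × H) (he : μ'.map e = μ.prod μH)
    (ρ : G →* Equiv.Perm Y) (ρ' : G' →* Equiv.Perm Y') (y : Y) (X : Y') (g₀ : G)
    (E : stab ρ' X ≃ₜ* stab ρ y)
    (hE : ∀ t, (E t : G) = g₀ * (e t).1 * g₀⁻¹)
    {K : Subgroup G} (hK : IsOpen (K : Set G)) (hKc : IsCompact (K : Set G))
    (hT : IsClosed (stab ρ y : Set G))
    (f : Y → ℂ) (F : Y → ENNReal) (hf : ∀ g, f (ρ g y) = ((F (ρ g y)).toReal : ℂ))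
    (hF : ∀ g, F (ρ g y) ≠ ⊤) (hFm : Measurable fun g => F (ρ g y))
    (f' : Y' → ℂ) (F' : Y' → ENNReal) (hf' : ∀ X, f' X = ((F' X).toReal : ℂ))
    (hF' : ∀ X, F' X ≠ ⊤) (hFm' : Measurable fun g => F' (ρ' g X))
    (hFF' : ∀ g : G, ∫⁻ h, F' (ρ' (e.symm (g, h)) X) ∂μH = F (ρ (g * g₀⁻¹) y)) :
    orbInt μ' ρ' f' X = orbInt μ ρ f y := by
  have hem : Measurable e := e.continuous.measurable
  have hesm : Measurable e.symm := e.symm.continuous.measurable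
  have hμ' : μ' = (μ.prod μH).map e.symm := by
    rw [← he, Measure.map_map hesm hem]
    have : e.symm ∘ e = id := by ext; simp
    rw [this, Measure.map_id]
  haveI : μ'.IsHaarMeasure := by
    rw [hμ']
    exact e.symm.toMulEquiv.isHaarMeasure_map _ e.symm.continuous e.continuous
  haveI : NeZero μ := inferInstance
  haveI : NeZero μ' := inferInstance
  haveI : LocallyCompactSpace (stab ρ y) := hT.isClosedEmbedding_subtypeVal.locallyCompactSpace
  haveI : SecondCountableTopology (stab ρ y) :=
    Topology.IsEmbedding.subtypeVal.secondCountableTopology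
  have hmapE := map_normalizedHaar E
  have hEm : Measurable E := E.continuous.measurable
  have hEsm : Measurable E.symm := E.symm.continuous.measurable
  by_cases hex : ∃ μ : Measure (stab ρ y), μ.IsHaarMeasure ∧ μ (compactElements (stab ρ y)) = 1
  swap
  · have h0 := normalizedHaar_eq_zero hex
    rw [orbInt_eq_zero_of_not_exists μ ρ f y h0]
    apply orbInt_eq_zero_of_not_exists
    rw [h0] at hmapE
    exact (Measure.map_eq_zero_iff hEm.aemeasurable).1 hmapE
  obtain ⟨μT, hμT⟩ : ∃ μT, μT = normalizedHaar _ (compactElements (stab ρ y)) := ⟨_, rfl⟩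
  obtain ⟨μT', hμT'⟩ : ∃ μT', μT' = normalizedHaar _ (compactElements (stab ρ' X)) := ⟨_, rfl⟩
  rw [← hμT, ← hμT'] at hmapE
  haveI hHaar : μT.IsHaarMeasure := by
    rw [hμT, normalizedHaar, dif_pos hex]; exact hex.choose_spec.1
  have hmapE' : μT' = μT.map E.symm := by
    rw [← hmapE, Measure.map_map hEsm hEm]
    have : E.symm ∘ E = id := by ext; simp
    rw [this, Measure.map_id]
  haveI : μT'.IsHaarMeasure := by
    rw [hmapE']
    exact E.symm.toMulEquiv.isHaarMeasure_map _ E.symm.continuous E.continuous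
  haveI : SFinite μT' := by rw [hmapE']; infer_instance
  obtain ⟨w, hw, hw1⟩ := exists_section hK hKc hT μT
  let w' : G' → ENNReal := fun g' => w ((e g').1 * g₀⁻¹)
  have hw' : Measurable w' := hw.comp ((measurable_fst.comp hem).mul_const _)
  have hcongr : ∀ Θ : G → ENNReal, ∀ Θ' : G' → ENNReal, ∀ g', Measurable Θ →
      (∀ t : stab ρ' X, Θ' (g' * t) = Θ ((e g').1 * g₀⁻¹ * (E t : G))) →
      ∫⁻ t : stab ρ' X, Θ' (g' * t) ∂μT' =
        ∫⁻ t : stab ρ y, Θ ((e g').1 * g₀⁻¹ * t) ∂μT := by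
    intro Θ Θ' g' hΘ h
    have hm : Measurable fun t : stab ρ y => Θ ((e g').1 * g₀⁻¹ * t) :=
      hΘ.comp (measurable_subtype_coe.const_mul _)
    rw [← hmapE, lintegral_map hm hEm]
    exact lintegral_congr h
  have hw1' : ∀ g', ∫⁻ t : stab ρ' X, w' (g' * t) ∂μT' = 1 := fun g' => by
    rw [hcongr w w' g' hw fun t => by simp [w', hE, mul_assoc], hw1]
  -- integration over `H`
  let I : (G' → ENNReal) → G → ENNReal := fun Θ' g => ∫⁻ h, Θ' (e.symm (g * g₀, h)) ∂μH
  have hIm : ∀ Θ' : G' → ENNReal, Measurable Θ' → Measurable (I Θ') := fun Θ' hΘ' => by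
    have h1 : Measurable fun p : G × H => Θ' (e.symm (p.1 * g₀, p.2)) :=
      hΘ'.comp (hesm.comp ((measurable_fst.mul_const _).prodMk measurable_snd))
    exact h1.lintegral_prod_right'
  have hIint : ∀ Θ' : G' → ENNReal, Measurable Θ' → ∀ v : G → ENNReal, Measurable v →
      ∫⁻ g', v ((e g').1 * g₀⁻¹) * Θ' g' ∂μ' = ∫⁻ g, v g * I Θ' g ∂μ := by
    intro Θ' hΘ' v hv
    have h1 : Measurable fun p : G × H => v (p.1 * g₀⁻¹) * Θ' (e.symm p) :=
      (hv.comp (measurable_fst.mul_const _)).mul (hΘ'.comp hesm)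
    calc ∫⁻ g', v ((e g').1 * g₀⁻¹) * Θ' g' ∂μ'
        = ∫⁻ p, v (p.1 * g₀⁻¹) * Θ' (e.symm p) ∂(μ.prod μH) := by
          rw [← he, lintegral_map h1 hem]; simp
      _ = ∫⁻ g, ∫⁻ h, v (g * g₀⁻¹) * Θ' (e.symm (g, h)) ∂μH ∂μ :=
          lintegral_prod _ h1.aemeasurable
      _ = ∫⁻ g, v (g * g₀⁻¹) * ∫⁻ h, Θ' (e.symm (g, h)) ∂μH ∂μ := by
          refine lintegral_congr fun g => lintegral_const_mul _ ?_
          exact hΘ'.comp (hesm.comp measurable_prodMk_left)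
      _ = ∫⁻ g, v g * I Θ' g ∂μ := by
          rw [← lintegral_mul_right_eq_self _ g₀]
          simp [I]
  let θ : stab ρ y → H := fun t => (e (E.symm t : G')).2
  have hθm : Measurable θ := measurable_snd.comp (hem.comp (measurable_subtype_coe.comp
    hEsm))
  have hweil : ∀ Θ' : G' → ENNReal, Measurable Θ' →
      ∫⁻ g', w' g' * ∫⁻ t : stab ρ' X, Θ' (g' * t) ∂μT' ∂μ' =
        ∫⁻ g, w g * ∫⁻ t : stab ρ y, I Θ' (g * t) ∂μT ∂μ := by
    intro Θ' hΘ'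
    rw [hIint _ (measurable_lintegral_mul_subgroup hΘ') w hw]
    refine lintegral_congr fun g => ?_
    congr 1
    change ∫⁻ h, ∫⁻ t : stab ρ' X, Θ' (e.symm (g * g₀, h) * t) ∂μT' ∂μH = _
    have h1 : ∀ h : H, ∫⁻ t : stab ρ' X, Θ' (e.symm (g * g₀, h) * t) ∂μT' =
        ∫⁻ t : stab ρ y, Θ' (e.symm (g * t * g₀, h * θ t)) ∂μT := by
      intro h
      have h2 : Measurable fun t : stab ρ y => Θ' (e.symm (g * t * g₀, h * θ t)) :=
        hΘ'.comp (hesm.comp (((measurable_subtype_coe.const_mul _).mul_const _).prodMk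
          (hθm.const_mul h)))
      rw [← hmapE, lintegral_map h2 hEm]
      refine lintegral_congr fun t => ?_
      congr 1
      apply e.injective
      rw [map_mul]
      ext
      · simp [hE, mul_assoc]
      · simp [θ]
    simp only [h1]
    have h3 : Measurable fun p : H × stab ρ y => Θ' (e.symm (g * p.2 * g₀, p.1 * θ p.2)) :=
      hΘ'.comp (hesm.comp ((((measurable_subtype_coe.comp measurable_snd).const_mul _).mul_const
        _).prodMk (measurable_fst.mul (hθm.comp measurable_snd))))
    rw [lintegral_lintegral_swap h3.aemeasurable]
    refine lintegral_congr fun t => ?_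
    exact lintegral_mul_right_eq_self (fun h => Θ' (e.symm (g * t * g₀, h))) (θ t)
  have hint : ∀ Θ' : G' → ENNReal, Measurable Θ' → ∫⁻ g', Θ' g' ∂μ' = ∫⁻ g, I Θ' g ∂μ := by
    intro Θ' hΘ'
    have := hIint Θ' hΘ' (fun _ => 1) measurable_const
    simpa using this
  have hiff : WeilFormula μ' (stab ρ' X) μT' w' ↔ WeilFormula μ (stab ρ y) μT w := by
    constructor
    · intro h Θ hΘ
      obtain ⟨C, hC, hC1⟩ := exists_compact_mem_nhds (1 : H)
      have hc0 : μH C ≠ 0 := (Measure.measure_pos_of_mem_nhds μH hC1).ne'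
      have hcT : μH C ≠ ⊤ := hC.measure_ne_top
      let Θ' : G' → ENNReal := fun g' => Θ ((e g').1 * g₀⁻¹) * C.indicator 1 (e g').2
      have hΘ' : Measurable Θ' := (hΘ.comp ((measurable_fst.comp hem).mul_const _)).mul
        ((measurable_one.indicator hC.measurableSet).comp (measurable_snd.comp hem))
      have hI : I Θ' = fun g => Θ g * μH C := by
        funext g
        simp only [I, Θ']
        simp only [ContinuousMulEquiv.apply_symm_apply, mul_inv_cancel_right]
        rw [lintegral_const_mul _ (measurable_one.indicator hC.measurableSet),
          lintegral_indicator_one hC.measurableSet]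
      have h1 := h Θ' hΘ'
      rw [hweil Θ' hΘ', hint Θ' hΘ', hI, lintegral_mul_const _ hΘ] at h1
      have h2 : ∫⁻ g, w g * ∫⁻ t : stab ρ y, Θ (g * t) * μH C ∂μT ∂μ =
          (∫⁻ g, w g * ∫⁻ t : stab ρ y, Θ (g * t) ∂μT ∂μ) * μH C := by
        have hm : Measurable fun g => w g * ∫⁻ t : stab ρ y, Θ (g * t) ∂μT :=
          hw.mul (measurable_lintegral_mul_subgroup hΘ)
        rw [← lintegral_mul_const _ hm]
        refine lintegral_congr fun g => ?_
        have hm' : Measurable fun t : stab ρ y => Θ (g * t) :=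
          hΘ.comp (measurable_subtype_coe.const_mul g)
        rw [lintegral_mul_const _ hm', mul_assoc]
      rw [h2] at h1
      exact (ENNReal.mul_left_inj hc0 hcT).1 h1
    · intro h Θ' hΘ'
      rw [hweil Θ' hΘ', hint Θ' hΘ']
      exact h _ (hIm Θ' hΘ')
  classical
  rw [orbInt_eq_of_section μ' ρ' f' F' X (fun g => hf' _) (fun g => hF' _) hFm' μT' hμT' hw' hw1',
    orbInt_eq_of_section μ ρ f F y hf hF hFm μT hμT hw hw1]
  simp only [hiff]
  congr 3
  rw [hIint _ hFm' w hw]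
  refine lintegral_congr fun g => ?_
  simp only [I]
  rw [hFF', mul_inv_cancel_right]

end OrbitalIntegralTransfer


section Cartan

variable {K : Type*} [Field K] [ValuativeRel K] [TopologicalSpace K] [IsNonarchimedeanLocalField K]

/-! ### The Cartan decomposition of integral matrices -/

theorem exists_smith {R : Type*} [CommRing R] [IsDomain R] [IsPrincipalIdealRing R] {n : ℕ}
    (A : Matrix (Fin n) (Fin n) R) (hA : A.det ≠ 0) (v : R → ℕ) :
    ∃ (P B : GL (Fin n) R) (a : Fin n → R), Antitone (fun i => v (a i)) ∧
      A * P.val = B.val * Matrix.diagonal a := by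
  have hinj : Function.Injective A.mulVecLin := by
    rw [← LinearMap.ker_eq_bot, LinearMap.ker_eq_bot']
    exact fun x hx => Matrix.eq_zero_of_mulVec_eq_zero hA hx
  let e := LinearEquiv.ofInjective A.mulVecLin hinj
  obtain ⟨b, a, c, h⟩ := Submodule.exists_smith_normal_form_of_rank_eq (Pi.basisFun R (Fin n))
    (N := LinearMap.range A.mulVecLin) e.symm.finrank_eq
  let s := Tuple.sort fun i => OrderDual.toDual (v (a i))
  let b' := b.reindex s.symm
  let p := (c.map e.symm).reindex s.symm
  let toGL : Module.Basis (Fin n) R (Fin n → R) → GL (Fin n) R := fun b =>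
    ⟨(Pi.basisFun R (Fin n)).toMatrix b, b.toMatrix (Pi.basisFun R (Fin n)),
      Module.Basis.toMatrix_mul_toMatrix_flip _ _, Module.Basis.toMatrix_mul_toMatrix_flip _ _⟩
  have htoGL : ∀ b i j, (toGL b).val i j = b j i := fun b i j => by
    simp [toGL, Module.Basis.toMatrix_apply]
  refine ⟨toGL p, toGL b', a ∘ s, fun i j hij => Tuple.monotone_sort
    (fun i => OrderDual.toDual (v (a i))) hij, ?_⟩
  ext i j
  rw [Matrix.mul_diagonal, Matrix.mul_apply, htoGL]
  simp only [htoGL]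
  have h1 : A.mulVec (p j) = a (s j) • b (s j) := by
    rw [← h (s j)]
    have : ((e (e.symm (c (s j))) : LinearMap.range A.mulVecLin) : Fin n → R) = c (s j) := by simp
    rw [← this]
    simp only [p, Module.Basis.coe_reindex, Function.comp, Module.Basis.map_apply,
      Equiv.symm_symm]
    rfl
  have h2 := congrFun h1 i
  simp only [Matrix.mulVec, dotProduct, Pi.smul_apply, smul_eq_mul] at h2
  rw [h2, mul_comm]
  simp [b']

theorem map_subtype_mem_maxK {n : ℕ} (k : GL (Fin n) 𝒪[K]) :
    Matrix.GeneralLinearGroup.map (n := Fin n) (𝒪[K]).subtype k ∈ maxK K n := ⟨k, rfl⟩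

theorem exists_mem_doubleCoset {n : ℕ} {g : GL (Fin n) K} (hg : g.val ∈ intMat K n n) :
    ∃ l : Fin n → ℕ, Antitone l ∧ g ∈ doubleCoset l := by
  let A : Matrix (Fin n) (Fin n) 𝒪[K] := Matrix.of fun i j => ⟨g.val i j, hg i j⟩
  have hAg : A.map (𝒪[K]).subtype = g.val := by ext i j; rfl
  have hdet : ((A.det : 𝒪[K]) : K) = g.val.det := by
    rw [← hAg]; exact RingHom.map_det (𝒪[K]).subtype A
  have hA : A.det ≠ 0 := fun h => det_ne_zero_GL g (by rw [← hdet, h]; rfl)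
  obtain ⟨P, B, a, ha, h⟩ := exists_smith A hA fun x => (ord K (x : K)).toNat
  have ha0 : ∀ i, (a i : K) ≠ 0 := by
    intro i hi
    have h1 := congrArg Matrix.det h
    rw [Matrix.det_mul, Matrix.det_mul, Matrix.det_diagonal,
      Finset.prod_eq_zero (Finset.mem_univ i) (Subtype.ext hi), mul_zero] at h1
    exact (mul_ne_zero hA (Matrix.isUnit_det_of_left_inverse P.inv_val).ne_zero) h1
  let Q := Matrix.GeneralLinearGroup.map (n := Fin n) (𝒪[K]).subtype P
  let C := Matrix.GeneralLinearGroup.map (n := Fin n) (𝒪[K]).subtype B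
  have h2 : g.val * Q.val = C.val * Matrix.diagonal (fun i => (a i : K)) := by
    have h1 := congrArg (fun M : Matrix (Fin n) (Fin n) 𝒪[K] => M.map (𝒪[K]).subtype) h
    simp only [Matrix.map_mul] at h1
    rw [hAg] at h1
    change g.val * Q.val = C.val * (Matrix.diagonal a).map (𝒪[K]).subtype at h1
    rw [h1, Matrix.diagonal_map (map_zero _)]
    rfl
  refine ⟨fun i => (ord K (a i : K)).toNat, ha, C, map_subtype_mem_maxK B, Q⁻¹,
    inv_mem (map_subtype_mem_maxK P), fun i => Units.mk0 _ (ha0 i), fun i => ?_, ?_⟩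
  · exact (Int.toNat_of_nonneg ((mem_integer_iff_of_ne (ha0 i)).1 (a i).2)).symm
  · simp only [Units.val_mk0]
    rw [← h2, mul_assoc, Q.mul_inv, mul_one]

theorem le_of_mem_doubleCoset {n : ℕ} {g : GL (Fin n) K} {l l' : Fin n → ℕ} (hl : Antitone l)
    (hl' : Antitone l') (hg : g ∈ doubleCoset l) (hg' : g ∈ doubleCoset l') : l' ≤ l := by
  obtain ⟨k, hk, k₁, hk₁, t, ht, e⟩ := hg
  obtain ⟨h, hh, h₁, hh₁, t', ht', e'⟩ := hg'
  intro r
  by_contra hr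
  replace hr : l r < l' r := not_le.1 hr
  obtain ⟨c, hc⟩ := exists_ord_eq (K := K) 1
  have hA : h⁻¹ * k ∈ maxK K n := mul_mem (inv_mem hh) hk
  have hB : h₁ * k₁⁻¹ ∈ maxK K n := mul_mem hh₁ (inv_mem hk₁)
  have hAi := (mem_maxK_iff.1 hA).1
  have hBi := (mem_maxK_iff.1 hB).1
  have key : (h⁻¹ * k).val * Matrix.diagonal (fun i => (t i : K)) =
      Matrix.diagonal (fun i => (t' i : K)) * (h₁ * k₁⁻¹).val := by
    rw [Units.val_mul, Units.val_mul]
    calc (h⁻¹).val * k.val * Matrix.diagonal (fun i => (t i : K))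
        = (h⁻¹).val * (k.val * Matrix.diagonal (fun i => (t i : K)) * k₁.val) * (k₁⁻¹).val := by
          simp only [mul_assoc]; rw [k₁.mul_inv, mul_one]
      _ = (h⁻¹).val * (h.val * Matrix.diagonal (fun i => (t' i : K)) * h₁.val) * (k₁⁻¹).val := by
          rw [← e, e']
      _ = _ := by
          simp only [← mul_assoc]; rw [h.inv_mul, one_mul]
  have hsmall : ∀ i j, i ≤ r → r ≤ j → (c : K)⁻¹ * (h⁻¹ * k).val i j ∈ 𝒪[K] := by
    intro i j hi hj
    have h1 := congrFun (congrFun key i) j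
    rw [Matrix.mul_diagonal, Matrix.diagonal_mul] at h1
    have h2 : (c : K)⁻¹ * (h⁻¹ * k).val i j =
        ((c : K)⁻¹ * t' i * (t j : K)⁻¹) * (h₁ * k₁⁻¹).val i j := by
      rw [(eq_mul_inv_iff_mul_eq₀ (t j).ne_zero).2 h1]; ring
    rw [h2]
    refine mul_mem ((mem_integer_iff_of_ne ?_).2 ?_) (hBi i j)
    · exact mul_ne_zero (mul_ne_zero (inv_ne_zero c.ne_zero) (t' i).ne_zero)
        (inv_ne_zero (t j).ne_zero)
    · rw [ord_mul (mul_ne_zero (inv_ne_zero c.ne_zero) (t' i).ne_zero)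
        (inv_ne_zero (t j).ne_zero), ord_mul (inv_ne_zero c.ne_zero) (t' i).ne_zero, ord_inv,
        ord_inv, hc, ht, ht']
      have := hl' hi
      have := hl hj
      omega
  have hdet : (c : K)⁻¹ * (h⁻¹ * k).val.det ∈ 𝒪[K] := by
    rw [Matrix.det_apply, Finset.mul_sum]
    refine sum_mem fun τ _ => ?_
    rw [Units.smul_def, mul_smul_comm]
    refine zsmul_mem ?_ _
    obtain ⟨i, hi, hi'⟩ : ∃ i, τ i ≤ r ∧ r ≤ i := by
      by_contra! hcon
      have h1 : (Finset.Ici r).card ≤ (Finset.Ioi r).card :=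
        Finset.card_le_card_of_injOn τ (fun i hi => by
          simp only [Finset.coe_Ioi, Set.mem_Ioi]
          by_contra! h2
          exact absurd (Finset.mem_Ici.1 hi) (not_le.2 (hcon i h2))) τ.injective.injOn
      have := r.isLt
      simp at h1
      omega
    rw [← Finset.mul_prod_erase _ _ (Finset.mem_univ i), ← mul_assoc]
    exact mul_mem (hsmall _ _ hi hi') (prod_mem fun j _ => hAi _ _)
  rw [mem_integer_iff_of_ne (mul_ne_zero (inv_ne_zero c.ne_zero) (det_ne_zero_GL _)),
    ord_mul (inv_ne_zero c.ne_zero) (det_ne_zero_GL _), ord_inv, hc,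
    ord_det_of_mem_maxK hA] at hdet
  omega

theorem eq_of_mem_doubleCoset {n : ℕ} {g : GL (Fin n) K} {l l' : Fin n → ℕ} (hl : Antitone l)
    (hl' : Antitone l') (hg : g ∈ doubleCoset l) (hg' : g ∈ doubleCoset l') : l = l' :=
  le_antisymm (le_of_mem_doubleCoset hl' hl hg' hg) (le_of_mem_doubleCoset hl hl' hg hg')

theorem ord_det_of_mem_doubleCoset {n : ℕ} {g : GL (Fin n) K} {l : Fin n → ℕ}
    (hg : g ∈ doubleCoset l) : g.val ∈ intMat K n n ∧ ord K g.val.det = ∑ i, (l i : ℤ) := by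
  obtain ⟨k, hk, k₁, hk₁, t, ht, e⟩ := hg
  have hd : (Matrix.diagonal (fun i => (t i : K))).det ≠ 0 := by
    rw [Matrix.det_diagonal]; exact Finset.prod_ne_zero_iff.2 fun i _ => (t i).ne_zero
  constructor
  · rw [e]
    refine intMat_mul (intMat_mul (mem_maxK_iff.1 hk).1 fun i j => ?_) (mem_maxK_iff.1 hk₁).1
    rw [Matrix.diagonal_apply]
    split_ifs
    · exact (mem_integer_iff_of_ne (t i).ne_zero).2 (by rw [ht]; positivity)
    · exact zero_mem _
  · rw [e, Matrix.det_mul, Matrix.det_mul, ord_mul (mul_ne_zero (det_ne_zero_GL k) hd)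
      (det_ne_zero_GL k₁), ord_mul (det_ne_zero_GL k) hd, ord_det_of_mem_maxK hk,
      ord_det_of_mem_maxK hk₁, Matrix.det_diagonal, ord_prod _ _ fun i _ => (t i).ne_zero]
    simp [ht]

open Classical in
/-- `𝟏_d` is the indicator function of the integral matrices whose determinant has valuation `d`. -/
theorem oneD_eq (n d : ℕ) (g : GL (Fin n) K) :
    oneD K n d g = if g.val ∈ intMat K n n ∧ ord K g.val.det = d then 1 else 0 := by
  rw [oneD]
  split_ifs with h
  · obtain ⟨l, hl, hgl⟩ := exists_mem_doubleCoset h.1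
    have hld : l ∈ domWeights n d := by
      have h1 := (ord_det_of_mem_doubleCoset hgl).2
      rw [h.2] at h1
      simp only [domWeights, Finset.mem_filter, Finset.mem_piAntidiag]
      exact ⟨⟨by exact_mod_cast h1.symm, fun i _ => Finset.mem_univ i⟩, hl⟩
    rw [Finset.sum_eq_single_of_mem l hld]
    · simp [hgl]
    · intro l' hl' hne
      refine Set.indicator_of_notMem (fun hg' => hne ?_) _
      exact eq_of_mem_doubleCoset (Finset.mem_filter.1 hl').2 hl hg' hgl
  · refine Finset.sum_eq_zero fun l hl => Set.indicator_of_notMem (fun hg => h ?_) _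
    obtain ⟨h1, h2⟩ := ord_det_of_mem_doubleCoset hg
    refine ⟨h1, h2.trans ?_⟩
    have h3 := (Finset.mem_piAntidiag.1 (Finset.mem_filter.1 hl).1).1
    exact_mod_cast h3

end Cartan


section Blocks

/-! ### Block matrices -/

variable {R : Type*} [CommRing R] {a b : ℕ}

@[simp] theorem blk_castAdd_castAdd (A : Matrix (Fin a) (Fin a) R) (B C D) (i j : Fin a) :
    blk (b := b) A B C D (Fin.castAdd b i) (Fin.castAdd b j) = A i j := by
  simp [blk]

@[simp] theorem blk_castAdd_natAdd (A : Matrix (Fin a) (Fin a) R) (B C D) (i : Fin a) (j : Fin b) :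
    blk A B C D (Fin.castAdd b i) (Fin.natAdd a j) = B i j := by
  simp [blk]

@[simp] theorem blk_natAdd_castAdd (A : Matrix (Fin a) (Fin a) R) (B C D) (i : Fin b) (j : Fin a) :
    blk A B C D (Fin.natAdd a i) (Fin.castAdd b j) = C i j := by
  simp [blk]

@[simp] theorem blk_natAdd_natAdd (A : Matrix (Fin a) (Fin a) R) (B C D) (i j : Fin b) :
    blk A B C D (Fin.natAdd a i) (Fin.natAdd a j) = D i j := by
  simp [blk]

theorem blk_ext {M N : Matrix (Fin (a + b)) (Fin (a + b)) R}
    (h₁₁ : ∀ i j, M (Fin.castAdd b i) (Fin.castAdd b j) = N (Fin.castAdd b i) (Fin.castAdd b j))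
    (h₁₂ : ∀ i j, M (Fin.castAdd b i) (Fin.natAdd a j) = N (Fin.castAdd b i) (Fin.natAdd a j))
    (h₂₁ : ∀ i j, M (Fin.natAdd a i) (Fin.castAdd b j) = N (Fin.natAdd a i) (Fin.castAdd b j))
    (h₂₂ : ∀ i j, M (Fin.natAdd a i) (Fin.natAdd a j) = N (Fin.natAdd a i) (Fin.natAdd a j)) :
    M = N := by
  ext i j
  refine Fin.addCases (fun i => ?_) (fun i => ?_) i <;>
    refine Fin.addCases (fun j => ?_) (fun j => ?_) j
  · exact h₁₁ i j
  · exact h₁₂ i j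
  · exact h₂₁ i j
  · exact h₂₂ i j

theorem blk_mul (A : Matrix (Fin a) (Fin a) R) (B C) (D : Matrix (Fin b) (Fin b) R) (A' B' C' D') :
    blk A B C D * blk A' B' C' D' =
      blk (A * A' + B * C') (A * B' + B * D') (C * A' + D * C') (C * B' + D * D') := by
  simp only [blk, Matrix.reindex_apply]
  rw [Matrix.submatrix_mul_equiv, Matrix.fromBlocks_multiply]

theorem blk_one : blk (1 : Matrix (Fin a) (Fin a) R) 0 0 (1 : Matrix (Fin b) (Fin b) R) = 1 := by
  simp [blk]

theorem det_blk (A : Matrix (Fin a) (Fin a) R) (B) (D : Matrix (Fin b) (Fin b) R) :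
    (blk A B 0 D).det = A.det * D.det := by
  simp [blk]

theorem blk_diagonal (s : Fin a → R) (t : Fin b → R) :
    blk (Matrix.diagonal s) 0 0 (Matrix.diagonal t) = Matrix.diagonal (Fin.append s t) := by
  apply blk_ext <;> intro i j <;> simp [Matrix.diagonal_apply, Fin.ext_iff] <;> omega

theorem eq_blk (M : Matrix (Fin (a + b)) (Fin (a + b)) R) :
    M = blk (Matrix.of fun i j => M (Fin.castAdd b i) (Fin.castAdd b j))
      (Matrix.of fun i j => M (Fin.castAdd b i) (Fin.natAdd a j))
      (Matrix.of fun i j => M (Fin.natAdd a i) (Fin.castAdd b j))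
      (Matrix.of fun i j => M (Fin.natAdd a i) (Fin.natAdd a j)) := by
  apply blk_ext <;> intro i j <;> simp

theorem blockTriangular_blk {A : Matrix (Fin a) (Fin a) R} {B} {D : Matrix (Fin b) (Fin b) R}
    (hA : A.BlockTriangular id) (hD : D.BlockTriangular id) :
    (blk A B 0 D).BlockTriangular id := by
  intro i j
  refine Fin.addCases (fun i => ?_) (fun i => ?_) i <;>
    refine Fin.addCases (fun j => ?_) (fun j => ?_) j <;> intro h
  · rw [blk_castAdd_castAdd]
    exact hA (show j.val < i.val from h)
  · have h' : a + j.val < i.val := h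
    have := i.isLt
    omega
  · simp
  · rw [blk_natAdd_natAdd]
    have h' : a + j.val < a + i.val := h
    exact hD (show j.val < i.val by omega)

theorem BlockTriangular.mul_apply_self {n : ℕ} {A B : Matrix (Fin n) (Fin n) R}
    (hA : A.BlockTriangular id) (hB : B.BlockTriangular id) (i : Fin n) :
    (A * B) i i = A i i * B i i := by
  rw [Matrix.mul_apply]
  refine Finset.sum_eq_single_of_mem i (Finset.mem_univ i) fun j _ hj => ?_
  rcases lt_or_gt_of_ne hj with h | h
  · rw [hA h, zero_mul]
  · rw [hB h, mul_zero]

end Blocks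

section Iwasawa

variable {K : Type*} [Field K] [ValuativeRel K] [TopologicalSpace K] [IsNonarchimedeanLocalField K]

/-! ### The parabolic subgroup and the Iwasawa decomposition -/

theorem blk_mem_intMat {a b : ℕ} {A : Matrix (Fin a) (Fin a) K} {B C}
    {D : Matrix (Fin b) (Fin b) K} :
    blk A B C D ∈ intMat K (a + b) (a + b) ↔
      A ∈ intMat K a a ∧ B ∈ intMat K a b ∧ C ∈ intMat K b a ∧ D ∈ intMat K b b := by
  constructor
  · intro h
    refine ⟨fun i j => ?_, fun i j => ?_, fun i j => ?_, fun i j => ?_⟩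
    · simpa using h (Fin.castAdd b i) (Fin.castAdd b j)
    · simpa using h (Fin.castAdd b i) (Fin.natAdd a j)
    · simpa using h (Fin.natAdd a i) (Fin.castAdd b j)
    · simpa using h (Fin.natAdd a i) (Fin.natAdd a j)
  · rintro ⟨hA, hB, hC, hD⟩ i j
    refine Fin.addCases (fun i => ?_) (fun i => ?_) i <;>
      refine Fin.addCases (fun j => ?_) (fun j => ?_) j <;> simp
    exacts [hA i j, hB i j, hC i j, hD i j]

theorem zero_mem_intMat (m n : ℕ) : (0 : Matrix (Fin m) (Fin n) K) ∈ intMat K m n :=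
  fun _ _ => zero_mem _

variable {a b : ℕ}

theorem parab_val (m₁ : GL (Fin a) K) (m₂ : GL (Fin b) K) (x : Matrix (Fin a) (Fin b) K) :
    (parab m₁ m₂ x).val = blk m₁.val (m₁.val * x) 0 m₂.val := by
  change blk m₁.val 0 0 m₂.val * blk 1 x 0 1 = _
  rw [blk_mul]; simp

theorem parab_mul (m₁ m₁' : GL (Fin a) K) (m₂ m₂' : GL (Fin b) K) (x x' : Matrix _ _ K) :
    parab m₁ m₂ x * parab m₁' m₂' x' =
      parab (m₁ * m₁') (m₂ * m₂') (x' + (m₁'⁻¹).val * x * m₂'.val) := by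
  apply Units.ext
  rw [Units.val_mul, parab_val, parab_val, parab_val, blk_mul]
  have h : m₁'.val * ((m₁'⁻¹).val * x * m₂'.val) = x * m₂'.val := by
    rw [← Matrix.mul_assoc, ← Matrix.mul_assoc, m₁'.mul_inv, Matrix.one_mul]
  simp only [Units.val_mul, Matrix.mul_zero, Matrix.zero_mul, add_zero, zero_add]
  congr 1
  rw [Matrix.mul_add, Matrix.mul_assoc m₁.val m₁'.val, Matrix.mul_assoc m₁.val m₁'.val, h,
    Matrix.mul_assoc]

theorem parab_one : parab (1 : GL (Fin a) K) (1 : GL (Fin b) K) 0 = 1 := by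
  apply Units.ext
  rw [parab_val]; simp [blk_one]

theorem parab_inv (m₁ : GL (Fin a) K) (m₂ : GL (Fin b) K) (x : Matrix (Fin a) (Fin b) K) :
    (parab m₁ m₂ x)⁻¹ = parab m₁⁻¹ m₂⁻¹ (-(m₁.val * x * (m₂⁻¹).val)) := by
  rw [inv_eq_iff_mul_eq_one, parab_mul]
  simp [parab_one]

theorem parab_mem_maxK {m₁ : GL (Fin a) K} {m₂ : GL (Fin b) K} {x : Matrix (Fin a) (Fin b) K} :
    parab m₁ m₂ x ∈ maxK K (a + b) ↔ m₁ ∈ maxK K a ∧ m₂ ∈ maxK K b ∧ x ∈ intMat K a b := by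
  have h0 : x = (m₁⁻¹).val * (m₁.val * x) := by
    rw [← Matrix.mul_assoc, m₁.inv_mul, Matrix.one_mul]
  rw [mem_maxK_iff, mem_maxK_iff, mem_maxK_iff, parab_inv, parab_val, parab_val, blk_mem_intMat,
    blk_mem_intMat]
  constructor
  · rintro ⟨⟨h1, h2, -, h3⟩, h4, h5, -, h6⟩
    exact ⟨⟨h1, h4⟩, ⟨h3, h6⟩, h0 ▸ intMat_mul h4 h2⟩
  · rintro ⟨⟨h1, h4⟩, ⟨h3, h6⟩, h⟩
    refine ⟨⟨h1, intMat_mul h1 h, zero_mem_intMat _ _, h3⟩, h4, intMat_mul h4 ?_,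
      zero_mem_intMat _ _, h6⟩
    intro i j
    exact neg_mem (intMat_mul (intMat_mul h1 h) h6 i j)

theorem permMatrix_mem_maxK {n : ℕ} (s : Equiv.Perm (Fin n)) :
    ∃ k ∈ maxK K n, k.val = s.permMatrix K := by
  have h : ∀ s : Equiv.Perm (Fin n), s.permMatrix K * (s⁻¹).permMatrix K = 1 := fun s => by
    rw [← Matrix.permMatrix_mul, inv_mul_cancel, Matrix.permMatrix_one]
  have hi : ∀ s : Equiv.Perm (Fin n), s.permMatrix K ∈ intMat K n n := fun s i j => by
    rw [Equiv.Perm.permMatrix, PEquiv.toMatrix_apply]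
    split_ifs
    · exact one_mem _
    · exact zero_mem _
  exact ⟨⟨s.permMatrix K, (s⁻¹).permMatrix K, h s, by simpa using h s⁻¹⟩,
    mem_maxK_iff.2 ⟨hi s, hi s⁻¹⟩, rfl⟩

open Classical in
/-- Reduction of a row vector by column operations over the ring of integers. -/
theorem exists_maxK_vecMul {n : ℕ} (v : Fin (n + 1) → K) :
    ∃ k ∈ maxK K (n + 1), ∀ j : Fin n, (v ᵥ* k.val) (Fin.castAdd 1 j) = 0 := by
  by_cases hv : v = 0
  · exact ⟨1, one_mem _, by simp [hv]⟩
  obtain ⟨i₀, hi₀⟩ : ∃ i, v i ≠ 0 := by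
    by_contra! h; exact hv (funext h)
  obtain ⟨i₁, hi₁, hmin⟩ := Finset.exists_min_image (Finset.univ.filter fun i => v i ≠ 0)
    (fun i => ord K (v i)) ⟨i₀, by simp [hi₀]⟩
  have hv₁ : v i₁ ≠ 0 := (Finset.mem_filter.1 hi₁).2
  obtain ⟨p, hp, hpv⟩ := permMatrix_mem_maxK (K := K)
    (Equiv.swap i₁ (Fin.natAdd n (0 : Fin 1) : Fin (n + 1)))
  let w : Fin (n + 1) → K := v ᵥ* p.val
  have hw : ∀ i, w i = v (Equiv.swap i₁ (Fin.natAdd n (0 : Fin 1)) i) := fun i => by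
    simp only [w, hpv]
    rw [Matrix.vecMul_permMatrix]; simp
  have hw₁ : w (Fin.natAdd n 0) = v i₁ := by rw [hw]; simp
  let r : Matrix (Fin 1) (Fin n) K := Matrix.of fun _ j => -(w (Fin.castAdd 1 j) / v i₁)
  have hr : r ∈ intMat K 1 n := by
    intro i j
    refine neg_mem ?_
    by_cases h0 : w (Fin.castAdd 1 j) = 0
    · rw [h0, zero_div]; exact zero_mem _
    · rw [mem_integer_iff_of_ne (div_ne_zero h0 hv₁), div_eq_mul_inv,
        ord_mul h0 (inv_ne_zero hv₁), ord_inv]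
      rw [hw] at h0 ⊢
      have := hmin _ (Finset.mem_filter.2 ⟨Finset.mem_univ _, h0⟩)
      linarith
  let q : GL (Fin (n + 1)) K := ⟨blk 1 0 r 1, blk 1 0 (-r) 1, by rw [blk_mul]; simp [blk_one],
    by rw [blk_mul]; simp [blk_one]⟩
  have hq : q ∈ maxK K (n + 1) := by
    refine mem_maxK_iff.2 ⟨blk_mem_intMat.2 ⟨intMat_one _, zero_mem_intMat _ _, hr, intMat_one _⟩,
      blk_mem_intMat.2 ⟨intMat_one _, zero_mem_intMat _ _, fun i j => neg_mem (hr i j),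
        intMat_one _⟩⟩
  refine ⟨p * q, mul_mem hp hq, fun j => ?_⟩
  rw [Units.val_mul, ← Matrix.vecMul_vecMul]
  change (w ᵥ* blk 1 0 r 1) (Fin.castAdd 1 j) = 0
  simp only [Matrix.vecMul, dotProduct]
  rw [Fin.sum_univ_add]
  simp only [blk_castAdd_castAdd, blk_natAdd_castAdd, Matrix.one_apply, Fin.sum_univ_one, hw₁, r,
    Matrix.of_apply, mul_ite, mul_one, mul_zero, Finset.sum_ite_eq', Finset.mem_univ, if_true]
  field_simp
  ring

theorem exists_maxK_mul_blockTriangular : ∀ (n : ℕ) (g : GL (Fin n) K),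
    ∃ k ∈ maxK K n, (g * k).val.BlockTriangular id
  | 0, g => ⟨1, one_mem _, fun i => i.elim0⟩
  | n + 1, g => by
    obtain ⟨k, hk, h⟩ := exists_maxK_vecMul (g.val (Fin.natAdd n (0 : Fin 1)))
    have h1 := eq_blk (a := n) (b := 1) (g * k).val
    set A : Matrix (Fin n) (Fin n) K :=
      Matrix.of fun i j => (g * k).val (Fin.castAdd 1 i) (Fin.castAdd 1 j) with hA
    set D : Matrix (Fin 1) (Fin 1) K :=
      Matrix.of fun i j => (g * k).val (Fin.natAdd n i) (Fin.natAdd n j)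
    have h2 : (Matrix.of fun i j => (g * k).val (Fin.natAdd n i) (Fin.castAdd 1 j) :
        Matrix (Fin 1) (Fin n) K) = 0 := by
      ext i j
      rw [Subsingleton.elim i 0]
      exact h j
    rw [h2] at h1
    have hdet : A.det ≠ 0 := by
      have h3 := det_ne_zero_GL (g * k)
      rw [h1, det_blk] at h3
      exact left_ne_zero_of_mul h3
    obtain ⟨k', hk', h'⟩ := exists_maxK_mul_blockTriangular n
      (Matrix.GeneralLinearGroup.mkOfDetNeZero A hdet)
    refine ⟨k * parab k' (1 : GL (Fin 1) K) 0, mul_mem hk (parab_mem_maxK.2 ⟨hk', one_mem _,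
      zero_mem_intMat _ _⟩), ?_⟩
    rw [← mul_assoc, Units.val_mul, h1, parab_val, blk_mul]
    simp only [Matrix.zero_mul, Matrix.mul_zero, add_zero, zero_add]
    refine blockTriangular_blk h' ?_
    intro i j hij
    exact absurd hij (by rw [Subsingleton.elim i j]; exact lt_irrefl _)

theorem diagonal_ne_zero_of_blockTriangular {n : ℕ} {g : GL (Fin n) K}
    (hg : g.val.BlockTriangular id) (i : Fin n) : g.val i i ≠ 0 := by
  have h := det_ne_zero_GL g
  rw [Matrix.det_of_isUpperTriangular hg] at h
  exact Finset.prod_ne_zero_iff.1 h i (Finset.mem_univ i)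

theorem exists_isIwasawa {n : ℕ} (g : GL (Fin n) K) : ∃ l, IsIwasawa g l := by
  obtain ⟨k, hk, h⟩ := exists_maxK_mul_blockTriangular n g
  have h0 := diagonal_ne_zero_of_blockTriangular h
  refine ⟨fun i => ord K ((g * k).val i i), (g * k).val *
    Matrix.diagonal (fun i => ((g * k).val i i)⁻¹), ?_, ?_, fun i => Units.mk0 _ (h0 i),
    fun i => rfl, k⁻¹, inv_mem hk, ?_⟩
  · exact h.mul (Matrix.blockTriangular_diagonal _)
  · intro i
    rw [Matrix.mul_diagonal]; exact mul_inv_cancel₀ (h0 i)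
  · rw [mul_assoc ((g * k).val), Matrix.diagonal_mul_diagonal]
    simp only [Units.val_mk0, inv_mul_cancel₀ (h0 _), Matrix.diagonal_one, mul_one]
    rw [← Units.val_mul, mul_inv_cancel_right]

theorem IsIwasawa.le {n : ℕ} {g : GL (Fin n) K} {l l' : Fin n → ℤ} (h : IsIwasawa g l)
    (h' : IsIwasawa g l') : l ≤ l' := by
  obtain ⟨u, hu, hu1, t, ht, k, hk, e⟩ := h
  obtain ⟨u', hu', hu1', t', ht', k', hk', e'⟩ := h'
  have key : ∀ (u : Matrix (Fin n) (Fin n) K) (t : Fin n → Kˣ) (k : GL (Fin n) K),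
      g.val = u * Matrix.diagonal (fun i => (t i : K)) * k.val →
      (g * k⁻¹).val = u * Matrix.diagonal (fun i => (t i : K)) := by
    intro u t k e
    rw [Units.val_mul, e, mul_assoc, k.mul_inv, mul_one]
  have hb := key u t k e
  have hb' := key u' t' k' e'
  have hB : (g * k⁻¹).val.BlockTriangular id := by
    rw [hb]; exact hu.mul (Matrix.blockTriangular_diagonal _)
  have hB' : (g * k'⁻¹).val.BlockTriangular id := by
    rw [hb']; exact hu'.mul (Matrix.blockTriangular_diagonal _)
  have hinv : ((g * k⁻¹)⁻¹).val.BlockTriangular id := by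
    rw [Matrix.coe_units_inv]
    letI := (g * k⁻¹).invertible
    exact Matrix.blockTriangular_inv_of_blockTriangular hB
  have hκ : (k * k'⁻¹).val = ((g * k⁻¹)⁻¹).val * (g * k'⁻¹).val := by
    rw [← Units.val_mul]; congr 1; group
  have hκB : (k * k'⁻¹).val.BlockTriangular id := by rw [hκ]; exact hinv.mul hB'
  have hprod : (g * k'⁻¹).val = (g * k⁻¹).val * (k * k'⁻¹).val := by
    rw [← Units.val_mul]; congr 1; group
  intro i
  have h1 : (t' i : K) = t i * (k * k'⁻¹).val i i := by
    have h2 := congrFun (congrFun hprod i) i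
    rw [BlockTriangular.mul_apply_self hB hκB, hb, hb', Matrix.mul_diagonal, Matrix.mul_diagonal,
      hu1, hu1', one_mul, one_mul] at h2
    exact h2
  have h3 : (k * k'⁻¹).val i i ≠ 0 := diagonal_ne_zero_of_blockTriangular hκB i
  have h4 := (mem_integer_iff_of_ne h3).1
    ((mem_maxK_iff.1 (mul_mem hk (inv_mem hk'))).1 i i)
  rw [← ht, ← ht', h1, ord_mul (t i).ne_zero h3]
  linarith

theorem iwasawa_eq {n : ℕ} {g : GL (Fin n) K} {l : Fin n → ℤ} (h : IsIwasawa g l) :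
    iwasawa g = l := by
  have hex : ∃ l, IsIwasawa g l := ⟨l, h⟩
  rw [iwasawa, dif_pos hex]
  exact le_antisymm (hex.choose_spec.le h) (h.le hex.choose_spec)

theorem isIwasawa_iwasawa {n : ℕ} (g : GL (Fin n) K) : IsIwasawa g (iwasawa g) := by
  obtain ⟨l, h⟩ := exists_isIwasawa g
  rwa [iwasawa_eq h]

theorem iwasawa_mul_maxK {n : ℕ} (g : GL (Fin n) K) {k : GL (Fin n) K} (hk : k ∈ maxK K n) :
    iwasawa (g * k) = iwasawa g := by
  obtain ⟨u, hu, hu1, t, ht, k', hk', e⟩ := isIwasawa_iwasawa g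
  refine iwasawa_eq ⟨u, hu, hu1, t, ht, k' * k, mul_mem hk' hk, ?_⟩
  rw [Units.val_mul, Units.val_mul, e, mul_assoc]

theorem iwasawa_parab (m₁ : GL (Fin a) K) (m₂ : GL (Fin b) K) (x : Matrix (Fin a) (Fin b) K) :
    iwasawa (parab m₁ m₂ x) = Fin.append (iwasawa m₁) (iwasawa m₂) := by
  obtain ⟨u, hu, hu1, t, ht, k, hk, e⟩ := isIwasawa_iwasawa m₁
  obtain ⟨u', hu', hu1', t', ht', k', hk', e'⟩ := isIwasawa_iwasawa m₂
  refine iwasawa_eq ⟨blk u (m₁.val * x * (k'⁻¹).val *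
    Matrix.diagonal (fun i => (t' i : K)⁻¹)) 0 u', blockTriangular_blk hu hu', ?_,
    Fin.append t t', ?_, parab k k' 0, parab_mem_maxK.2 ⟨hk, hk', zero_mem_intMat _ _⟩, ?_⟩
  · intro i
    refine Fin.addCases (fun i => ?_) (fun i => ?_) i <;> simp [hu1, hu1']
  · intro i
    refine Fin.addCases (fun i => ?_) (fun i => ?_) i <;> simp [ht, ht']
  · have h1 : (fun i => ((Fin.append t t' i : Kˣ) : K)) =
        Fin.append (fun i => (t i : K)) (fun i => (t' i : K)) := by
      funext i
      refine Fin.addCases (fun i => ?_) (fun i => ?_) i <;> simp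
    rw [h1, ← blk_diagonal, parab_val, parab_val, blk_mul, blk_mul]
    have h2 : m₁.val * x * (k'⁻¹).val * Matrix.diagonal (fun i => (t' i : K)⁻¹) *
        Matrix.diagonal (fun i => (t' i : K)) * k'.val = m₁.val * x := by
      rw [Matrix.mul_assoc (m₁.val * x * (k'⁻¹).val), Matrix.diagonal_mul_diagonal]
      simp only [inv_mul_cancel₀ (t' _).ne_zero, Matrix.diagonal_one, Matrix.mul_one]
      rw [Matrix.mul_assoc, k'.inv_mul, Matrix.mul_one]
    simp only [Matrix.zero_mul, Matrix.mul_zero, add_zero, zero_add]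
    rw [h2, ← e, ← e']

theorem exists_parab_mul (g : GL (Fin (a + b)) K) :
    ∃ (m₁ : GL (Fin a) K) (m₂ : GL (Fin b) K) (x : Matrix (Fin a) (Fin b) K),
      ∃ k ∈ maxK K (a + b), g = parab m₁ m₂ x * k := by
  obtain ⟨k, hk, h⟩ := exists_maxK_mul_blockTriangular _ g
  have h1 := eq_blk (a := a) (b := b) (g * k).val
  have h2 : (Matrix.of fun i j => (g * k).val (Fin.natAdd a i) (Fin.castAdd b j) :
      Matrix (Fin b) (Fin a) K) = 0 := by
    ext i j
    exact h (show (Fin.castAdd b j : Fin (a + b)) < Fin.natAdd a i by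
      simp [Fin.lt_def]; omega)
  rw [h2] at h1
  have hd := det_ne_zero_GL (g * k)
  rw [h1, det_blk] at hd
  let m₁ := Matrix.GeneralLinearGroup.mkOfDetNeZero _ (left_ne_zero_of_mul hd)
  let m₂ := Matrix.GeneralLinearGroup.mkOfDetNeZero _ (right_ne_zero_of_mul hd)
  refine ⟨m₁, m₂, (m₁⁻¹).val * (Matrix.of fun i j => (g * k).val (Fin.castAdd b i) (Fin.natAdd a j)),
    k⁻¹, inv_mem hk, ?_⟩
  rw [eq_mul_inv_iff_mul_eq]
  apply Units.ext
  rw [parab_val, ← Matrix.mul_assoc, m₁.mul_inv, Matrix.one_mul]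
  exact h1

end Iwasawa


section UnimodularGL

variable {K : Type*} [Field K] [ValuativeRel K] [TopologicalSpace K] [IsNonarchimedeanLocalField K]

/-! ### `GL_n` is unimodular -/

theorem muGL_spec (n : ℕ) : (muGL K n).IsHaarMeasure ∧ muGL K n (maxK K n) = 1 :=
  normalizedHaar_spec (isCompact_maxK n) (isOpen_maxK n) ⟨1, one_mem _⟩

instance instIsHaarMeasureMuGL (n : ℕ) : (muGL K n).IsHaarMeasure := (muGL_spec n).1

/-- An element of `K` which makes finitely many elements integral. -/
theorem exists_common_denominator {ι : Type*} [Finite ι] (x : ι → K) :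
    ∃ c : K, c ≠ 0 ∧ c ∈ 𝒪[K] ∧ ∀ i, c * x i ∈ 𝒪[K] := by
  cases nonempty_fintype ι
  choose m hm using fun i => exists_mul_integer (x i)
  obtain ⟨c, hc⟩ := exists_ord_eq (K := K) ((∑ i, m i : ℕ) : ℤ)
  refine ⟨c, c.ne_zero, (mem_integer_iff_of_ne c.ne_zero).2 (by rw [hc]; positivity), fun i => ?_⟩
  refine hm i c c.ne_zero ?_
  rw [hc]
  exact_mod_cast Finset.single_le_sum (f := m) (fun _ _ => Nat.zero_le _) (Finset.mem_univ i)

open Classical in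
/-- Diagonal matrices. -/
def diagGL (n : ℕ) : (Fin n → Kˣ) →* GL (Fin n) K where
  toFun t := ⟨Matrix.diagonal fun i => (t i : K), Matrix.diagonal fun i => ((t i)⁻¹ : Kˣ),
    by simp [Matrix.diagonal_mul_diagonal], by simp [Matrix.diagonal_mul_diagonal]⟩
  map_one' := by apply Units.ext; simp
  map_mul' s t := by apply Units.ext; simp [Matrix.diagonal_mul_diagonal]

theorem diagGL_val {n : ℕ} (t : Fin n → Kˣ) :
    (diagGL n t).val = Matrix.diagonal fun i => (t i : K) := rfl

theorem modularCharacter_eq_one_of_commute {G : Type*} [Group G] [TopologicalSpace G]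
    [IsTopologicalGroup G] [LocallyCompactSpace G] [MeasurableSpace G] [BorelSpace G]
    [SecondCountableTopology G] {z : G} (hz : ∀ g, g * z = z * g) :
    Measure.modularCharacter z = 1 := by
  obtain ⟨C, hC, hC1⟩ := exists_compact_mem_nhds (1 : G)
  let μ : Measure G := Measure.haar
  have hC0 : μ C ≠ 0 := (Measure.measure_pos_of_mem_nhds μ hC1).ne'
  have h1 := map_mul_right_eq_smul μ z
  rw [show (fun g : G => g * z) = fun g => z * g from funext hz, map_mul_left_eq_self] at h1
  have h2 := congrArg (fun ν => ν C) h1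
  simp only [Measure.smul_apply, ENNReal.smul_def, smul_eq_mul] at h2
  have h3 := (ENNReal.mul_eq_right hC0 hC.measure_ne_top).1 h2.symm
  exact_mod_cast h3

theorem modularCharacter_diagGL {n : ℕ} (t : Fin n → Kˣ) :
    Measure.modularCharacter (diagGL n t) = 1 := by
  classical
  let χ : (Fin n → Kˣ) →* NNReal := Measure.modularCharacter.comp (diagGL n)
  have hswap : ∀ (p : Equiv.Perm (Fin n)) t, χ (t ∘ p) = χ t := by
    intro p t
    obtain ⟨k, -, hk⟩ := permMatrix_mem_maxK (K := K) p
    have h : k * diagGL n t = diagGL n (t ∘ p) * k := by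
      apply Units.ext
      rw [Units.val_mul, Units.val_mul, hk, diagGL_val, diagGL_val]
      ext i j
      rw [Matrix.mul_diagonal, Matrix.diagonal_mul, Equiv.Perm.permMatrix, PEquiv.toMatrix_apply]
      simp only [Equiv.toPEquiv_apply, Option.mem_def, Option.some.injEq, Function.comp]
      split_ifs with h
      · rw [← h]; ring
      · ring
    have h1 := congrArg Measure.modularCharacter h
    rw [map_mul, map_mul, mul_comm] at h1
    have h2 : Measure.modularCharacter k ≠ 0 := by
      intro h0
      have h3 : Measure.modularCharacter (k * k⁻¹) = 1 := by rw [mul_inv_cancel, map_one]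
      rw [map_mul, h0, zero_mul] at h3
      exact zero_ne_one h3
    exact (mul_right_cancel₀ h2 h1).symm
  have hsingle : ∀ i u, χ (Pi.mulSingle i u) = 1 := by
    intro i u
    have h1 : ∀ j, χ (Pi.mulSingle j u) = χ (Pi.mulSingle i u) := by
      intro j
      rw [← hswap (Equiv.swap i j) (Pi.mulSingle i u)]
      congr 1
      funext k
      simp only [Function.comp, Pi.mulSingle_apply]
      congr 1
      rw [Equiv.swap_apply_eq_iff, Equiv.swap_apply_left]
    have h2 : χ (fun _ => u) = 1 := by
      refine modularCharacter_eq_one_of_commute fun g => ?_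
      apply Units.ext
      rw [Units.val_mul, Units.val_mul, diagGL_val]
      ext i j
      rw [Matrix.mul_diagonal, Matrix.diagonal_mul, mul_comm]
    rw [← Finset.univ_prod_mulSingle (fun _ : Fin n => u), map_prod,
      Finset.prod_congr rfl fun j _ => h1 j, Finset.prod_const] at h2
    refine (pow_eq_one_iff_of_nonneg zero_le ?_).1 h2
    simp only [Finset.card_univ, Fintype.card_fin]
    have := i.isLt
    omega
  change χ t = 1
  rw [← Finset.univ_prod_mulSingle t, map_prod]
  exact Finset.prod_eq_one fun i _ => hsingle i _

theorem modularCharacter_transvection {n : ℕ} (t : Matrix.TransvectionStruct (Fin n) K)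
    (g : GL (Fin n) K) (hg : g.val = t.toMatrix) : Measure.modularCharacter g = 1 := by
  obtain ⟨i, j, hij, x⟩ := t
  change g.val = Matrix.transvection i j x at hg
  have hpow : ∀ m : ℕ, (g ^ m).val = Matrix.transvection i j (m * x) := by
    intro m
    induction m with
    | zero => simp [Matrix.transvection]
    | succ m ih =>
      rw [pow_succ, Units.val_mul, ih, hg, Matrix.transvection_mul_transvection_same i j hij]
      congr 1; push_cast; ring
  have hinv : ∀ m : ℕ, ((g ^ m)⁻¹).val = Matrix.transvection i j (-(m * x)) := by
    intro m
    symm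
    apply Units.eq_inv_of_mul_eq_one_left
    rw [hpow, Matrix.transvection_mul_transvection_same i j hij]
    simp [Matrix.transvection]
  obtain ⟨c, hc0, hc, hcx⟩ := exists_common_denominator fun _ : Unit => x
  have hmem : ∀ y : K, c * y ∈ 𝒪[K] → c • Matrix.transvection i j y ∈ intMat K n n := by
    intro y hy k l
    simp only [Matrix.transvection, Matrix.smul_apply, Matrix.add_apply, smul_eq_mul, mul_add,
      Matrix.one_apply, Matrix.single_apply]
    refine add_mem ?_ ?_
    · split_ifs
      · simpa using hc
      · simp
    · split_ifs
      · exact hy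
      · simp
  have hm : ∀ m : ℕ, c * (m * x) ∈ 𝒪[K] := fun m => by
    rw [mul_left_comm]; exact mul_mem (natCast_mem _ m) (hcx ())
  refine modularCharacter_eq_one_of_pow_mem (isCompact_GL_bounded n hc0) fun m => ⟨?_, ?_⟩
  · rw [hpow]; exact hmem _ (hm m)
  · rw [hinv]; exact hmem _ (by rw [mul_neg]; exact neg_mem (hm m))

theorem modularCharacter_GL {n : ℕ} (g : GL (Fin n) K) : Measure.modularCharacter g = 1 := by
  have h := Matrix.diagonal_transvection_induction_of_det_ne_zero
    (fun M : Matrix (Fin n) (Fin n) K =>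
      ∀ g : GL (Fin n) K, g.val = M → Measure.modularCharacter g = 1) g.val (det_ne_zero_GL g)
    ?_ ?_ ?_
  · exact h g rfl
  · intro D hD g hg
    rw [Matrix.det_diagonal] at hD
    have h0 : ∀ i, D i ≠ 0 := fun i => Finset.prod_ne_zero_iff.1 hD i (Finset.mem_univ i)
    have : g = diagGL n fun i => Units.mk0 (D i) (h0 i) := by
      apply Units.ext; rw [hg, diagGL_val]; rfl
    rw [this, modularCharacter_diagGL]
  · exact fun t g hg => modularCharacter_transvection t g hg
  · intro A B hA hB hPA hPB g hg
    have : g = Matrix.GeneralLinearGroup.mkOfDetNeZero A hA *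
        Matrix.GeneralLinearGroup.mkOfDetNeZero B hB := by
      apply Units.ext; rw [hg]; rfl
    rw [this, map_mul, hPA _ rfl, hPB _ rfl, one_mul]

instance instIsMulRightInvariantMuGL (n : ℕ) : (muGL K n).IsMulRightInvariant :=
  isMulRightInvariant_of_modularCharacter modularCharacter_GL _

instance instIsInvInvariantMuGL (n : ℕ) : (muGL K n).IsInvInvariant :=
  isInvInvariant_of_isMulRightInvariant _

end UnimodularGL


section UnitaryGroup

variable {K : Type*} [Field K] [ValuativeRel K] [TopologicalSpace K] [IsNonarchimedeanLocalField K]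
  {s : K →+* K}

/-! ### The unitary group is unimodular -/

theorem mem_integer_of_ord (hso : ∀ x, ord K (s x) = ord K x) {x : K} (hx : x ∈ 𝒪[K]) :
    s x ∈ 𝒪[K] := by
  rcases mem_integer_iff.1 hx with rfl | h
  · rw [map_zero]; exact zero_mem _
  · exact mem_integer_iff.2 (Or.inr (by rwa [hso]))

theorem continuous_of_ord (hso : ∀ x, ord K (s x) = ord K x) : Continuous s := by
  refine continuous_of_continuousAt_zero s ?_
  rw [ContinuousAt, map_zero]
  refine (hasBasis_nhds_zero_ord.tendsto_iff hasBasis_nhds_zero_ord).2 fun n _ => ⟨n, trivial, ?_⟩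
  rintro x (rfl | hx)
  · exact Or.inl (map_zero s)
  · exact Or.inr (by rwa [hso])

theorem continuous_conjT (hs : Continuous s) {m n : Type*} :
    Continuous (conjT (m := m) (n := n) s) :=
  (continuous_id.matrix_map hs).matrix_transpose

theorem conjT_mem_intMat (hso : ∀ x, ord K (s x) = ord K x) {m n : ℕ}
    {A : Matrix (Fin m) (Fin n) K} (hA : A ∈ intMat K m n) : conjT s A ∈ intMat K n m :=
  fun i j => mem_integer_of_ord hso (hA j i)

theorem det_conjT {R : Type*} [CommRing R] {n : ℕ} (s : R →+* R) (A : Matrix (Fin n) (Fin n) R) :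
    (conjT s A).det = s A.det := by
  rw [conjT, Matrix.det_transpose, RingHom.map_det]; rfl

theorem isClosed_unitary (hso : ∀ x, ord K (s x) = ord K x) {n : ℕ}
    (x : Matrix (Fin n) (Fin n) K) : IsClosed (unitary s x : Set (GL (Fin n) K)) := by
  have h1 : Continuous fun g : GL (Fin n) K => conjT s g.val * x * g.val :=
    (((continuous_conjT (continuous_of_ord hso)).comp continuous_GL_val).mul
      continuous_const).mul continuous_GL_val
  exact isClosed_eq h1 continuous_const

instance instSecondCountableUnitary {n : ℕ} (x : Matrix (Fin n) (Fin n) K) :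
    SecondCountableTopology (unitary s x) :=
  Topology.IsEmbedding.subtypeVal.secondCountableTopology

theorem locallyCompactSpace_unitary (hso : ∀ x, ord K (s x) = ord K x) {n : ℕ}
    (x : Matrix (Fin n) (Fin n) K) : LocallyCompactSpace (unitary s x) :=
  (isClosed_unitary hso x).isClosedEmbedding_subtypeVal.locallyCompactSpace

theorem mem_unitary_one_iff {R : Type*} [CommRing R] {s : R →+* R} {n : ℕ} {g : GL (Fin n) R} :
    g ∈ unitary s 1 ↔ conjT s g.val * g.val = 1 := by
  change conjT s g.val * 1 * g.val = 1 ↔ _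
  rw [mul_one]

variable (s) in
/-- The maximal compact subgroup `U(V_n) ∩ GL_n(𝒪)`. -/
def unitaryK (n : ℕ) : Subgroup (unitary (n := n) s (1 : Matrix (Fin n) (Fin n) K)) :=
  (maxK K n).subgroupOf _

theorem isOpen_unitaryK (n : ℕ) :
    IsOpen (unitaryK s n : Set (unitary (n := n) s (1 : Matrix (Fin n) (Fin n) K))) :=
  (isOpen_maxK n).preimage continuous_subtype_val

theorem isCompact_unitaryK (hso : ∀ x, ord K (s x) = ord K x) (n : ℕ) :
    IsCompact (unitaryK s n : Set (unitary (n := n) s (1 : Matrix (Fin n) (Fin n) K))) :=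
  (isClosed_unitary hso 1).isClosedEmbedding_subtypeVal.isCompact_preimage (isCompact_maxK n)

theorem muU_spec (hso : ∀ x, ord K (s x) = ord K x) (n : ℕ) :
    (muU s n).IsHaarMeasure ∧ muU s n (unitaryK s n) = 1 := by
  haveI := locallyCompactSpace_unitary hso (1 : Matrix (Fin n) (Fin n) K)
  exact normalizedHaar_spec (isCompact_unitaryK hso n) (isOpen_unitaryK n)
    ⟨1, (unitaryK s n).one_mem⟩

theorem isHaarMeasure_muU (hso : ∀ x, ord K (s x) = ord K x) (n : ℕ) :
    (muU s n).IsHaarMeasure := (muU_spec hso n).1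

/-- The Hermitian form. -/
def hermInner {R : Type*} [CommRing R] {n : ℕ} (s : R →+* R) (v w : Fin n → R) : R :=
  ∑ i, s (v i) * w i

theorem hermInner_conj {R : Type*} [CommRing R] {n : ℕ} {s : R →+* R} (hs : ∀ x, s (s x) = x)
    (v w : Fin n → R) : s (hermInner s v w) = hermInner s w v := by
  simp only [hermInner, map_sum, map_mul, hs]
  exact Finset.sum_congr rfl fun i _ => mul_comm _ _

theorem hermInner_mulVec {R : Type*} [CommRing R] {n : ℕ} {s : R →+* R}
    {g : GL (Fin n) R} (hg : g ∈ unitary s 1) (v w : Fin n → R) :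
    hermInner s (g.val *ᵥ v) (g.val *ᵥ w) = hermInner s v w := by
  have h : ∀ v w : Fin n → R, hermInner s v w = (s ∘ v) ⬝ᵥ w := fun v w => rfl
  have h2 : ∀ v : Fin n → R, s ∘ (g.val *ᵥ v) = (s ∘ v) ᵥ* conjT s g.val := by
    intro v
    funext i
    simp only [Function.comp, Matrix.mulVec, Matrix.vecMul, dotProduct, map_sum, map_mul, conjT,
      Matrix.transpose_apply, Matrix.map_apply]
    exact Finset.sum_congr rfl fun i _ => mul_comm _ _
  rw [h, h, h2, Matrix.dotProduct_mulVec, Matrix.vecMul_vecMul, mem_unitary_one_iff.1 hg,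
    Matrix.vecMul_one]

/-- The matrix of the quasi-reflection `x ↦ x + c ⟨d, x⟩ d`. -/
def reflMat {R : Type*} [CommRing R] {n : ℕ} (s : R →+* R) (d : Fin n → R) (c : R) :
    Matrix (Fin n) (Fin n) R := 1 + c • Matrix.vecMulVec d (s ∘ d)

theorem reflMat_mul {R : Type*} [CommRing R] {n : ℕ} (s : R →+* R) (d : Fin n → R) (c c' : R) :
    reflMat s d c * reflMat s d c' = reflMat s d (c + c' + c * c' * hermInner s d d) := by
  have h : Matrix.vecMulVec d (s ∘ d) * Matrix.vecMulVec d (s ∘ d) =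
      hermInner s d d • Matrix.vecMulVec d (s ∘ d) := by
    rw [Matrix.vecMulVec_mul_vecMulVec]
    ext i j
    simp only [Matrix.vecMulVec_apply, Pi.smul_apply, Matrix.smul_apply, smul_eq_mul, hermInner,
      dotProduct, Function.comp]
    ring
  simp only [reflMat, add_mul, mul_add, one_mul, mul_one, smul_mul_assoc, mul_smul_comm, h,
    smul_smul, add_smul]
  module

theorem conjT_reflMat {R : Type*} [CommRing R] {n : ℕ} {s : R →+* R} (hs : ∀ x, s (s x) = x)
    (d : Fin n → R) (c : R) : conjT s (reflMat s d c) = reflMat s d (s c) := by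
  ext i j
  simp only [conjT, reflMat, Matrix.transpose_apply, Matrix.map_apply, Matrix.add_apply,
    Matrix.smul_apply, Matrix.vecMulVec_apply, map_add, map_mul, smul_eq_mul, Function.comp, hs,
    Matrix.one_apply]
  by_cases h : i = j
  · subst h; simp; ring
  · simp [h, Ne.symm h]; ring

theorem reflMat_mulVec {R : Type*} [CommRing R] {n : ℕ} (s : R →+* R) (d : Fin n → R) (c : R)
    (x : Fin n → R) : reflMat s d c *ᵥ x = x + (c * hermInner s d x) • d := by
  funext i
  rw [reflMat, Matrix.add_mulVec, Matrix.one_mulVec, Matrix.smul_mulVec]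
  simp only [Pi.add_apply, Pi.smul_apply, smul_eq_mul, Matrix.mulVec, dotProduct,
    Matrix.vecMulVec_apply, hermInner, Function.comp]
  rw [mul_assoc, Finset.sum_mul]
  congr 2
  exact Finset.sum_congr rfl fun i _ => by ring

theorem ord_eq_zero_of_norm_one (hso : ∀ x, ord K (s x) = ord K x) {x : K} (hx : x * s x = 1) :
    ord K x = 0 := by
  have hx0 : x ≠ 0 := left_ne_zero_of_mul (hx ▸ one_ne_zero)
  have hs0 : s x ≠ 0 := right_ne_zero_of_mul (hx ▸ one_ne_zero)
  have h := ord_mul hx0 hs0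
  rw [hx, ord_one, hso] at h
  omega

/-- For `⟨d, d⟩ ≠ 0` and `λ` of norm one there is a unitary quasi-reflection with eigenvalue `λ`
on `d`, and the modular character is trivial on it. -/
theorem exists_unitary_refl (hs : ∀ x, s (s x) = x) (hso : ∀ x, ord K (s x) = ord K x) {n : ℕ}
    (d : Fin n → K) (hd : hermInner s d d ≠ 0) (lam : K) (hl : lam * s lam = 1) :
    ∃ r : unitary (n := n) s (1 : Matrix (Fin n) (Fin n) K),
      (∀ x, r.1.val *ᵥ x = x + ((lam - 1) / hermInner s d d * hermInner s d x) • d) ∧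
      ∀ (_ : LocallyCompactSpace (unitary (n := n) s (1 : Matrix (Fin n) (Fin n) K))),
        Measure.modularCharacter r = 1 := by
  set N := hermInner s d d with hN
  have hsN : s N = N := hermInner_conj hs d d
  let c : K → K := fun l => (l - 1) / N
  have hmul : ∀ l l', reflMat s d (c l) * reflMat s d (c l') = reflMat s d (c (l * l')) := by
    intro l l'
    rw [reflMat_mul, ← hN]
    congr 1
    simp only [c]; field_simp; ring
  have hone : reflMat s d (c 1) = 1 := by simp [c, reflMat]
  have hl' : s lam * lam = 1 := by rw [mul_comm]; exact hl
  let r : GL (Fin n) K := ⟨reflMat s d (c lam), reflMat s d (c (s lam)),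
    by rw [hmul, hl, hone], by rw [hmul, hl', hone]⟩
  have hconj : ∀ l, conjT s (reflMat s d (c l)) = reflMat s d (c (s l)) := by
    intro l
    rw [conjT_reflMat hs]
    simp [c, hsN]
  have hr : r ∈ unitary s 1 := by
    rw [mem_unitary_one_iff]
    change conjT s (reflMat s d (c lam)) * reflMat s d (c lam) = 1
    rw [hconj, hmul, hl', hone]
  refine ⟨⟨r, hr⟩, fun x => reflMat_mulVec s d (c lam) x, fun _ => ?_⟩
  have hpow : ∀ m : ℕ, (r ^ m).val = reflMat s d (c (lam ^ m)) ∧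
      ((r ^ m)⁻¹).val = reflMat s d (c (s lam ^ m)) := by
    intro m
    induction m with
    | zero => simp [hone]
    | succ m ih =>
      constructor
      · rw [pow_succ, Units.val_mul, ih.1, pow_succ, ← hmul]
      · rw [pow_succ, mul_inv_rev, Units.val_mul, ih.2, pow_succ', ← hmul]
        rfl
  obtain ⟨e, he0, he, hed⟩ := exists_common_denominator
    fun p : Fin n × Fin n => (N⁻¹ * (d p.1 * s (d p.2)))
  have hbd : ∀ l : K, l ∈ 𝒪[K] → e • reflMat s d (c l) ∈ intMat K n n := by
    intro l hl i j
    have : (e • reflMat s d (c l)) i j =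
        e * (1 : Matrix (Fin n) (Fin n) K) i j + (l - 1) * (e * (N⁻¹ * (d i * s (d j)))) := by
      simp only [reflMat, c, Matrix.smul_apply, Matrix.add_apply, Matrix.vecMulVec_apply,
        smul_eq_mul, Function.comp]
      ring
    rw [this]
    exact add_mem (mul_mem he (intMat_one n i j)) (mul_mem (sub_mem hl (one_mem _)) (hed (i, j)))
  have hlam0 : lam ≠ 0 := left_ne_zero_of_mul (hl ▸ one_ne_zero)
  have hlamO : lam ∈ 𝒪[K] :=
    (mem_integer_iff_of_ne hlam0).2 (ord_eq_zero_of_norm_one hso hl).ge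
  refine modularCharacter_eq_one_of_pow_mem
    ((isClosed_unitary hso 1).isClosedEmbedding_subtypeVal.isCompact_preimage
      (isCompact_GL_bounded n he0)) fun m => ⟨?_, ?_⟩
  · change e • (r ^ m).val ∈ _
    rw [(hpow m).1]
    exact hbd _ (pow_mem hlamO m)
  · change e • ((r ^ m)⁻¹).val ∈ _
    rw [(hpow m).2]
    exact hbd _ (pow_mem (mem_integer_of_ord hso hlamO) m)

theorem hermInner_single_left {R : Type*} [CommRing R] {n : ℕ} (s : R →+* R) (i : Fin n)
    (v : Fin n → R) : hermInner s (Pi.single i 1) v = v i := by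
  simp only [hermInner]
  rw [Finset.sum_eq_single_of_mem i (Finset.mem_univ i) fun j _ hj => by simp [hj]]
  simp

theorem hermInner_smul_right {R : Type*} [CommRing R] {n : ℕ} (s : R →+* R) (c : R)
    (v w : Fin n → R) : hermInner s v (c • w) = c * hermInner s v w := by
  simp only [hermInner, Pi.smul_apply, smul_eq_mul, Finset.mul_sum]
  exact Finset.sum_congr rfl fun i _ => by ring

theorem modularCharacter_unitary [CharZero K] (hs : ∀ x, s (s x) = x)
    (hso : ∀ x, ord K (s x) = ord K x) {n : ℕ}
    [LocallyCompactSpace (unitary (n := n) s (1 : Matrix (Fin n) (Fin n) K))]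
    (g : unitary (n := n) s (1 : Matrix (Fin n) (Fin n) K)) :
    Measure.modularCharacter g = 1 := by
  have key : ∀ k : ℕ, k ≤ n → ∀ g : unitary (n := n) s (1 : Matrix (Fin n) (Fin n) K),
      (∀ i : Fin n, k ≤ i.val → g.1.val *ᵥ Pi.single i 1 = Pi.single i 1) →
      Measure.modularCharacter g = 1 := by
    intro k
    induction k with
    | zero =>
      intro _ g hg
      have : g = 1 := by
        apply Subtype.ext; apply Units.ext
        ext i j
        have := congrFun (hg j (Nat.zero_le _)) i
        rw [Matrix.mulVec_single_one, Matrix.col_apply] at this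
        rw [this]
        simp [Pi.single_apply, Matrix.one_apply]
      rw [this, map_one]
    | succ k ih =>
      intro hk g hg
      let j : Fin n := ⟨k, hk⟩
      let e : Fin n → K := Pi.single j 1
      let w : Fin n → K := g.1.val *ᵥ e
      have hee : hermInner s e e = 1 := by simp [e, hermInner_single_left]
      have hww : hermInner s w w = 1 := by rw [← hee]; exact hermInner_mulVec g.2 e e
      have hwi : ∀ i : Fin n, k + 1 ≤ i.val → w i = 0 := by
        intro i hi
        have h1 := hermInner_mulVec g.2 (Pi.single i 1) e
        rw [hg i hi, hermInner_single_left, hermInner_single_left] at h1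
        refine h1.trans (Pi.single_eq_of_ne ?_ _)
        rintro rfl
        simp [j] at hi
      -- a sign for which `w` can be moved to `e`
      obtain ⟨ε, hε, hsε, htr⟩ : ∃ ε : K, ε * ε = 1 ∧ s ε = ε ∧ 2 - ε * w j - s (ε * w j) ≠ 0 := by
        by_cases h : 2 - w j - s (w j) = 0
        · refine ⟨-1, by ring, by simp, ?_⟩
          have h2 : 2 - -1 * w j - s (-1 * w j) = 4 - (2 - w j - s (w j)) := by
            rw [map_mul, map_neg, map_one]; ring
          rw [h2, h, sub_zero]
          norm_num
        · exact ⟨1, by ring, map_one s, by simpa using h⟩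
      obtain ⟨r₁, hr₁, hm₁⟩ := exists_unitary_refl hs hso w (by rw [hww]; exact one_ne_zero) ε
        (by rw [hsε, hε])
      let c := ε * w j
      let d : Fin n → K := e - ε • w
      have hinner : ∀ v, hermInner s d v = hermInner s e v - ε * hermInner s w v := by
        intro v
        simp only [hermInner, d, Pi.sub_apply, Pi.smul_apply, smul_eq_mul, map_sub, map_mul, hsε,
          sub_mul, Finset.sum_sub_distrib, Finset.mul_sum]
        congr 1
        exact Finset.sum_congr rfl fun i _ => by ring
      have hew : hermInner s e w = w j := hermInner_single_left s j w
      have hwe : hermInner s w e = s (w j) := by rw [← hew, hermInner_conj hs]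
      have hsub : ∀ u v x : Fin n → K, hermInner s u (v - x) = hermInner s u v - hermInner s u x := by
        intro u v x; simp [hermInner, mul_sub, Finset.sum_sub_distrib]
      have hdw : hermInner s d (ε • w) = c - 1 := by
        rw [hinner, hermInner_smul_right, hermInner_smul_right, hew, hww, mul_one, hε]
      have hdd : hermInner s d d = 2 - c - s c := by
        have h1 : hermInner s d d = hermInner s d e - hermInner s d (ε • w) := by
          rw [← hsub]
        rw [h1, hdw, hinner, hee, hwe, map_mul, hsε]
        simp only [c]; ring
      have hc1 : c - 1 ≠ 0 := by
        intro h
        have h2 : c = 1 := by linear_combination h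
        apply htr
        change 2 - c - s c = 0
        rw [h2, map_one]; ring
      have hsc1 : s c - 1 ≠ 0 := by
        intro h
        apply hc1
        rw [← hs (c - 1), map_sub, map_one, h, map_zero]
      have hdd0 : 2 - c - s c ≠ 0 := htr
      obtain ⟨r₂, hr₂, hm₂⟩ := exists_unitary_refl hs hso d (by rw [hdd]; exact htr)
        (-(s c - 1) / (c - 1)) (by
          rw [map_div₀, map_neg, map_sub, map_sub, map_one, hs]
          field_simp)
      have hfix : Measure.modularCharacter (r₂ * r₁ * g) = 1 := by
        refine ih (by omega) _ fun i hi => ?_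
        change (r₂.1.val * r₁.1.val * g.1.val) *ᵥ Pi.single i 1 = _
        rw [← Matrix.mulVec_mulVec, ← Matrix.mulVec_mulVec]
        rcases Nat.lt_or_ge k i.val with h | h
        · rw [hg i h]
          have h1 : hermInner s w (Pi.single i 1) = 0 := by
            rw [← hermInner_conj hs, hermInner_single_left, hwi i h, map_zero]
          have h2 : hermInner s d (Pi.single i 1) = 0 := by
            rw [hinner, h1, hermInner_single_left, mul_zero, sub_zero]
            refine Pi.single_eq_of_ne ?_ _
            intro hij
            have := congrArg Fin.val hij
            simp [j] at this
            omega
          rw [hr₁, h1, mul_zero, zero_smul, add_zero, hr₂, h2, mul_zero, zero_smul, add_zero]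
        · have hij : i = j := Fin.ext (le_antisymm h hi)
          subst hij
          change r₂.1.val *ᵥ (r₁.1.val *ᵥ w) = e
          have h1 : r₁.1.val *ᵥ w = ε • w := by
            rw [hr₁, hww, div_one, mul_one]
            funext i; simp only [Pi.add_apply, Pi.smul_apply, smul_eq_mul]; ring
          rw [h1, hr₂, hdd, hdw]
          have h2 : (-(s c - 1) / (c - 1) - 1) / (2 - c - s c) * (c - 1) = 1 := by
            field_simp
            ring
          rw [h2, one_smul]
          simp only [d]; abel
      rw [map_mul, map_mul, hm₁, hm₂, one_mul, one_mul] at hfix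
      exact hfix
  exact key n le_rfl g fun i hi => absurd i.isLt (not_lt.2 hi)

theorem isMulRightInvariant_muU [CharZero K] (hs : ∀ x, s (s x) = x)
    (hso : ∀ x, ord K (s x) = ord K x) (n : ℕ) : (muU s n).IsMulRightInvariant := by
  haveI := locallyCompactSpace_unitary hso (1 : Matrix (Fin n) (Fin n) K)
  haveI := isHaarMeasure_muU hso n
  exact isMulRightInvariant_of_modularCharacter (modularCharacter_unitary hs hso) _

theorem isInvInvariant_muU [CharZero K] (hs : ∀ x, s (s x) = x)
    (hso : ∀ x, ord K (s x) = ord K x) (n : ℕ) : (muU s n).IsInvInvariant := by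
  haveI := locallyCompactSpace_unitary hso (1 : Matrix (Fin n) (Fin n) K)
  haveI := isHaarMeasure_muU hso n
  haveI := isMulRightInvariant_muU hs hso n
  exact isInvInvariant_of_isMulRightInvariant _

end UnitaryGroup


section PushForward

variable {K : Type*} [Field K] [ValuativeRel K] [TopologicalSpace K] [IsNonarchimedeanLocalField K]
  {s : K →+* K}

/-! ### The push-forward `r_!` and the action of the Hecke algebra on `𝟏_0` -/

theorem mem_unitary_of_mul_conjT {R : Type*} [CommRing R] {s : R →+* R} {n : ℕ} {g : GL (Fin n) R}
    (h : g.val * conjT s g.val = 1) : g ∈ unitary s 1 :=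
  mem_unitary_one_iff.2 (mul_eq_one_comm.1 h)

theorem mul_conjT_of_mem_unitary {R : Type*} [CommRing R] {s : R →+* R} {n : ℕ} {g : GL (Fin n) R}
    (h : g ∈ unitary s 1) : g.val * conjT s g.val = 1 :=
  mul_eq_one_comm.1 (mem_unitary_one_iff.1 h)

theorem inv_mul_mem_unitary {R : Type*} [CommRing R] {s : R →+* R} {n : ℕ} {X Y : GL (Fin n) R}
    (h : X.val * conjT s X.val = Y.val * conjT s Y.val) : X⁻¹ * Y ∈ unitary s 1 := by
  apply mem_unitary_of_mul_conjT
  rw [Units.val_mul, conjT_mul]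
  calc (X⁻¹).val * Y.val * (conjT s Y.val * conjT s (X⁻¹).val)
      = (X⁻¹).val * (Y.val * conjT s Y.val) * conjT s (X⁻¹).val := by simp only [mul_assoc]
    _ = ((X⁻¹).val * X.val) * (conjT s X.val * conjT s (X⁻¹).val) := by
        rw [← h]; simp only [mul_assoc]
    _ = 1 := by rw [X.inv_mul, one_mul, ← conjT_mul, X.inv_mul, conjT_one]

theorem rPush_eq_integral (hso : ∀ x, ord K (s x) = ord K x) {n : ℕ}
    (f : Matrix (Fin n) (Fin n) K → ℂ) (X : GL (Fin n) K) (h : Herm s n)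
    (hX : X.val * conjT s X.val = h.1) :
    rPush s f h = ∫ u : unitary (n := n) s (1 : Matrix (Fin n) (Fin n) K),
      f (X.val * u.1.val) ∂(muU s n) := by
  have hex : ∃ X : GL (Fin n) K, X.val * conjT s X.val = h.1 := ⟨X, hX⟩
  haveI := locallyCompactSpace_unitary hso (1 : Matrix (Fin n) (Fin n) K)
  haveI := isHaarMeasure_muU hso n
  rw [rPush, dif_pos hex]
  have hu := inv_mul_mem_unitary (hex.choose_spec.trans hX.symm)
  have h1 := integral_mul_left_eq_self (μ := muU s n)
    (fun u : unitary (n := n) s (1 : Matrix (Fin n) (Fin n) K) => f (hex.choose.val * u.1.val))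
    ⟨_, hu⟩
  rw [← h1]
  congr 1
  funext u
  congr 1
  change hex.choose.val * ((hex.choose⁻¹ * X * u.1 : GL (Fin n) K)).val = X.val * u.1.val
  rw [← Units.val_mul, ← Units.val_mul]
  congr 1
  group

theorem oneZero_mul_mul {n : ℕ} (y : Matrix (Fin n) (Fin n) K) {k : GL (Fin n) K}
    (hk : k ∈ maxK K n) : oneZero s n (k.val * y * conjT s k.val) = oneZero s n y := by
  have key : ∀ (y : Matrix (Fin n) (Fin n) K) (k : GL (Fin n) K), k ∈ maxK K n →
      (∃ h ∈ maxK K n, y = h.val * conjT s h.val) →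
      ∃ h ∈ maxK K n, k.val * y * conjT s k.val = h.val * conjT s h.val := by
    rintro y k hk ⟨h, hh, rfl⟩
    refine ⟨k * h, mul_mem hk hh, ?_⟩
    rw [Units.val_mul, conjT_mul]; simp only [mul_assoc]
  have hinv : (k⁻¹).val * (k.val * y * conjT s k.val) * conjT s (k⁻¹).val = y := by
    have h1 : conjT s k.val * conjT s (k⁻¹).val = 1 := by
      rw [← conjT_mul, k.inv_mul, conjT_one]
    calc _ = ((k⁻¹).val * k.val) * y * (conjT s k.val * conjT s (k⁻¹).val) := by
          simp only [mul_assoc]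
      _ = y := by rw [k.inv_mul, h1, one_mul, mul_one]
  by_cases h : ∃ h ∈ maxK K n, y = h.val * conjT s h.val
  · rw [oneZero, Set.indicator_of_mem (show k.val * y * conjT s k.val ∈
      {y | ∃ k ∈ maxK K n, y = k.val * conjT s k.val} from key y k hk h),
      Set.indicator_of_mem (show y ∈ {y | ∃ k ∈ maxK K n, y = k.val * conjT s k.val} from h)]; rfl
  · rw [oneZero, Set.indicator_of_notMem
      (show y ∉ {y | ∃ k ∈ maxK K n, y = k.val * conjT s k.val} from h), Set.indicator_of_notMem]
    intro h'
    have := key _ _ (inv_mem hk) h'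
    rw [hinv] at this
    exact h this

theorem exists_of_oneZero_ne_zero {n : ℕ} {y : Matrix (Fin n) (Fin n) K} (g : GL (Fin n) K)
    (h : oneZero s n (g.val * y * conjT s g.val) ≠ 0) :
    ∃ X : GL (Fin n) K, X.val * conjT s X.val = y := by
  obtain ⟨k, hk, e⟩ := Set.mem_of_indicator_ne_zero h
  refine ⟨g⁻¹ * k, ?_⟩
  rw [Units.val_mul, conjT_mul]
  have h1 : conjT s g.val * conjT s (g⁻¹).val = 1 := by
    rw [← conjT_mul, g.inv_mul, conjT_one]
  calc (g⁻¹).val * k.val * (conjT s k.val * conjT s (g⁻¹).val)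
      = (g⁻¹).val * (k.val * conjT s k.val) * conjT s (g⁻¹).val := by simp only [mul_assoc]
    _ = ((g⁻¹).val * g.val) * y * (conjT s g.val * conjT s (g⁻¹).val) := by
        rw [← e]; simp only [mul_assoc]
    _ = y := by rw [g.inv_mul, h1, one_mul, mul_one]

theorem convOne_eq_zero {n : ℕ} (f : GL (Fin n) K → ℂ) (y : Herm s n)
    (hy : ¬ ∃ X : GL (Fin n) K, X.val * conjT s X.val = y.1) : convOne s f y = 0 := by
  rw [convOne]
  refine integral_eq_zero_of_ae (Filter.Eventually.of_forall fun g => ?_)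
  have : oneZero s n (g.val * y.1 * conjT s g.val) = 0 := by
    by_contra h
    exact hy (exists_of_oneZero_ne_zero g h)
  simp [this]

theorem quotient_out_eq {G : Type*} [Group G] {H : Subgroup G} {β : Type*} (φ : G → β)
    (hφ : ∀ g, ∀ k ∈ H, φ (g * k) = φ g) (g : G) : φ (g : G ⧸ H).out = φ g := by
  have h1 : ((g : G ⧸ H).out)⁻¹ * g ∈ H := by rw [← QuotientGroup.eq, QuotientGroup.out_eq']
  have h2 := hφ (g : G ⧸ H).out _ h1
  rw [mul_inv_cancel_left] at h2
  exact h2.symm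

theorem convOne_eq_integral (hso : ∀ x, ord K (s x) = ord K x) {n : ℕ}
    (f : GL (Fin n) K → ℂ) (hf : ∀ g, ∀ k ∈ maxK K n, f (g * k) = f g) (X : GL (Fin n) K)
    (y : Herm s n) (hX : X.val * conjT s X.val = y.1) :
    convOne s f y = ∫ u : unitary (n := n) s (1 : Matrix (Fin n) (Fin n) K),
      f (X * u.1) ∂(muU s n) := by
  haveI := locallyCompactSpace_unitary hso (1 : Matrix (Fin n) (Fin n) K)
  haveI := isHaarMeasure_muU hso n
  let φ : GL (Fin n) K → ℂ := fun g => f (X * g) * oneZero s n ((g⁻¹).val * conjT s (g⁻¹).val)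
  have hφ : ∀ g, ∀ k ∈ maxK K n, φ (g * k) = φ g := by
    intro g k hk
    simp only [φ]
    rw [← mul_assoc, hf _ k hk, mul_inv_rev, Units.val_mul, conjT_mul]
    congr 1
    rw [← oneZero_mul_mul ((g⁻¹).val * conjT s (g⁻¹).val) (inv_mem hk)]
    simp only [mul_assoc]
  have h1 : convOne s f y = ∫ g, φ g ∂(muGL K n) := by
    rw [convOne, ← integral_inv_eq_self _ (muGL K n), ← integral_mul_left_eq_self _ X]
    congr 1
    funext g
    simp only [φ, inv_inv, mul_inv_rev]
    congr 2
    have h2 : (X⁻¹).val * y.1 * conjT s (X⁻¹).val = 1 := by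
      rw [← hX]
      calc _ = ((X⁻¹).val * X.val) * (conjT s X.val * conjT s (X⁻¹).val) := by
            simp only [mul_assoc]
        _ = 1 := by rw [X.inv_mul, one_mul, ← conjT_mul, X.inv_mul, conjT_one]
    rw [Units.val_mul, conjT_mul]
    calc _ = (g⁻¹).val * ((X⁻¹).val * y.1 * conjT s (X⁻¹).val) * conjT s (g⁻¹).val := by
          simp only [mul_assoc]
      _ = _ := by rw [h2, mul_one]
  have hφu : ∀ u : unitary (n := n) s (1 : Matrix (Fin n) (Fin n) K), φ u.1 = f (X * u.1) := by
    intro u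
    have h3 := mul_conjT_of_mem_unitary (u⁻¹).2
    simp only [φ]
    have h4 : ((u.1⁻¹).val * conjT s (u.1⁻¹).val) = 1 := h3
    rw [h4, oneZero, Set.indicator_of_mem (show (1 : Matrix (Fin n) (Fin n) K) ∈
      {y | ∃ k ∈ maxK K n, y = k.val * conjT s k.val} from
        ⟨1, one_mem _, by simp [conjT_one]⟩)]
    simp
  rw [h1, integral_eq_tsum_quotient (isOpen_maxK n) (muGL_spec n).2 φ hφ,
    integral_eq_tsum_quotient (isOpen_unitaryK n) (muU_spec hso n).2 (fun u => f (X * u.1))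
      (fun u k hk => by
        change f (X * (u.1 * k.1)) = _
        rw [← mul_assoc]
        exact hf _ _ hk)]
  let j : (unitary (n := n) s (1 : Matrix (Fin n) (Fin n) K)) ⧸ unitaryK s n →
      GL (Fin n) K ⧸ maxK K n := fun x => (x.out.1 : GL (Fin n) K)
  have hj : Function.Injective j := by
    intro x x' h
    have h5 : x.out.1⁻¹ * x'.out.1 ∈ maxK K n := QuotientGroup.eq.1 h
    rw [← QuotientGroup.out_eq' x, ← QuotientGroup.out_eq' x']
    exact QuotientGroup.eq.2 h5
  rw [← hj.tsum_eq]
  · refine tsum_congr fun x => ?_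
    simp only [j]
    rw [quotient_out_eq φ hφ, hφu]
  · intro x hx
    have h6 : oneZero s n ((x.out⁻¹).val * 1 * conjT s (x.out⁻¹).val) ≠ 0 := by
      rw [mul_one]; exact right_ne_zero_of_mul hx
    obtain ⟨k, hk, e⟩ := Set.mem_of_indicator_ne_zero h6
    rw [mul_one] at e
    have h7 : x.out * k ∈ unitary s 1 := by
      have := inv_mul_mem_unitary e
      rwa [inv_inv] at this
    refine ⟨QuotientGroup.mk ⟨_, h7⟩, ?_⟩
    have h8 := quotient_out_eq (H := unitaryK s n)
      (fun u => (u.1 : GL (Fin n) K ⧸ maxK K n)) (fun u k hk =>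
        QuotientGroup.mk_mul_of_mem u.1 hk) ⟨_, h7⟩
    simp only [j]
    refine h8.trans ?_
    change ((x.out * k : GL (Fin n) K) : GL (Fin n) K ⧸ maxK K n) = x
    rw [QuotientGroup.mk_mul_of_mem _ hk, QuotientGroup.out_eq']

theorem ord_det_mul_conjT (hso : ∀ x, ord K (s x) = ord K x) {n : ℕ} (X : GL (Fin n) K) :
    ord K (X.val * conjT s X.val).det = 2 * ord K X.val.det := by
  have h : s X.val.det ≠ 0 := fun h => det_ne_zero_GL X (by simpa using h)
  rw [Matrix.det_mul, det_conjT, ord_mul (det_ne_zero_GL X) h, hso]; ring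

theorem ord_det_unitary (hso : ∀ x, ord K (s x) = ord K x) {n : ℕ} {u : GL (Fin n) K}
    (hu : u ∈ unitary s 1) : ord K u.val.det = 0 := by
  have h := ord_det_mul_conjT hso u
  rw [mul_conjT_of_mem_unitary hu, Matrix.det_one, ord_one] at h
  omega

theorem rPush_oneEnd_eq_zero (hso : ∀ x, ord K (s x) = ord K x) {n : ℕ} (h : Herm s n)
    (hh : ord K h.1.det < 0 ∨ Odd (ord K h.1.det)) : rPush s (oneEnd K n) h = 0 := by
  by_cases hex : ∃ X : GL (Fin n) K, X.val * conjT s X.val = h.1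
  · obtain ⟨X, hX⟩ := hex
    have h1 := ord_det_mul_conjT hso X
    rw [hX] at h1
    rcases hh with hh | hh
    · rw [rPush_eq_integral hso _ X h hX]
      refine integral_eq_zero_of_ae (Filter.Eventually.of_forall fun u => ?_)
      refine Set.indicator_of_notMem (fun hi => ?_) _
      have h2 := (mem_integer_iff_of_ne (det_ne_zero_GL (X * u.1))).1 (det_mem_integer hi)
      rw [ord_det_mul_GL, ord_det_unitary hso u.2] at h2
      omega
    · exfalso
      rw [h1] at hh
      exact (Int.not_odd_iff_even.2 ⟨_, two_mul _⟩) hh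
  · rw [rPush, dif_neg hex]

theorem oneD_mul_maxK (n d : ℕ) (g : GL (Fin n) K) {k k' : GL (Fin n) K} (hk : k ∈ maxK K n)
    (hk' : k' ∈ maxK K n) : oneD K n d (k * g * k') = oneD K n d g := by
  classical
  rw [oneD_eq, oneD_eq]
  have h1 : (k * g * k').val ∈ intMat K n n ↔ g.val ∈ intMat K n n := by
    constructor
    · intro h
      have h2 : g.val = (k⁻¹).val * (k * g * k').val * (k'⁻¹).val := by
        rw [← Units.val_mul, ← Units.val_mul]; congr 1; group
      rw [h2]
      exact intMat_mul (intMat_mul (mem_maxK_iff.1 hk).2 h) (mem_maxK_iff.1 hk').2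
    · intro h
      exact intMat_mul (intMat_mul (mem_maxK_iff.1 hk).1 h) (mem_maxK_iff.1 hk').1
  have h2 : ord K (k * g * k').val.det = ord K g.val.det := by
    rw [ord_det_mul_GL, ord_det_mul_GL, ord_det_of_mem_maxK hk, ord_det_of_mem_maxK hk']; ring
  rw [h1, h2]

theorem hasCompactSupport_oneD (n d : ℕ) : HasCompactSupport (oneD K n d) := by
  classical
  obtain ⟨c, hc⟩ := exists_ord_eq (K := K) d
  have hcO : (c : K) ∈ 𝒪[K] := (mem_integer_iff_of_ne c.ne_zero).2 (by rw [hc]; positivity)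
  refine HasCompactSupport.intro (isCompact_GL_bounded n c.ne_zero) fun g hg => ?_
  rw [oneD_eq, if_neg]
  rintro ⟨h1, h2⟩
  refine hg ⟨fun i j => mul_mem hcO (h1 i j), ?_⟩
  have h3 : (g⁻¹).val = (g.val.det)⁻¹ • g.val.adjugate := by
    rw [Matrix.coe_units_inv, Matrix.inv_def, Ring.inverse_eq_inv']
  rw [h3, smul_smul]
  intro i j
  refine mul_mem ((mem_integer_iff_of_ne (mul_ne_zero c.ne_zero
    (inv_ne_zero (det_ne_zero_GL g)))).2 ?_) ?_
  · rw [ord_mul c.ne_zero (inv_ne_zero (det_ne_zero_GL g)), ord_inv, hc, h2]; simp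
  rw [Matrix.adjugate_apply]
  refine det_mem_integer fun k l => ?_
  rw [Matrix.updateRow_apply]
  split_ifs
  · rw [Pi.single_apply]; split_ifs
    · exact one_mem _
    · exact zero_mem _
  · exact h1 k l

theorem isSpherical_oneD (n d : ℕ) : IsSpherical (oneD K n d) :=
  ⟨hasCompactSupport_oneD n d, fun _ hk _ hk' g => oneD_mul_maxK n d g hk hk'⟩

theorem det_ne_zero_of_exists {n : ℕ} {y : Matrix (Fin n) (Fin n) K}
    (h : ∃ X : GL (Fin n) K, X.val * conjT s X.val = y) : y.det ≠ 0 := by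
  obtain ⟨X, rfl⟩ := h
  rw [Matrix.det_mul, det_conjT]
  exact mul_ne_zero (det_ne_zero_GL X) (fun h => det_ne_zero_GL X (by simpa using h))

theorem convOne_oneD (hso : ∀ x, ord K (s x) = ord K x) {n : ℕ} (d : ℕ) (h : Herm s n)
    (hh : ord K h.1.det = 2 * d) : convOne s (oneD K n d) h = rPush s (oneEnd K n) h := by
  classical
  by_cases hex : ∃ X : GL (Fin n) K, X.val * conjT s X.val = h.1
  · obtain ⟨X, hX⟩ := hex
    rw [rPush_eq_integral hso _ X h hX, convOne_eq_integral hso _ (fun g k hk => by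
      simpa using oneD_mul_maxK n d g (one_mem _) hk) X h hX]
    congr 1
    funext u
    have h1 := ord_det_mul_conjT hso X
    rw [hX, hh] at h1
    have h2 : ord K (X * u.1).val.det = d := by
      rw [ord_det_mul_GL, ord_det_unitary hso u.2]; omega
    rw [oneD_eq, oneEnd]
    by_cases h3 : (X * u.1).val ∈ intMat K n n
    · rw [if_pos ⟨h3, h2⟩]
      exact (Set.indicator_of_mem h3 (1 : Matrix (Fin n) (Fin n) K → ℂ)).symm
    · rw [if_neg fun h => h3 h.1]
      exact (Set.indicator_of_notMem h3 (1 : Matrix (Fin n) (Fin n) K → ℂ)).symm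
  · rw [convOne_eq_zero _ _ hex, rPush, dif_neg hex]

theorem convOne_oneD_eq_zero (hso : ∀ x, ord K (s x) = ord K x) {n : ℕ} (d : ℕ) (h : Herm s n)
    (hh : ord K h.1.det ≠ 2 * d) : convOne s (oneD K n d) h = 0 := by
  classical
  by_cases hex : ∃ X : GL (Fin n) K, X.val * conjT s X.val = h.1
  · obtain ⟨X, hX⟩ := hex
    rw [convOne_eq_integral hso _ (fun g k hk => by
      simpa using oneD_mul_maxK n d g (one_mem _) hk) X h hX]
    refine integral_eq_zero_of_ae (Filter.Eventually.of_forall fun u => ?_)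
    have h1 := ord_det_mul_conjT hso X
    rw [hX] at h1
    have h2 : ord K (X * u.1).val.det ≠ d := by
      rw [ord_det_mul_GL, ord_det_unitary hso u.2]; omega
    change oneD K n d (X * u.1) = 0
    rw [oneD_eq, if_neg fun h => h2 h.2]
  · exact convOne_eq_zero _ _ hex

theorem phiGraded_eq_zero (hso : ∀ x, ord K (s x) = ord K x) {n : ℕ} (m : ℤ) (h : Herm s n)
    (hm : Odd m ∨ m < 0) : phiGraded s m h = 0 := by
  rw [phiGraded]
  split_ifs with h1
  · refine rPush_oneEnd_eq_zero hso h ?_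
    rw [h1.2]; exact hm.symm
  · rfl

theorem phiGraded_two_mul (hso : ∀ x, ord K (s x) = ord K x) {n : ℕ} (d : ℕ) (h : Herm s n) :
    phiGraded s (2 * d) h = convOne s (oneD K n d) h := by
  rw [phiGraded]
  split_ifs with h1
  · exact (convOne_oneD hso d h h1.2).symm
  · by_cases hd : ord K h.1.det = 2 * d
    · rw [convOne_eq_zero]
      intro hex
      exact h1 ⟨det_ne_zero_of_exists hex, hd⟩
    · exact (convOne_oneD_eq_zero hso d h hd).symm

theorem hasSum_convOne_oneD (hso : ∀ x, ord K (s x) = ord K x) {n : ℕ} (h : Herm s n) :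
    HasSum (fun d : ℕ => convOne s (oneD K n d) h) (rPush s (oneEnd K n) h) := by
  by_cases hd : ∃ d : ℕ, ord K h.1.det = 2 * d
  · obtain ⟨d, hd⟩ := hd
    rw [← convOne_oneD hso d h hd]
    refine hasSum_single d fun d' hd' => convOne_oneD_eq_zero hso d' h ?_
    rw [hd]
    intro h'
    exact hd' (by omega)
  · push Not at hd
    rw [rPush_oneEnd_eq_zero hso h, funext fun d => convOne_oneD_eq_zero hso d h (hd d)]
    · exact hasSum_zero
    · by_contra! hcon
      obtain ⟨c, hc⟩ := Int.not_odd_iff_even.1 hcon.2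
      exact hd c.toNat (by omega)

end PushForward


section Volumes

variable {K : Type*} [Field K] [ValuativeRel K] [TopologicalSpace K] [IsNonarchimedeanLocalField K]

/-! ### Volumes of lattices -/

theorem isUnit_integer_iff {x : 𝒪[K]} : IsUnit x ↔ (x : K) ≠ 0 ∧ ord K (x : K) = 0 := by
  constructor
  · rintro ⟨u, rfl⟩
    have h1 : ((u : 𝒪[K]) : K) * ((u⁻¹ : 𝒪[K]ˣ) : 𝒪[K]) = 1 := by
      rw [← Subring.coe_mul, u.mul_inv]; rfl
    have h2 : ((u : 𝒪[K]) : K) ≠ 0 := left_ne_zero_of_mul_eq_one h1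
    have h3 : (((u⁻¹ : 𝒪[K]ˣ) : 𝒪[K]) : K) ≠ 0 := right_ne_zero_of_mul_eq_one h1
    have h4 := (mem_integer_iff_of_ne h2).1 (u : 𝒪[K]).2
    have h5 := (mem_integer_iff_of_ne h3).1 ((u⁻¹ : 𝒪[K]ˣ) : 𝒪[K]).2
    have h6 := congrArg (ord K) h1
    rw [ord_mul h2 h3, ord_one] at h6
    exact ⟨h2, by omega⟩
  · rintro ⟨h1, h2⟩
    refine IsUnit.of_mul_eq_one ⟨(x : K)⁻¹, (mem_integer_iff_of_ne (inv_ne_zero h1)).2 ?_⟩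
      (Subtype.ext (mul_inv_cancel₀ h1))
    rw [ord_inv, h2]; simp

theorem residue_eq_zero_iff_ord {x : 𝒪[K]} :
    IsLocalRing.residue 𝒪[K] x = 0 ↔ (x : K) = 0 ∨ 1 ≤ ord K (x : K) := by
  rw [IsLocalRing.residue_eq_zero_iff, IsLocalRing.mem_maximalIdeal, mem_nonunits_iff,
    isUnit_integer_iff]
  have h := mem_integer_iff.1 x.2
  by_cases h0 : (x : K) = 0
  · simp [h0]
  · simp only [h0, false_or, ne_eq, not_false_eq_true, true_and] at h ⊢
    omega

theorem addHaar_mul_mem_integer [MeasurableSpace K] [BorelSpace K] (μ : Measure K)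
    [μ.IsAddHaarMeasure] (hμ : μ (𝒪[K] : Set K) = 1) (n : ℕ) :
    ∀ t : Kˣ, ord K (t : K) = n → μ {x | (t : K) * x ∈ 𝒪[K]} = (resCard K : ENNReal) ^ n := by
  induction n with
  | zero =>
    intro t ht
    have : {x | (t : K) * x ∈ 𝒪[K]} = (𝒪[K] : Set K) := by
      ext x
      by_cases hx : x = 0
      · simp [hx]
      · change (t : K) * x ∈ 𝒪[K] ↔ x ∈ 𝒪[K]
        rw [mul_mem_integer_iff hx t.ne_zero, ht, mem_integer_iff_of_ne hx]; simp
    rw [this, hμ, pow_zero]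
  | succ n ih =>
    intro t ht
    obtain ⟨t', ht'⟩ := exists_ord_eq (K := K) n
    let ρ : 𝓀[K] → 𝒪[K] := Function.surjInv (IsLocalRing.residue_surjective)
    have hρ : ∀ r, IsLocalRing.residue 𝒪[K] (ρ r) = r := Function.surjInv_eq _
    have hst : ∀ x : K, (t' : K) * x ∈ 𝒪[K] ↔ (t : K) * x = 0 ∨ 1 ≤ ord K ((t : K) * x) := by
      intro x
      by_cases hx : x = 0
      · simp [hx]
      · rw [mul_mem_integer_iff hx t'.ne_zero, ord_mul t.ne_zero hx, ht, ht']
        simp only [mul_eq_zero, t.ne_zero, hx, or_self, false_or]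
        push_cast
        constructor <;> intro h <;> linarith
    have hS : ∀ (r : 𝓀[K]) (x : K), (t' : K) * (x - (t : K)⁻¹ * ρ r) ∈ 𝒪[K] ↔
        ∃ h : (t : K) * x ∈ 𝒪[K], IsLocalRing.residue 𝒪[K] ⟨_, h⟩ = r := by
      intro r x
      have e : (t : K) * (x - (t : K)⁻¹ * ρ r) = t * x - ρ r := by
        rw [mul_sub, mul_inv_cancel_left₀ t.ne_zero]
      rw [hst, e]
      have key : ∀ h : (t : K) * x ∈ 𝒪[K], IsLocalRing.residue 𝒪[K] ⟨_, h⟩ = r ↔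
          ((t : K) * x - ρ r = 0 ∨ 1 ≤ ord K ((t : K) * x - ρ r)) := by
        intro h
        rw [← sub_eq_zero]
        conv_lhs => rw [← hρ r, ← map_sub]
        exact residue_eq_zero_iff_ord
      constructor
      · intro h
        have h1 : (t : K) * x - ρ r ∈ 𝒪[K] :=
          mem_integer_iff.2 (h.imp_right fun h => by omega)
        have h2 : (t : K) * x ∈ 𝒪[K] := by
          have := add_mem h1 (ρ r).2
          rwa [sub_add_cancel] at this
        exact ⟨h2, (key h2).2 h⟩
      · rintro ⟨h, h'⟩
        exact (key h).1 h'
    have hU : {x | (t : K) * x ∈ 𝒪[K]} = ⋃ r : 𝓀[K],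
        (fun x => x + -((t : K)⁻¹ * ρ r)) ⁻¹' {x | (t' : K) * x ∈ 𝒪[K]} := by
      ext x
      simp_rw [← sub_eq_add_neg]
      simp only [Set.mem_ofPred_eq, Set.mem_iUnion, Set.mem_preimage, hS]
      exact ⟨fun h => ⟨_, h, rfl⟩, fun ⟨_, h, _⟩ => h⟩
    have hm : MeasurableSet {x | (t' : K) * x ∈ 𝒪[K]} :=
      (isOpen_integer.preimage (continuous_const.mul continuous_id)).measurableSet
    haveI : Fintype 𝓀[K] := Fintype.ofFinite _
    rw [hU, measure_iUnion]
    · simp_rw [measure_preimage_add_right, ih t' ht']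
      rw [tsum_fintype, Finset.sum_const, Finset.card_univ, ← Nat.card_eq_fintype_card, pow_succ',
        nsmul_eq_mul]
      rfl
    · intro r r' hrr'
      refine Set.disjoint_left.2 fun x hx hx' => hrr' ?_
      rw [Set.mem_preimage, ← sub_eq_add_neg] at hx hx'
      obtain ⟨h, h1⟩ := (hS r x).1 hx
      obtain ⟨h', h2⟩ := (hS r' x).1 hx'
      exact h1.symm.trans h2
    · intro r
      exact hm.preimage (continuous_id.add continuous_const).measurable

instance instMeasurableSpaceMatrix (m n : ℕ) : MeasurableSpace (Matrix (Fin m) (Fin n) K) :=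
  borel _

instance instBorelSpaceMatrix (m n : ℕ) : BorelSpace (Matrix (Fin m) (Fin n) K) := ⟨rfl⟩

variable (K) in
/-- Haar measure on matrices, giving integral matrices volume one. -/
def muMat (a b : ℕ) : Measure (Matrix (Fin a) (Fin b) K) := normalizedAddHaar _ (intMat K a b)

theorem muMat_spec (a b : ℕ) :
    (muMat K a b).IsAddHaarMeasure ∧ muMat K a b (intMat K a b) = 1 :=
  normalizedAddHaar_spec (isCompact_intMat a b) (isOpen_intMat a b) ⟨0, zero_mem_intMat a b⟩

instance (a b : ℕ) : (muMat K a b).IsAddHaarMeasure := (muMat_spec a b).1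

theorem normalizedAddHaar_apply_eq {A : Type*} [AddGroup A] [TopologicalSpace A]
    [IsTopologicalAddGroup A] [LocallyCompactSpace A] [SecondCountableTopology A]
    {m m' : MeasurableSpace A} (hm : m = borel A) (hm' : m' = borel A) {C : Set A}
    (hC : IsCompact C) (ho : IsOpen C) (hn : C.Nonempty) (ν : @Measure A m')
    (hν : @Measure.IsAddHaarMeasure A _ _ m' ν) (h1 : ν C = 1) (S : Set A) :
    (@normalizedAddHaar A _ _ m C) S = ν S := by
  obtain rfl : m = m' := hm.trans hm'.symm
  haveI : BorelSpace A := ⟨hm⟩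
  obtain ⟨h2, h3⟩ := normalizedAddHaar_spec hC ho hn
  rw [addHaar_unique_of_eq (μ := ν) (C := C) (by rw [h1]; exact one_ne_zero)
    (by rw [h1]; exact ENNReal.one_ne_top) (h3.trans h1.symm)]

theorem muMat_diagonal_mul (a b : ℕ) (t : Fin a → Kˣ) (l : Fin a → ℕ)
    (ht : ∀ i, ord K (t i : K) = l i) :
    muMat K a b {x | Matrix.diagonal (fun i => (t i : K)) * x ∈ intMat K a b} =
      ((resCard K : ENNReal) ^ b) ^ ∑ i, l i := by
  letI : MeasurableSpace K := borel K
  haveI : BorelSpace K := ⟨rfl⟩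
  obtain ⟨h1, h2⟩ := normalizedAddHaar_spec (isCompact_integer (K := K)) isOpen_integer
    ⟨0, zero_mem _⟩
  set μ := normalizedAddHaar K (𝒪[K] : Set K) with hμ
  haveI : SigmaFinite (Measure.pi fun _ : Fin b => μ) := inferInstance
  haveI : (Measure.pi fun _ : Fin b => μ).IsAddHaarMeasure := inferInstance
  let ν : Measure (Fin a → Fin b → K) := Measure.pi fun _ => Measure.pi fun _ => μ
  haveI : ν.IsAddHaarMeasure :=
    inferInstanceAs (Measure.pi fun _ : Fin a => Measure.pi fun _ : Fin b => μ).IsAddHaarMeasure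
  have key : ∀ (s : Fin a → K), ν {x | ∀ i j, s i * x i j ∈ 𝒪[K]} =
      ∏ i, ∏ _j : Fin b, μ {y | s i * y ∈ 𝒪[K]} := by
    intro s
    have : {x : Fin a → Fin b → K | ∀ i j, s i * x i j ∈ 𝒪[K]} =
        Set.univ.pi fun i => Set.univ.pi fun _ => {y | s i * y ∈ 𝒪[K]} := by
      ext x
      simp
    rw [this, Measure.pi_pi]
    simp_rw [Measure.pi_pi]
  have h3 : ν {x | ∀ i j, x i j ∈ 𝒪[K]} = 1 := by
    have := key 1
    simp only [Pi.one_apply, one_mul] at this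
    rw [this, show {y | y ∈ 𝒪[K]} = (𝒪[K] : Set K) from rfl, h2]
    simp
  have h4 := normalizedAddHaar_apply_eq (A := Fin a → Fin b → K) (m := borel _) rfl
    BorelSpace.measurable_eq (isCompact_intMat (K := K) a b)
    (isOpen_intMat a b) ⟨0, zero_mem_intMat a b⟩ ν inferInstance h3
    {x | ∀ i j, (t i : K) * x i j ∈ 𝒪[K]}
  have h5 : {x | Matrix.diagonal (fun i => (t i : K)) * x ∈ intMat K a b} =
      {x : Matrix (Fin a) (Fin b) K | ∀ i j, (t i : K) * x i j ∈ 𝒪[K]} := by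
    ext x
    simp [intMat, Matrix.diagonal_mul]
  rw [h5]
  refine h4.trans ?_
  rw [key]
  simp_rw [addHaar_mul_mem_integer μ h2 _ _ (ht _)]
  simp only [Finset.prod_const, Finset.card_univ, Fintype.card_fin, ← pow_mul]
  rw [Finset.prod_pow_eq_pow_sum, Finset.mul_sum]
  simp_rw [mul_comm b]

theorem measurePreserving_maxK_mul_mul {a b : ℕ} {k₁ : GL (Fin a) K} {k₂ : GL (Fin b) K}
    (h₁ : k₁ ∈ maxK K a) (h₂ : k₂ ∈ maxK K b) :
    MeasurePreserving (fun x : Matrix (Fin a) (Fin b) K => k₁.val * x * k₂.val)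
      (muMat K a b) (muMat K a b) ∧
    MeasurableEmbedding (fun x : Matrix (Fin a) (Fin b) K => k₁.val * x * k₂.val) := by
  let e : Matrix (Fin a) (Fin b) K ≃ₜ+ Matrix (Fin a) (Fin b) K :=
    { toFun := fun x => k₁.val * x * k₂.val
      invFun := fun x => (k₁⁻¹).val * x * (k₂⁻¹).val
      left_inv := fun x => by
        beta_reduce
        rw [Matrix.mul_assoc, Matrix.mul_assoc, k₂.mul_inv, Matrix.mul_one, ← Matrix.mul_assoc,
          k₁.inv_mul, Matrix.one_mul]
      right_inv := fun x => by
        beta_reduce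
        rw [Matrix.mul_assoc, Matrix.mul_assoc, k₂.inv_mul, Matrix.mul_one, ← Matrix.mul_assoc,
          k₁.mul_inv, Matrix.one_mul]
      map_add' := fun x y => by rw [Matrix.mul_add, Matrix.add_mul]
      continuous_toFun := by fun_prop
      continuous_invFun := by fun_prop }
  have hm : Measurable e := e.continuous_toFun.measurable
  haveI := e.isAddHaarMeasure_map (muMat K a b)
  have h3 : (muMat K a b).map e (intMat K a b) = muMat K a b (intMat K a b) := by
    rw [Measure.map_apply hm (isOpen_intMat a b).measurableSet]
    congr 1
    ext x
    constructor
    · intro h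
      rw [← e.symm_apply_apply x]
      exact intMat_mul (intMat_mul (mem_maxK_iff.1 h₁).2 h) (mem_maxK_iff.1 h₂).2
    · intro h
      exact intMat_mul (intMat_mul (mem_maxK_iff.1 h₁).1 h) (mem_maxK_iff.1 h₂).1
  refine ⟨⟨hm, ?_⟩, e.toHomeomorph.measurableEmbedding⟩
  refine addHaar_unique_of_eq (μ := muMat K a b) (ν := (muMat K a b).map e) (C := intMat K a b)
    ?_ ?_ h3
  · rw [(muMat_spec a b).2]; exact one_ne_zero
  · rw [(muMat_spec a b).2]; exact ENNReal.one_ne_top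

theorem muMat_mul_mem_intMat {a b : ℕ} (m : GL (Fin a) K) (hm : m.val ∈ intMat K a a) :
    muMat K a b {x | m.val * x ∈ intMat K a b} =
      ((resCard K : ENNReal) ^ b) ^ (ord K m.val.det).toNat := by
  obtain ⟨l, -, hl⟩ := exists_mem_doubleCoset hm
  rw [(ord_det_of_mem_doubleCoset hl).2]
  obtain ⟨k, hk, k', hk', t, ht, e⟩ := hl
  have h1 : {x : Matrix (Fin a) (Fin b) K | m.val * x ∈ intMat K a b} =
      (fun x => k'.val * x * (1 : GL (Fin b) K).val) ⁻¹'
        {x | Matrix.diagonal (fun i => (t i : K)) * x ∈ intMat K a b} := by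
    ext x
    simp only [Set.mem_ofPred_eq, Set.mem_preimage, Units.val_one, Matrix.mul_one]
    have h2 : m.val * x = k.val * (Matrix.diagonal (fun i => (t i : K)) * (k'.val * x)) := by
      rw [e]; simp only [Matrix.mul_assoc]
    rw [h2]
    constructor
    · intro h
      have := intMat_mul (mem_maxK_iff.1 hk).2 h
      rwa [← Matrix.mul_assoc, k.inv_mul, Matrix.one_mul] at this
    · exact fun h => intMat_mul (mem_maxK_iff.1 hk).1 h
  have h3 : IsOpen {x : Matrix (Fin a) (Fin b) K |
      Matrix.diagonal (fun i => (t i : K)) * x ∈ intMat K a b} :=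
    (isOpen_intMat a b).preimage (by fun_prop)
  rw [h1, (measurePreserving_maxK_mul_mul hk' (one_mem _)).1.measure_preimage
    h3.measurableSet.nullMeasurableSet, muMat_diagonal_mul a b t l ht, ← Nat.cast_sum,
    Int.toNat_natCast]

end Volumes


section Xi

variable {K : Type*} [Field K] [ValuativeRel K] [TopologicalSpace K] [IsNonarchimedeanLocalField K]
  {a b : ℕ}

/-! ### The morphism `ξ` -/

theorem absK_pos {x : K} (hx : x ≠ 0) : 0 < absK K x := by
  rw [absK_of_ne hx]
  exact zpow_pos (by exact_mod_cast zero_lt_one.trans (resCard_gt_one (K := K))) _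

theorem xi_eq {f : GL (Fin (a + b)) K → ℂ} (hf : IsSpherical f) (m : GL (Fin a) K × GL (Fin b) K) :
    xi f m = ((absK K m.1.val.det ^ b : ℝ) : ℂ) *
      ∫ x, f (parab m.1 m.2 x) ∂(muMat K a b) := by
  have h1 : ∀ x, ∫ k in (maxK K (a + b) : Set (GL (Fin (a + b)) K)),
      f (k * parab m.1 m.2 x * k⁻¹) ∂(muGL K (a + b)) = f (parab m.1 m.2 x) := by
    intro x
    rw [setIntegral_congr_fun (g := fun _ => f (parab m.1 m.2 x))
      (isOpen_maxK (a + b)).measurableSet fun k hk => hf.2 k hk _ (inv_mem hk) _,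
      setIntegral_const, Measure.real, (muGL_spec (K := K) (a + b)).2]
    simp
  have h2 : parabolicDescent f m =
      (((absK K m.1.val.det ^ b * (absK K m.2.val.det ^ a)⁻¹) ^ (1 / 2 : ℝ) : ℝ) : ℂ) *
      ∫ x, f (parab m.1 m.2 x) ∂(muMat K a b) := by
    rw [← funext h1]
    rfl
  have hA := absK_pos (det_ne_zero_GL m.1)
  have hB := absK_pos (det_ne_zero_GL m.2)
  rw [xi, h2, ← mul_assoc, ← Complex.ofReal_mul]
  congr 2
  generalize absK K m.1.val.det = A at *
  generalize absK K m.2.val.det = B at *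
  rw [Real.mul_rpow (by positivity) (by positivity), ← Real.rpow_natCast, ← Real.rpow_natCast,
    ← Real.rpow_neg hB.le, ← Real.rpow_mul hA.le, ← Real.rpow_mul hB.le]
  calc _ = (A ^ ((b : ℝ) / 2) * A ^ ((b : ℝ) * (1 / 2))) *
        (B ^ ((a : ℝ) / 2) * B ^ (-(a : ℝ) * (1 / 2))) := by ring
    _ = _ := by
      rw [← Real.rpow_add hA, ← Real.rpow_add hB,
        show (a : ℝ) / 2 + -(a : ℝ) * (1 / 2) = 0 by ring,
        show (b : ℝ) / 2 + (b : ℝ) * (1 / 2) = b by ring, Real.rpow_zero, mul_one]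

theorem oneD_parab (d : ℕ) (m : GL (Fin a) K × GL (Fin b) K) (x : Matrix (Fin a) (Fin b) K) :
    oneD K (a + b) d (parab m.1 m.2 x) =
      {x | m.1.val * x ∈ intMat K a b}.indicator
        (fun _ => ∑ p ∈ Finset.HasAntidiagonal.antidiagonal d,
          oneD K a p.1 m.1 * oneD K b p.2 m.2) x := by
  classical
  have h1 : ∑ p ∈ Finset.HasAntidiagonal.antidiagonal d, oneD K a p.1 m.1 * oneD K b p.2 m.2 =
      if m.1.val ∈ intMat K a a ∧ m.2.val ∈ intMat K b b ∧
        ord K m.1.val.det + ord K m.2.val.det = d then 1 else 0 := by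
    simp_rw [oneD_eq, ite_zero_mul_ite_zero, mul_one]
    split_ifs with h
    · have h2 := (mem_integer_iff_of_ne (det_ne_zero_GL m.1)).1 (det_mem_integer h.1)
      have h3 := (mem_integer_iff_of_ne (det_ne_zero_GL m.2)).1 (det_mem_integer h.2.1)
      rw [Finset.sum_eq_single_of_mem
        ((ord K m.1.val.det).toNat, (ord K m.2.val.det).toNat), if_pos]
      · exact ⟨⟨h.1, by simp [h2]⟩, h.2.1, by simp [h3]⟩
      · rw [Finset.HasAntidiagonal.mem_antidiagonal]; omega
      · rintro ⟨i, j⟩ - hij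
        rw [if_neg]
        rintro ⟨⟨-, h4⟩, -, h5⟩
        apply hij
        dsimp only at h4 h5
        rw [h4, h5]; simp
    · refine Finset.sum_eq_zero fun p hp => if_neg ?_
      rintro ⟨⟨h2, h3⟩, h4, h5⟩
      refine h ⟨h2, h4, ?_⟩
      rw [h3, h5, ← Finset.HasAntidiagonal.mem_antidiagonal.1 hp]; push_cast; rfl
  rw [h1, oneD_eq, parab_val, blk_mem_intMat, det_blk, ord_mul (det_ne_zero_GL _) (det_ne_zero_GL _),
    Set.indicator_apply]
  simp only [zero_mem_intMat, true_and, Set.mem_ofPred_eq]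
  by_cases hx : m.1.val * x ∈ intMat K a b <;> simp [hx, and_assoc]

theorem xi_oneD (d : ℕ) (m : GL (Fin a) K × GL (Fin b) K) :
    xi (oneD K (a + b) d) m =
      ∑ p ∈ Finset.HasAntidiagonal.antidiagonal d, oneD K a p.1 m.1 * oneD K b p.2 m.2 := by
  classical
  rw [xi_eq (isSpherical_oneD (a + b) d)]
  simp_rw [oneD_parab d m]
  have ho : IsOpen {x : Matrix (Fin a) (Fin b) K | m.1.val * x ∈ intMat K a b} :=
    (isOpen_intMat a b).preimage (by fun_prop)
  rw [integral_indicator_const _ ho.measurableSet]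
  by_cases hm : m.1.val ∈ intMat K a a
  · have h2 := (mem_integer_iff_of_ne (det_ne_zero_GL m.1)).1 (det_mem_integer hm)
    rw [Measure.real, muMat_mul_mem_intMat m.1 hm, absK_of_ne (det_ne_zero_GL m.1)]
    obtain ⟨l, hl⟩ := Int.eq_ofNat_of_zero_le h2
    have hq : (resCard K : ℝ) ≠ 0 := by
      exact_mod_cast (zero_lt_one.trans (resCard_gt_one (K := K))).ne'
    rw [hl]
    simp only [Int.toNat_natCast, ENNReal.toReal_pow, ENNReal.toReal_natCast, zpow_neg,
      zpow_natCast, Complex.real_smul, ← mul_assoc, ← Complex.ofReal_mul]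
    rw [inv_pow, ← pow_mul, ← pow_mul, mul_comm b, inv_mul_cancel₀ (pow_ne_zero _ hq)]
    simp
  · rw [Finset.sum_eq_zero]
    · simp
    · intro p _
      rw [oneD_eq, if_neg fun h => hm h.1, zero_mul]

/-! ### The Satake transform -/

theorem sum_iwasawa {n : ℕ} (g : GL (Fin n) K) : ∑ i, iwasawa g i = ord K g.val.det := by
  obtain ⟨u, hu, hu1, t, ht, k, hk, e⟩ := isIwasawa_iwasawa g
  have h1 : u.det = 1 := by rw [Matrix.det_of_isUpperTriangular hu]; simp [hu1]
  have h2 : ∏ i, (t i : K) ≠ 0 := Finset.prod_ne_zero_iff.2 fun i _ => (t i).ne_zero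
  rw [e, Matrix.det_mul, Matrix.det_mul, h1, one_mul, Matrix.det_diagonal,
    ord_mul h2 (det_ne_zero_GL k), ord_det_of_mem_maxK hk, add_zero,
    ord_prod _ _ fun i _ => (t i).ne_zero]
  exact Finset.sum_congr rfl fun i _ => (ht i).symm

theorem satakeKernel_mul_maxK {n : ℕ} (s : Fin n → ℂ) (g : GL (Fin n) K) {k : GL (Fin n) K}
    (hk : k ∈ maxK K n) : satakeKernel s (g * k) = satakeKernel s g := by
  rw [satakeKernel, iwasawa_mul_maxK g hk, satakeKernel]

theorem satakeKernel_parab (sa : Fin a → ℂ) (sb : Fin b → ℂ) (m₁ : GL (Fin a) K)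
    (m₂ : GL (Fin b) K) (x : Matrix (Fin a) (Fin b) K) :
    satakeKernel (Fin.append (fun i => sa i + (b : ℂ) / 2) (fun j => sb j + (a : ℂ) / 2))
      (parab m₁ m₂ x) =
    ((absK K m₁.val.det ^ b : ℝ) : ℂ) * (satakeKernel sa m₁ * satakeKernel sb m₂) := by
  have hq : (resCard K : ℂ) ≠ 0 := by
    exact_mod_cast (zero_lt_one.trans (resCard_gt_one (K := K))).ne'
  have h1 : ((absK K m₁.val.det ^ b : ℝ) : ℂ) =
      ∏ i, (resCard K : ℂ) ^ (-(iwasawa m₁ i : ℂ) * b) := by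
    rw [absK_of_ne (det_ne_zero_GL m₁), ← sum_iwasawa, ← Finset.sum_neg_distrib]
    push_cast
    rw [← zpow_natCast, ← zpow_mul, Finset.sum_mul, ← Complex.cpow_intCast]
    push_cast
    simp only [Complex.cpow_def_of_ne_zero hq, ← Complex.exp_sum]
    congr 1
    rw [← Finset.mul_sum]
  rw [h1, satakeKernel, iwasawa_parab, Fin.prod_univ_add, satakeKernel, satakeKernel, ← mul_assoc,
    ← Finset.prod_mul_distrib]
  congr 1
  · refine Finset.prod_congr rfl fun i _ => ?_
    rw [Fin.append_left, Fin.append_left, ← Complex.cpow_add _ _ hq]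
    congr 1
    simp only [Fin.val_castAdd]
    push_cast
    ring
  · refine Finset.prod_congr rfl fun i _ => ?_
    rw [Fin.append_right, Fin.append_right]
    congr 1
    simp only [Fin.val_natAdd]
    push_cast
    ring

theorem finite_support_quotient {G : Type*} [Group G] [TopologicalSpace G] [IsTopologicalGroup G]
    {H : Subgroup G} (hH : IsOpen (H : Set G)) {f : G → ℂ} (hf : HasCompactSupport f) :
    (Function.support fun x : G ⧸ H => f x.out).Finite := by
  haveI := QuotientGroup.discreteTopology hH
  have h1 : IsCompact ((QuotientGroup.mk : G → G ⧸ H) '' tsupport f) :=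
    hf.isCompact.image continuous_quot_mk
  refine (h1.finite_of_discrete).subset fun x hx => ?_
  exact ⟨x.out, subset_tsupport _ hx, QuotientGroup.out_eq' x⟩

variable (K) in
/-- Integral matrices as a subgroup. -/
def intMatSubgroup (a b : ℕ) : AddSubgroup (Matrix (Fin a) (Fin b) K) where
  carrier := intMat K a b
  zero_mem' := zero_mem_intMat a b
  add_mem' := intMat_add
  neg_mem' := fun h i j => neg_mem (h i j)

theorem parab_mul_maxK {m₁ k₁ : GL (Fin a) K} {m₂ k₂ : GL (Fin b) K}
    (x : Matrix (Fin a) (Fin b) K) :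
    parab (m₁ * k₁) (m₂ * k₂) x =
      parab m₁ m₂ (k₁.val * x * (k₂⁻¹).val) * parab k₁ k₂ 0 := by
  rw [parab_mul]
  congr 1
  rw [zero_add, Matrix.mul_assoc, Matrix.mul_assoc, k₂.inv_mul, Matrix.mul_one, ← Matrix.mul_assoc,
    k₁.inv_mul, Matrix.one_mul]

/-- The Iwasawa decomposition of the set of cosets. -/
theorem bijective_parab_out : Function.Bijective
    (fun p : ((GL (Fin a) K × GL (Fin b) K) ⧸ (maxK K a).prod (maxK K b)) ×
        (Matrix (Fin a) (Fin b) K ⧸ intMatSubgroup K a b) =>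
      (parab p.1.out.1 p.1.out.2 p.2.out : GL (Fin (a + b)) K ⧸ maxK K (a + b))) := by
  constructor
  · rintro ⟨m, x⟩ ⟨m', x'⟩ h
    have h1 := QuotientGroup.eq.1 h
    rw [parab_inv, parab_mul, parab_mem_maxK] at h1
    obtain ⟨h2, h3, h4⟩ := h1
    obtain rfl : m = m' := by
      rw [← QuotientGroup.out_eq' m, ← QuotientGroup.out_eq' m', QuotientGroup.eq]
      exact ⟨h2, h3⟩
    congr 1
    rw [← QuotientAddGroup.out_eq' x, ← QuotientAddGroup.out_eq' x', QuotientAddGroup.eq]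
    change -x.out + x'.out ∈ intMat K a b
    convert h4 using 1
    rw [Matrix.mul_neg, Matrix.neg_mul, Matrix.mul_assoc, Matrix.mul_assoc, Matrix.mul_assoc,
      Units.inv_mul, Matrix.mul_one, ← Matrix.mul_assoc, Units.inv_mul, Matrix.one_mul, add_comm]
  · intro g
    obtain ⟨m₁, m₂, x, k, hk, e⟩ := exists_parab_mul g.out
    let m : (GL (Fin a) K × GL (Fin b) K) ⧸ (maxK K a).prod (maxK K b) :=
      QuotientGroup.mk (m₁, m₂)
    have hm : m.out⁻¹ * (m₁, m₂) ∈ (maxK K a).prod (maxK K b) := by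
      rw [← QuotientGroup.eq, QuotientGroup.out_eq']
    obtain ⟨hm1, hm2⟩ := hm
    set k₁ := m.out.1⁻¹ * m₁ with hk₁
    set k₂ := m.out.2⁻¹ * m₂ with hk₂
    replace hm1 : k₁ ∈ maxK K a := hm1
    replace hm2 : k₂ ∈ maxK K b := hm2
    let y := k₁.val * x * (k₂⁻¹).val
    have e1 : parab m₁ m₂ x = parab m.out.1 m.out.2 y * parab k₁ k₂ 0 := by
      rw [← parab_mul_maxK]; simp [hk₁, hk₂]
    let x' : Matrix (Fin a) (Fin b) K ⧸ intMatSubgroup K a b := QuotientAddGroup.mk y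
    have hx : -x'.out + y ∈ intMat K a b := by
      have : -x'.out + y ∈ intMatSubgroup K a b := by
        rw [← QuotientAddGroup.eq, QuotientAddGroup.out_eq']
      exact this
    have e2 : parab m.out.1 m.out.2 y =
        parab m.out.1 m.out.2 x'.out * parab 1 1 (-x'.out + y) := by
      rw [parab_mul]; simp
    refine ⟨(m, x'), ?_⟩
    rw [← QuotientGroup.out_eq' g, e, e1, e2, QuotientGroup.mk_mul_of_mem _ hk,
      QuotientGroup.mk_mul_of_mem _ (parab_mem_maxK.2 ⟨hm1, hm2, zero_mem_intMat _ _⟩),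
      QuotientGroup.mk_mul_of_mem _ (parab_mem_maxK.2 ⟨one_mem _, one_mem _, hx⟩)]

theorem tsum_quotient_parab (Φ : GL (Fin (a + b)) K → ℂ)
    (hΦ : ∀ g, ∀ k ∈ maxK K (a + b), Φ (g * k) = Φ g)
    (hfin : (Function.support fun x : GL (Fin (a + b)) K ⧸ maxK K (a + b) => Φ x.out).Finite) :
    ∑' x : GL (Fin (a + b)) K ⧸ maxK K (a + b), Φ x.out =
      ∑' m : (GL (Fin a) K × GL (Fin b) K) ⧸ (maxK K a).prod (maxK K b),
        ∑' x : Matrix (Fin a) (Fin b) K ⧸ intMatSubgroup K a b,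
          Φ (parab m.out.1 m.out.2 x.out) := by
  let e := Equiv.ofBijective _ (bijective_parab_out (K := K) (a := a) (b := b))
  have hsum : Summable fun x : GL (Fin (a + b)) K ⧸ maxK K (a + b) => Φ x.out :=
    summable_of_hasFiniteSupport hfin
  have he : ∀ p, Φ (e p).out = Φ (parab p.1.out.1 p.1.out.2 p.2.out) := fun p =>
    quotient_out_eq Φ hΦ _
  have hsum' : Summable fun p => Φ (e p).out := (e.summable_iff).2 hsum
  rw [← e.tsum_eq, hsum'.tsum_prod]
  simp only [he]

theorem satake_xi {f : GL (Fin (a + b)) K → ℂ} (hf : IsSpherical f) (sa : Fin a → ℂ)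
    (sb : Fin b → ℂ) : satake₂ (xi (a := a) (b := b) f) sa sb =
      satake f (Fin.append (fun i => sa i + (b : ℂ) / 2) (fun j => sb j + (a : ℂ) / 2)) := by
  have hfr : ∀ g, ∀ k ∈ maxK K (a + b), f (g * k) = f g := fun g k hk => by
    simpa using hf.2 1 (one_mem _) k hk g
  set s := Fin.append (fun i => sa i + (b : ℂ) / 2) (fun j => sb j + (a : ℂ) / 2) with hs
  have hinv : ∀ m : GL (Fin a) K × GL (Fin b) K, ∀ k ∈ (maxK K a).prod (maxK K b),
      ∫ x, f (parab (m * k).1 (m * k).2 x) ∂(muMat K a b) =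
      ∫ x, f (parab m.1 m.2 x) ∂(muMat K a b) := by
    intro m k hk
    have h1 : ∀ x, f (parab (m * k).1 (m * k).2 x) =
        f (parab m.1 m.2 (k.1.val * x * (k.2⁻¹).val)) := fun x => by
      rw [Prod.fst_mul, Prod.snd_mul, parab_mul_maxK, hfr _ _
        (parab_mem_maxK.2 ⟨hk.1, hk.2, zero_mem_intMat _ _⟩)]
    simp_rw [h1]
    have h2 := measurePreserving_maxK_mul_mul hk.1 (inv_mem hk.2)
    exact h2.1.integral_comp h2.2 (fun x => f (parab m.1 m.2 x))
  haveI : ((muGL K a).prod (muGL K b)).IsMulLeftInvariant := Measure.prod.instIsMulLeftInvariant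
  have hM : ∫ m, xi f m * (satakeKernel sa m.1 * satakeKernel sb m.2)
      ∂((muGL K a).prod (muGL K b)) = _ :=
    integral_eq_tsum_quotient (G := GL (Fin a) K × GL (Fin b) K)
      (K := (maxK K a).prod (maxK K b)) ((isOpen_maxK a).prod (isOpen_maxK b)) (by
        rw [Subgroup.coe_prod, Measure.prod_prod, (muGL_spec a).2, (muGL_spec b).2, one_mul]) _ (by
        intro m k hk
        rw [xi_eq hf, xi_eq hf, hinv m k hk, Prod.fst_mul, Prod.snd_mul,
          satakeKernel_mul_maxK _ _ hk.1, satakeKernel_mul_maxK _ _ hk.2]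
        congr 4
        have hd := det_ne_zero_GL (m.1 * k.1)
        rw [absK_of_ne hd, absK_of_ne (det_ne_zero_GL m.1), ord_det_mul_GL,
          ord_det_of_mem_maxK hk.1, add_zero])
  rw [satake₂, hM, satake, integral_eq_tsum_quotient (isOpen_maxK (a + b)) (muGL_spec (a + b)).2]
  swap
  · intro g k hk
    rw [hfr _ _ hk, satakeKernel_mul_maxK _ _ hk]
  rw [tsum_quotient_parab (fun g => f g * satakeKernel s g) (fun g k hk => by
      rw [hfr _ _ hk, satakeKernel_mul_maxK _ _ hk])
    ((finite_support_quotient (isOpen_maxK (a + b)) hf.1).subset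
      fun x hx => left_ne_zero_of_mul hx)]
  refine tsum_congr fun m => ?_
  simp_rw [hs, satakeKernel_parab]
  rw [tsum_mul_right, xi_eq hf, integral_eq_tsum_addQuotient (K := intMatSubgroup K a b)
    (isOpen_intMat a b) (muMat_spec a b).2]
  · ring
  · intro x k hk
    have : parab m.out.1 m.out.2 (x + k) = parab m.out.1 m.out.2 x * parab 1 1 k := by
      rw [parab_mul]; simp [add_comm]
    rw [this, hfr _ _ (parab_mem_maxK.2 ⟨one_mem _, one_mem _, hk⟩)]

end Xi


section WeightedTransfer

/-! ### Comparison of weighted sums of orbital integrals -/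

theorem orbit_mk_eq {G Y : Type*} [Group G] {ρ : G →* Equiv.Perm Y} {y y' : Y} :
    (Quotient.mk (orbitSetoid ρ) y = Quotient.mk (orbitSetoid ρ) y') ↔ ∃ g, ρ g y' = y := by
  rw [Quotient.eq]
  constructor
  · rintro ⟨⟨_, g, rfl⟩, h⟩
    exact ⟨g, h⟩
  · rintro ⟨g, h⟩
    exact ⟨⟨_, g, rfl⟩, h⟩

theorem exists_out_eq {G Y : Type*} [Group G] {ρ : G →* Equiv.Perm Y} (y : Y) :
    ∃ g, ρ g y = (Quotient.mk (orbitSetoid ρ) y).out :=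
  orbit_mk_eq.1 (Quotient.out_eq _)

theorem orbInt_eq_zero {G Y : Type*} [Group G] [TopologicalSpace G] [MeasurableSpace G]
    (μ : Measure G) (ρ : G →* Equiv.Perm Y) (f : Y → ℂ) (y : Y) (h : ∀ g, f (ρ g y) = 0) :
    orbInt μ ρ f y = 0 := by
  simp [orbInt, h]

theorem weightedOrbInt_congr {G Y : Type*} [Group G] [TopologicalSpace G] [MeasurableSpace G]
    (μ : Measure G) (ρ : G →* Equiv.Perm Y) (st : Y → Prop) (κ : Y → ℂ) (f f' : Y → ℂ)
    (hst : ∀ g y, st y → st (ρ g y)) (h : ∀ y, st y → f y = f' y) :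
    weightedOrbInt μ ρ st κ f = weightedOrbInt μ ρ st κ f' := by
  rw [weightedOrbInt, weightedOrbInt]
  refine finsum_congr fun ω => ?_
  split_ifs with hω
  · rw [orbInt, orbInt]
    simp only [h _ (hst _ _ hω)]
  · rfl

theorem weightedOrbInt_eq_zero {G Y : Type*} [Group G] [TopologicalSpace G] [MeasurableSpace G]
    (μ : Measure G) (ρ : G →* Equiv.Perm Y) (st : Y → Prop) (κ : Y → ℂ) (f : Y → ℂ)
    (hst : ∀ g y, st y → st (ρ g y)) (h : ∀ y, st y → f y = 0) :
    weightedOrbInt μ ρ st κ f = 0 := by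
  rw [weightedOrbInt]
  refine finsum_eq_zero_of_forall_eq_zero fun ω => ?_
  split_ifs with hω
  · rw [orbInt_eq_zero _ _ _ _ fun g => h _ (hst g _ hω), mul_zero]
  · rfl

theorem finsum_eq_finsum_mem {ι : Type*} (f : ι → ℂ) (s : Set ι) (h : ∀ i, i ∉ s → f i = 0) :
    ∑ᶠ i, f i = ∑ᶠ i ∈ s, f i := by
  classical
  refine finsum_congr fun i => ?_
  rw [finsum_eq_if]
  split_ifs with hi
  · rfl
  · exact h i hi

variable {G : Type*} [Group G] [TopologicalSpace G] [IsTopologicalGroup G]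
  [LocallyCompactSpace G] [SecondCountableTopology G] [T2Space G] [MeasurableSpace G]
  [BorelSpace G] {Y : Type*}
  {G' H Y' : Type*}
  [Group G'] [TopologicalSpace G'] [IsTopologicalGroup G']
  [LocallyCompactSpace G'] [SecondCountableTopology G'] [T2Space G'] [MeasurableSpace G']
  [BorelSpace G']
  [Group H] [TopologicalSpace H] [IsTopologicalGroup H]
  [LocallyCompactSpace H] [SecondCountableTopology H] [T2Space H] [MeasurableSpace H]
  [BorelSpace H]

/-- The situation of a map `r : Y' → Y`, equivariant for `G' = G × H → G`, whose fibres in the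
invariant subset `S` are torsors under `H`. -/
structure IsTorsorMap (e : G' ≃ₜ* G × H) (ρ : G →* Equiv.Perm Y) (ρ' : G' →* Equiv.Perm Y')
    (r : Y' → Y) (S : Set Y') : Prop where
  smul_mem : ∀ g X, X ∈ S → ρ' g X ∈ S
  map_smul : ∀ g X, r (ρ' g X) = ρ (e g).1 (r X)
  exists_smul : ∀ X ∈ S, ∀ X' ∈ S, r X = r X' → ∃ h, ρ' (e.symm (1, h)) X = X'
  stabilizer : ∀ X ∈ S, ∃ θ : stab ρ (r X) → H, Continuous θ ∧
    ∀ g h, ρ' (e.symm (g, h)) X = X ↔ ∃ hg : g ∈ stab ρ (r X), h = θ ⟨g, hg⟩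

variable {e : G' ≃ₜ* G × H} {ρ : G →* Equiv.Perm Y} {ρ' : G' →* Equiv.Perm Y'} {r : Y' → Y}
  {S : Set Y'}

theorem IsTorsorMap.exists_stab_equiv (h : IsTorsorMap e ρ ρ' r S) {X : Y'} (hX : X ∈ S) {y : Y}
    {g₀ : G} (hy : ρ g₀ (r X) = y) :
    ∃ E : stab ρ' X ≃ₜ* stab ρ y, ∀ t, (E t : G) = g₀ * (e t).1 * g₀⁻¹ := by
  obtain ⟨θ, hθ, hst⟩ := h.stabilizer X hX
  have hy' : ρ g₀⁻¹ y = r X := by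
    rw [← hy, ← Equiv.Perm.mul_apply, ← map_mul, inv_mul_cancel, map_one]; rfl
  have h1 : ∀ t : stab ρ' X, g₀ * (e t).1 * g₀⁻¹ ∈ stab ρ y := fun t => by
    have h2 : ρ' t X = X := t.2
    rw [mem_stab, map_mul, map_mul, Equiv.Perm.mul_apply, Equiv.Perm.mul_apply, hy',
      ← h.map_smul, h2, hy]
  have h2 : ∀ t : stab ρ y, g₀⁻¹ * t * g₀ ∈ stab ρ (r X) := fun t => by
    have h2 : ρ t y = y := t.2
    rw [mem_stab, map_mul, map_mul, Equiv.Perm.mul_apply, Equiv.Perm.mul_apply, hy, h2, hy']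
  refine ⟨{ toFun := fun t => ⟨_, h1 t⟩
            invFun := fun t => ⟨e.symm (g₀⁻¹ * t * g₀, θ ⟨_, h2 t⟩), (hst _ _).2 ⟨h2 t, rfl⟩⟩
            left_inv := fun t => ?_
            right_inv := fun t => ?_
            map_mul' := fun t t' => ?_
            continuous_toFun := ?_
            continuous_invFun := ?_ }, fun t => rfl⟩
  · apply Subtype.ext
    apply e.injective
    have h3 : ρ' (e.symm ((e t).1, (e t).2)) X = X := by
      rw [Prod.mk.eta, e.symm_apply_apply]; exact t.2
    obtain ⟨hg, h4⟩ := (hst _ _).1 h3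
    simp only [ContinuousMulEquiv.apply_symm_apply]
    refine Prod.ext (by simp [mul_assoc]) ?_
    rw [h4]
    simp [mul_assoc]
  · apply Subtype.ext
    simp [mul_assoc]
  · apply Subtype.ext
    simp [mul_assoc]
  · exact ((continuous_const.mul (continuous_fst.comp
      (e.continuous.comp continuous_subtype_val))).mul continuous_const).subtype_mk _
  · refine (e.symm.continuous.comp (Continuous.prodMk ?_ (hθ.comp ?_))).subtype_mk _
    · exact (continuous_const.mul continuous_subtype_val).mul continuous_const
    · exact ((continuous_const.mul continuous_subtype_val).mul continuous_const).subtype_mk _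

theorem IsTorsorMap.weightedOrbInt_eq (h : IsTorsorMap e ρ ρ' r S)
    (μ : Measure G) [μ.IsHaarMeasure] [μ.IsMulRightInvariant]
    (μH : Measure H) [μH.IsHaarMeasure] [μH.IsMulRightInvariant] (μ' : Measure G')
    (he : μ'.map e = μ.prod μH)
    {K : Subgroup G} (hK : IsOpen (K : Set G)) (hKc : IsCompact (K : Set G))
    (hT : ∀ y, IsClosed (stab ρ y : Set G))
    (f : Y → ℂ) (f' : Y' → ℂ) (F' : Y' → ENNReal) (hf' : ∀ X, f' X = ((F' X).toReal : ℂ))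
    (hF' : ∀ X, F' X ≠ ⊤) (hFm' : ∀ X, Measurable fun g => F' (ρ' g X))
    (hfin : ∀ X ∈ S, ∫⁻ h, F' (ρ' (e.symm (1, h)) X) ∂μH ≠ ⊤)
    (hf : ∀ X ∈ S, f (r X) = ((∫⁻ h, F' (ρ' (e.symm (1, h)) X) ∂μH).toReal : ℂ))
    (hf0 : ∀ y, (¬ ∃ X ∈ S, r X = y) → f y = 0)
    (st : Y → Prop) (st' : Y' → Prop) (κ : Y → ℂ) (κ' : Y' → ℂ)
    (hst : ∀ g y, st y → st (ρ g y)) (hst' : ∀ X, st' X ↔ X ∈ S ∧ st (r X))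
    (hκ : ∀ g y, κ (ρ g y) = κ y) (hκ' : ∀ X, κ' X = κ (r X)) :
    weightedOrbInt μ' ρ' st' κ' f' = weightedOrbInt μ ρ st κ f := by
  classical
  have hinv : ∀ g y, ρ g⁻¹ (ρ g y) = y := fun g y => by
    rw [← Equiv.Perm.mul_apply, ← map_mul, inv_mul_cancel, map_one]; rfl
  have hstS : ∀ g X, X ∈ S → ∃ X' ∈ S, r X' = ρ g (r X) := fun g X hX =>
    ⟨ρ' (e.symm (g, 1)) X, h.smul_mem _ _ hX, by rw [h.map_smul]; simp⟩
  let I : Y' → ENNReal := fun X => ∫⁻ h, F' (ρ' (e.symm (1, h)) X) ∂μH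
  have hIr : ∀ X ∈ S, ∀ X' ∈ S, r X = r X' → I X = I X' := by
    intro X hX X' hX' hXX'
    obtain ⟨h₀, rfl⟩ := h.exists_smul X hX X' hX' hXX'
    simp only [I]
    rw [← lintegral_mul_right_eq_self _ h₀]
    refine lintegral_congr fun h => ?_
    rw [← Equiv.Perm.mul_apply, ← map_mul, ← map_mul, Prod.mk_mul_mk, one_mul]
  let F : Y → ENNReal := fun y => if hy : ∃ X ∈ S, r X = y then I hy.choose else 0
  have hFI : ∀ X ∈ S, F (r X) = I X := fun X hX => by
    have hy : ∃ X' ∈ S, r X' = r X := ⟨X, hX, rfl⟩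
    simp only [F]
    rw [dif_pos hy]
    exact hIr _ hy.choose_spec.1 _ hX hy.choose_spec.2
  have hFg : ∀ X ∈ S, ∀ g, F (ρ g (r X)) = ∫⁻ h, F' (ρ' (e.symm (g, h)) X) ∂μH := by
    intro X hX g
    have h1 : ρ g (r X) = r (ρ' (e.symm (g, 1)) X) := by rw [h.map_smul]; simp
    rw [h1, hFI _ (h.smul_mem _ _ hX)]
    refine lintegral_congr fun h => ?_
    rw [← Equiv.Perm.mul_apply, ← map_mul, ← map_mul, Prod.mk_mul_mk, one_mul, mul_one]
  have horb : ∀ X ∈ S, ∀ g₀ y, ρ g₀ (r X) = y → orbInt μ' ρ' f' X = orbInt μ ρ f y := by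
    intro X hX g₀ y hy
    obtain ⟨E, hE⟩ := h.exists_stab_equiv hX hy
    have hy' : ∀ g, ρ g y = ρ (g * g₀) (r X) := fun g => by
      rw [map_mul, Equiv.Perm.mul_apply, hy]
    refine orbInt_transfer μ μH μ' e he ρ ρ' y X g₀ E hE hK hKc (hT y) f F ?_ ?_ ?_ f' F' hf' hF'
      (hFm' X) ?_
    · intro g
      obtain ⟨X', hX', e1⟩ := hstS (g * g₀) X hX
      rw [hy', ← e1, hf X' hX', hFI X' hX']
    · intro g
      obtain ⟨X', hX', e1⟩ := hstS (g * g₀) X hX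
      rw [hy', ← e1, hFI X' hX']
      exact hfin X' hX'
    · simp only [hy', hFg X hX]
      have hm : Measurable fun p : G × H => F' (ρ' (e.symm (p.1 * g₀, p.2)) X) :=
        (hFm' X).comp (e.symm.continuous.measurable.comp
          ((measurable_fst.mul_const _).prodMk measurable_snd))
      exact hm.lintegral_prod_right'
    · intro g
      rw [hy', inv_mul_cancel_right, hFg X hX]
  rw [weightedOrbInt, weightedOrbInt]
  rw [finsum_eq_finsum_mem (ι := Quotient (orbitSetoid ρ')) _ {ω | ω.out ∈ S ∧ st (r ω.out)},
    finsum_eq_finsum_mem (ι := Quotient (orbitSetoid ρ)) _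
      {ω | st ω.out ∧ ∃ X ∈ S, r X = ω.out}]
  rotate_left
  · intro ω hω
    split_ifs with h1
    · rw [orbInt_eq_zero, mul_zero]
      intro g
      refine hf0 _ ?_
      rintro ⟨X, hX, e1⟩
      obtain ⟨X', hX', e2⟩ := hstS g⁻¹ X hX
      rw [e1, hinv] at e2
      exact hω ⟨h1, X', hX', e2⟩
    · rfl
  · intro ω hω
    exact if_neg fun h1 => hω ((hst' _).1 h1)
  refine finsum_mem_eq_of_bijOn (fun ω => Quotient.mk (orbitSetoid ρ) (r ω.out)) ⟨?_, ?_, ?_⟩ ?_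
  · rintro ω ⟨hS, hs⟩
    obtain ⟨g, hg⟩ := exists_out_eq (ρ := ρ) (r ω.out)
    obtain ⟨X', hX', e1⟩ := hstS g _ hS
    exact ⟨hg ▸ hst g _ hs, X', hX', e1.trans hg⟩
  · rintro ω ⟨hS, hs⟩ ω' ⟨hS', hs'⟩ heq
    obtain ⟨g, hg⟩ := orbit_mk_eq.1 heq
    have h1 : r (ρ' (e.symm (g, 1)) ω'.out) = r ω.out := by
      rw [h.map_smul]; simpa using hg
    obtain ⟨h₀, e1⟩ := h.exists_smul _ (h.smul_mem _ _ hS') _ hS h1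
    rw [← Equiv.Perm.mul_apply, ← map_mul] at e1
    rw [← Quotient.out_eq ω, ← Quotient.out_eq ω']
    exact orbit_mk_eq.2 ⟨_, e1⟩
  · rintro ω ⟨hs, X, hX, e1⟩
    obtain ⟨g, hg⟩ := exists_out_eq (ρ := ρ') X
    have h1 : r (Quotient.mk (orbitSetoid ρ') X).out = ρ (e g).1 ω.out := by
      rw [← hg, h.map_smul, e1]
    refine ⟨Quotient.mk (orbitSetoid ρ') X, ⟨?_, ?_⟩, ?_⟩
    · rw [← hg]; exact h.smul_mem _ _ hX
    · rw [h1]; exact hst _ _ hs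
    · change Quotient.mk (orbitSetoid ρ) (r (Quotient.mk (orbitSetoid ρ') X).out) = ω
      rw [h1, ← Quotient.out_eq ω]
      refine orbit_mk_eq.2 ⟨(e g).1, ?_⟩
      rw [Quotient.out_eq]
  · rintro ω ⟨hS, hs⟩
    obtain ⟨g, hg⟩ := exists_out_eq (ρ := ρ) (r ω.out)
    rw [if_pos ((hst' _).2 ⟨hS, hs⟩), if_pos (hg ▸ hst g _ hs), horb _ hS g _ hg, hκ', ← hg, hκ]

end WeightedTransfer


section TorsorInstances

/-! ### The contraction as a torsor map -/

theorem contraction_one_val {R : Type*} [CommRing R] {s : R →+* R} (hs : ∀ x, s (s x) = x) {n : ℕ}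
    (X : Matrix (Fin n) (Fin n) R) :
    (contraction hs (HermForm.one s n) X).1 = X * conjT s X := by
  change X * (((1 : GL (Fin n) R)⁻¹).val * conjT s X) = _
  simp

variable {K : Type*} [Field K] [ValuativeRel K] [TopologicalSpace K] [IsNonarchimedeanLocalField K]
  {s : K →+* K}

theorem isTorsorMap_contraction (hs : ∀ x, s (s x) = x) (n : ℕ) :
    IsTorsorMap (ContinuousMulEquiv.refl (unitary (n := n) s (1 : Matrix (Fin n) (Fin n) K) ×
        unitary (n := n) s (1 : Matrix (Fin n) (Fin n) K)))
      (hermAction s n) (homAction s 1) (contraction hs (HermForm.one s n)) {X | X.det ≠ 0} := by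
  have hval : ∀ (g : unitary (n := n) s (1 : Matrix (Fin n) (Fin n) K) ×
      unitary (n := n) s (1 : Matrix (Fin n) (Fin n) K)) X,
      homAction s 1 g X = g.1.1.val * X * (g.2.1⁻¹).val := fun g X => rfl
  have hmap : ∀ g X, contraction hs (HermForm.one s n) (homAction s 1 g X) =
      hermAction s n g.1 (contraction hs (HermForm.one s n) X) := by
    intro g X
    apply Subtype.ext
    change _ = g.1.1.val * (contraction hs (HermForm.one s n) X).1 * (g.1.1⁻¹).val
    rw [contraction_one_val, contraction_one_val, hval, conjT_mul, conjT_mul, unitary_inv' g.2,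
      unitary_inv g.1]
    calc _ = g.1.1.val * X * ((g.2.1⁻¹).val * g.2.1.val) * (conjT s X * (g.1.1⁻¹).val) := by
          simp only [mul_assoc]
      _ = _ := by rw [Units.inv_mul, mul_one]; simp only [mul_assoc]
  have hconj : ∀ {X X' : GL (Fin n) K}, contraction hs (HermForm.one s n) X.val =
      contraction hs (HermForm.one s n) X'.val → X⁻¹ * X' ∈ unitary s 1 := by
    intro X X' h
    apply inv_mul_mem_unitary
    rw [← contraction_one_val hs, ← contraction_one_val hs, h]
  refine ⟨?_, hmap, ?_, ?_⟩
  · intro g X hX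
    change (homAction s 1 g X).det ≠ 0
    rw [hval, Matrix.det_mul, Matrix.det_mul]
    exact mul_ne_zero (mul_ne_zero (det_ne_zero_GL _) hX) (det_ne_zero_GL _)
  · intro X hX X' hX' h
    lift X to GL (Fin n) K using (Matrix.isUnit_iff_isUnit_det X).2 (Ne.isUnit hX)
    lift X' to GL (Fin n) K using (Matrix.isUnit_iff_isUnit_det X').2 (Ne.isUnit hX')
    refine ⟨⟨X'⁻¹ * X, hconj h.symm⟩, ?_⟩
    change (1 : Matrix (Fin n) (Fin n) K) * X.val * ((X'⁻¹ * X)⁻¹ : GL (Fin n) K).val = X'.val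
    rw [one_mul, ← Units.val_mul]
    congr 1
    group
  · intro X hX
    lift X to GL (Fin n) K using (Matrix.isUnit_iff_isUnit_det X).2 (Ne.isUnit hX)
    have hθ : ∀ t : stab (hermAction s n) (contraction hs (HermForm.one s n) X.val),
        X⁻¹ * t.1.1 * X ∈ unitary s 1 := by
      intro t
      rw [mul_assoc]
      apply hconj
      have h1 := hmap (t.1, 1) X.val
      rw [show hermAction s n t.1 (contraction hs (HermForm.one s n) X.val) =
        contraction hs (HermForm.one s n) X.val from t.2] at h1
      refine h1.symm.trans ?_
      rw [hval]
      congr 1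
      simp
    refine ⟨fun t => ⟨_, hθ t⟩, ?_, ?_⟩
    · exact ((continuous_const.mul (continuous_subtype_val.comp continuous_subtype_val)).mul
        continuous_const).subtype_mk _
    · intro g h
      change g.1.val * X.val * (h.1⁻¹).val = X.val ↔ _
      rw [← Units.val_mul, ← Units.val_mul, Units.val_inj, mul_inv_eq_iff_eq_mul]
      constructor
      · intro e
        have hg : g ∈ stab (hermAction s n) (contraction hs (HermForm.one s n) X.val) := by
          rw [mem_stab, ← hmap (g, h), hval]
          congr 1
          change g.1.val * X.val * (h.1⁻¹).val = X.val
          rw [← Units.val_mul, ← Units.val_mul, Units.val_inj, mul_inv_eq_iff_eq_mul, e]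
        refine ⟨hg, Subtype.ext ?_⟩
        change h.1 = X⁻¹ * g.1 * X
        rw [mul_assoc, e, inv_mul_cancel_left]
      · rintro ⟨hg, rfl⟩
        change g.1 * X = X * (X⁻¹ * g.1 * X)
        group

/-- Rearrangement of the factors of a product. -/
def prodProdProdComm (A B C D : Type*) [Group A] [Group B] [Group C] [Group D]
    [TopologicalSpace A] [TopologicalSpace B] [TopologicalSpace C] [TopologicalSpace D] :
    (A × B) × (C × D) ≃ₜ* (A × C) × (B × D) :=
  { MulEquiv.prodProdProdComm A B C D with
    continuous_toFun := by
      change Continuous fun p : (A × B) × (C × D) => ((p.1.1, p.2.1), (p.1.2, p.2.2))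
      fun_prop
    continuous_invFun := by
      change Continuous fun p : (A × C) × (B × D) => ((p.1.1, p.2.1), (p.1.2, p.2.2))
      fun_prop }

theorem IsTorsorMap.prod {G₁ H₁ G₂ H₂ Y₁ Y₂ Z₁ Z₂ : Type*} [Group G₁] [Group H₁] [Group G₂]
    [Group H₂] [TopologicalSpace G₁] [TopologicalSpace H₁] [TopologicalSpace G₂]
    [TopologicalSpace H₂] {ρ₁ : G₁ →* Equiv.Perm Y₁} {ρ₁' : G₁ × H₁ →* Equiv.Perm Z₁} {r₁ : Z₁ → Y₁}
    {S₁ : Set Z₁} {ρ₂ : G₂ →* Equiv.Perm Y₂} {ρ₂' : G₂ × H₂ →* Equiv.Perm Z₂} {r₂ : Z₂ → Y₂}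
    {S₂ : Set Z₂} (h₁ : IsTorsorMap (ContinuousMulEquiv.refl (G₁ × H₁)) ρ₁ ρ₁' r₁ S₁)
    (h₂ : IsTorsorMap (ContinuousMulEquiv.refl (G₂ × H₂)) ρ₂ ρ₂' r₂ S₂) :
    IsTorsorMap (prodProdProdComm G₁ H₁ G₂ H₂) (prodAction ρ₁ ρ₂) (prodAction ρ₁' ρ₂')
      (Prod.map r₁ r₂) (S₁ ×ˢ S₂) := by
  refine ⟨?_, ?_, ?_, ?_⟩
  · rintro g X ⟨hX₁, hX₂⟩
    exact ⟨h₁.smul_mem _ _ hX₁, h₂.smul_mem _ _ hX₂⟩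
  · intro g X
    exact Prod.ext (h₁.map_smul _ _) (h₂.map_smul _ _)
  · rintro X ⟨hX₁, hX₂⟩ X' ⟨hX₁', hX₂'⟩ h
    obtain ⟨a, ha⟩ := h₁.exists_smul _ hX₁ _ hX₁' (congrArg Prod.fst h)
    obtain ⟨b, hb⟩ := h₂.exists_smul _ hX₂ _ hX₂' (congrArg Prod.snd h)
    exact ⟨(a, b), Prod.ext ha hb⟩
  · rintro X ⟨hX₁, hX₂⟩
    obtain ⟨θ₁, hθ₁, h1⟩ := h₁.stabilizer _ hX₁
    obtain ⟨θ₂, hθ₂, h2⟩ := h₂.stabilizer _ hX₂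
    have m1 : ∀ t : stab (prodAction ρ₁ ρ₂) (Prod.map r₁ r₂ X), t.1.1 ∈ stab ρ₁ (r₁ X.1) :=
      fun t => congrArg Prod.fst (show prodAction ρ₁ ρ₂ t.1 (Prod.map r₁ r₂ X) = _ from t.2)
    have m2 : ∀ t : stab (prodAction ρ₁ ρ₂) (Prod.map r₁ r₂ X), t.1.2 ∈ stab ρ₂ (r₂ X.2) :=
      fun t => congrArg Prod.snd (show prodAction ρ₁ ρ₂ t.1 (Prod.map r₁ r₂ X) = _ from t.2)
    refine ⟨fun t => (θ₁ ⟨_, m1 t⟩, θ₂ ⟨_, m2 t⟩), ?_, ?_⟩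
    · exact (hθ₁.comp ((continuous_fst.comp continuous_subtype_val).subtype_mk _)).prodMk
        (hθ₂.comp ((continuous_snd.comp continuous_subtype_val).subtype_mk _))
    · intro g h
      constructor
      · intro e
        obtain ⟨g1, e1⟩ := (h1 g.1 h.1).1 (congrArg Prod.fst e)
        obtain ⟨g2, e2⟩ := (h2 g.2 h.2).1 (congrArg Prod.snd e)
        exact ⟨Prod.ext g1 g2, Prod.ext e1 e2⟩
      · rintro ⟨hg, rfl⟩
        exact Prod.ext ((h1 g.1 _).2 ⟨_, rfl⟩) ((h2 g.2 _).2 ⟨_, rfl⟩)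

/-! ### Integrals over the fibres -/

variable (s) in
/-- The set of `u ∈ U(V_n)` with `X u⁻¹` integral. -/
def fiberSet {n : ℕ} (X : Matrix (Fin n) (Fin n) K) :
    Set (unitary (n := n) s (1 : Matrix (Fin n) (Fin n) K)) :=
  {u | X * (u.1⁻¹).val ∈ intMat K n n}

theorem isOpen_fiberSet {n : ℕ} (X : Matrix (Fin n) (Fin n) K) : IsOpen (fiberSet s X) :=
  (isOpen_intMat n n).preimage (continuous_const.mul
    (continuous_GL_val.comp (continuous_subtype_val.inv)))

theorem muU_fiberSet_ne_top (hso : ∀ x, ord K (s x) = ord K x) {n : ℕ} (X : GL (Fin n) K) :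
    muU s n (fiberSet s X.val) ≠ ⊤ := by
  haveI := locallyCompactSpace_unitary hso (1 : Matrix (Fin n) (Fin n) K)
  haveI := isHaarMeasure_muU hso n
  obtain ⟨N, hN⟩ : ∃ N : ℕ, ∀ c : K, c ≠ 0 → (N : ℤ) ≤ ord K c →
      c • (X⁻¹).val ∈ intMat K n n := by
    choose N hN using fun p : Fin n × Fin n => exists_mul_integer ((X⁻¹).val p.1 p.2)
    refine ⟨∑ p, N p, fun c hc h i j => hN (i, j) c hc (le_trans ?_ h)⟩
    exact_mod_cast Finset.single_le_sum (f := N) (fun _ _ => Nat.zero_le _) (Finset.mem_univ (i, j))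
  obtain ⟨c, hc⟩ := exists_ord_eq (K := K) N
  have h1 : IsCompact {u : unitary (n := n) s (1 : Matrix (Fin n) (Fin n) K) |
      (c : K) • u.1.val ∈ intMat K n n ∧ (c : K) • (u.1⁻¹).val ∈ intMat K n n} :=
    (isClosed_unitary hso 1).isClosedEmbedding_subtypeVal.isCompact_preimage
      (isCompact_GL_bounded n c.ne_zero)
  refine ((measure_mono ?_).trans_lt h1.measure_lt_top).ne
  intro u hu
  have h2 : (c : K) • (u.1⁻¹).val ∈ intMat K n n := by
    have := intMat_mul (hN c c.ne_zero hc.ge) hu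
    rwa [Matrix.smul_mul, ← mul_assoc, X.inv_mul, one_mul] at this
  refine ⟨?_, h2⟩
  have h3 := conjT_mem_intMat hso h2
  rw [show conjT s ((c : K) • (u.1⁻¹).val) = s c • conjT s (u.1⁻¹).val by
    ext i j; simp [conjT], unitary_inv' u] at h3
  intro i j
  have h4 := h3 i j
  rw [Matrix.smul_apply, smul_eq_mul] at h4 ⊢
  by_cases h5 : u.1.val i j = 0
  · rw [h5, mul_zero]; exact zero_mem _
  · have h6 : s c ≠ 0 := by simp
    rw [mul_mem_integer_iff h5 h6, hso] at h4
    exact (mul_mem_integer_iff h5 c.ne_zero).2 h4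

theorem rPush_oneEnd_eq [CharZero K] (hs : ∀ x, s (s x) = x) (hso : ∀ x, ord K (s x) = ord K x)
    {n : ℕ} (X : GL (Fin n) K) (h : Herm s n) (hX : X.val * conjT s X.val = h.1) :
    rPush s (oneEnd K n) h = ((muU s n (fiberSet s X.val)).toReal : ℂ) := by
  haveI := locallyCompactSpace_unitary hso (1 : Matrix (Fin n) (Fin n) K)
  haveI := isHaarMeasure_muU hso n
  haveI := isInvInvariant_muU hs hso n
  rw [rPush_eq_integral hso _ X h hX, ← integral_inv_eq_self]
  have : ∀ u : unitary (n := n) s (1 : Matrix (Fin n) (Fin n) K),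
      oneEnd K n (X.val * (u⁻¹).1.val) = (fiberSet s X.val).indicator (fun _ => (1 : ℂ)) u :=
    fun u => rfl
  simp_rw [this]
  rw [integral_indicator_const _ (isOpen_fiberSet X.val).measurableSet]
  simp [Measure.real]

end TorsorInstances


section StableConjugacy

variable {F E : Type*} [Field F] [Field E] [Algebra F E] (σ : E ≃ₐ[F] E)

/-! ### Stable conjugacy -/

theorem toBar_injective : Function.Injective (toBar F E) := by
  haveI : Nontrivial (Ebar F E) :=
    (Algebra.TensorProduct.includeRight_injective (R := F) (A := E) (B := AlgebraicClosure F)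
      (FaithfulSMul.algebraMap_injective F E)).nontrivial
  exact (toBar F E).injective

theorem conjT_map_toBar {m n : Type*} (A : Matrix m n E) :
    conjT (sbar σ) (A.map (toBar F E)) = (conjT (sig σ) A).map (toBar F E) := by
  ext i j
  simp [conjT, sbar, toBar]

/-- The element of `GL_n(E ⊗ F̄)` defined by an element of `GL_n(E)`. -/
abbrev glBar {n : ℕ} (g : GL (Fin n) E) : GL (Fin n) (Ebar F E) :=
  Matrix.GeneralLinearGroup.map (toBar F E) g

theorem glBar_val {n : ℕ} (g : GL (Fin n) E) :
    (glBar (F := F) g).val = g.val.map (toBar F E) := rfl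

theorem glBar_inv_val {n : ℕ} (g : GL (Fin n) E) :
    ((glBar (F := F) g)⁻¹).val = (g⁻¹).val.map (toBar F E) := rfl

theorem glBar_mem_unitary {n : ℕ} {g : GL (Fin n) E} (hg : g ∈ unitary (sig σ) 1) :
    glBar (F := F) g ∈ unitary (sbar σ) 1 := by
  rw [mem_unitary_one_iff] at hg ⊢
  rw [glBar_val, conjT_map_toBar, ← Matrix.map_mul, hg, Matrix.map_one _ (map_zero _) (map_one _)]

variable {σ}

theorem StablyConj.det_eq {n : ℕ} {y y' : Herm (sig σ) n} (h : StablyConj σ y y') :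
    y'.1.det = y.1.det := by
  obtain ⟨g, -, e⟩ := h
  have h1 := congrArg Matrix.det e
  rw [Matrix.det_mul, Matrix.det_mul, mul_comm] at h1
  have h2 := ((Matrix.isUnit_iff_isUnit_det g.val).1 g.isUnit).mul_right_cancel h1
  apply toBar_injective (F := F)
  rw [RingHom.map_det, RingHom.map_det]
  exact h2.symm

theorem StablyConj.smul {n : ℕ} {y y' : Herm (sig σ) n} (h : StablyConj σ y y')
    (u : unitary (n := n) (sig σ) 1) : StablyConj σ y (hermAction (sig σ) n u y') := by
  obtain ⟨g, hg, e⟩ := h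
  refine ⟨glBar u.1 * g, mul_mem (glBar_mem_unitary σ u.2) hg, ?_⟩
  change _ = (u.1.val * y'.1 * (u.1⁻¹).val).map (toBar F E) * _
  rw [Units.val_mul, mul_assoc, e, Matrix.map_mul, Matrix.map_mul, ← glBar_val, ← glBar_inv_val]
  calc (glBar u.1).val * (y'.1.map (toBar F E) * g.val)
      = (glBar u.1).val * y'.1.map (toBar F E) *
        (((glBar (F := F) u.1)⁻¹).val * (glBar u.1).val) * g.val := by
        rw [Units.inv_mul, mul_one, mul_assoc]
    _ = _ := by simp only [mul_assoc]

variable (σ) in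
theorem invTrivialAt_smul {n : ℕ} (y y' : Herm (sig σ) n) (p : F[X])
    (u : unitary (n := n) (sig σ) 1) :
    InvTrivialAt σ y (hermAction (sig σ) n u y') p ↔ InvTrivialAt σ y y' p := by
  have key : ∀ (y' : Herm (sig σ) n) (u : unitary (n := n) (sig σ) 1),
      InvTrivialAt σ y y' p → InvTrivialAt σ y (hermAction (sig σ) n u y') p := by
    rintro y' u ⟨g, e, f, hf, h⟩
    refine ⟨u.1 * g, ?_, f, ?_, h⟩
    · change _ = u.1.val * y'.1 * (u.1⁻¹).val * _
      rw [Units.val_mul, mul_assoc, e]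
      calc u.1.val * (y'.1 * g.val) = u.1.val * y'.1 * ((u.1⁻¹).val * u.1.val) * g.val := by
            rw [Units.inv_mul, mul_one, mul_assoc]
        _ = _ := by simp only [mul_assoc]
    · rw [hf, Units.val_mul, conjT_mul]
      calc _ = conjT (sig σ) g.val * (conjT (sig σ) u.1.val * u.1.val) * g.val := by
            rw [mem_unitary_one_iff.1 u.2, mul_one]
        _ = _ := by simp only [mul_assoc]
  refine ⟨fun h => ?_, key y' u⟩
  have := key _ u⁻¹ h
  rwa [← Equiv.Perm.mul_apply, ← map_mul, inv_mul_cancel, map_one] at this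

variable (σ) in
theorem kappa_smul {n b : ℕ} (yb : Herm (sig σ) b) (y y' : Herm (sig σ) n)
    (u : unitary (n := n) (sig σ) 1) :
    kappa σ yb y (hermAction (sig σ) n u y') = kappa σ yb y y' := by
  refine finprod_congr fun p => finprod_congr fun _ => ?_
  rw [invTrivialAt_smul]

theorem relStablyConj_one_iff (hσ : ∀ x : E, sig σ (sig σ x) = x) {n : ℕ}
    {X X' : Matrix (Fin n) (Fin n) E} (hX : X.det ≠ 0) :
    RelStablyConj σ (HermForm.one (sig σ) n) X X' ↔ X'.det ≠ 0 ∧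
      StablyConj σ (contraction hσ (HermForm.one (sig σ) n) X)
        (contraction hσ (HermForm.one (sig σ) n) X') := by
  have h1 : (HermForm.one (sig σ) n).1.val.map (toBar F E) = 1 :=
    Matrix.map_one _ (map_zero _) (map_one _)
  rw [RelStablyConj, h1, StablyConj, contraction_one_val, contraction_one_val, Matrix.map_mul,
    Matrix.map_mul, ← conjT_map_toBar, ← conjT_map_toBar]
  lift X to GL (Fin n) E using (Matrix.isUnit_iff_isUnit_det X).2 (Ne.isUnit hX)
  constructor
  · rintro ⟨g, hg, h, hh, e⟩
    refine ⟨?_, g, hg, ?_⟩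
    · intro h0
      have h2 : IsUnit (X'.map (toBar F E) * h.val).det := by
        rw [← e, ← glBar_val, ← Units.val_mul]
        exact (Matrix.isUnit_iff_isUnit_det _).1 (Units.isUnit _)
      rw [Matrix.det_mul] at h2
      have h3 := isUnit_of_mul_isUnit_left h2
      have h4 : (X'.map (toBar F E)).det = 0 := by
        have := RingHom.map_det (toBar F E) X'
        rw [h0, map_zero] at this
        exact this.symm
      rw [h4, isUnit_zero_iff] at h3
      exact one_ne_zero (toBar_injective (F := F) (by rw [map_one, map_zero, h3]) : (1 : E) = 0)
    · have h5 : conjT (sbar σ) (X.val.map (toBar F E)) * conjT (sbar σ) g.val =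
          conjT (sbar σ) h.val * conjT (sbar σ) (X'.map (toBar F E)) := by
        rw [← conjT_mul, ← conjT_mul, e]
      have hg' := mem_unitary_one_iff.1 hg
      have hh' := mul_conjT_of_mem_unitary hh
      calc g.val * (X.val.map (toBar F E) * conjT (sbar σ) (X.val.map (toBar F E)))
          = (g.val * X.val.map (toBar F E)) *
            (conjT (sbar σ) (X.val.map (toBar F E)) * (conjT (sbar σ) g.val * g.val)) := by
            rw [hg', mul_one]; simp only [mul_assoc]
        _ = X'.map (toBar F E) * h.val * ((conjT (sbar σ) (X.val.map (toBar F E)) *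
            conjT (sbar σ) g.val) * g.val) := by rw [e]; simp only [mul_assoc]
        _ = X'.map (toBar F E) * (h.val * conjT (sbar σ) h.val) *
            (conjT (sbar σ) (X'.map (toBar F E)) * g.val) := by
            rw [h5]; simp only [mul_assoc]
        _ = _ := by rw [hh', mul_one, mul_assoc]
  · rintro ⟨hX', g, hg, e⟩
    lift X' to GL (Fin n) E using (Matrix.isUnit_iff_isUnit_det X').2 (Ne.isUnit hX')
    rw [← glBar_val, ← glBar_val] at e
    have h2 : (g * glBar X).val * conjT (sbar σ) (g * glBar X).val =
        (glBar X').val * conjT (sbar σ) (glBar (F := F) X').val := by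
      rw [Units.val_mul, conjT_mul]
      calc _ = g.val * ((glBar X).val * conjT (sbar σ) (glBar X).val) * conjT (sbar σ) g.val := by
            simp only [mul_assoc]
        _ = (glBar X').val * conjT (sbar σ) (glBar X').val * (g.val * conjT (sbar σ) g.val) := by
            rw [e, mul_assoc]
        _ = _ := by rw [mul_conjT_of_mem_unitary hg, mul_one]
    refine ⟨g, hg, (glBar X')⁻¹ * (g * glBar X), inv_mul_mem_unitary h2.symm, ?_⟩
    rw [← glBar_val, ← glBar_val, ← Units.val_mul, ← Units.val_mul, mul_inv_cancel_left]

end StableConjugacy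

section RelativeOrbitalIntegrals

variable {F E : Type*} [Field F] [ValuativeRel F] [TopologicalSpace F]
  [IsNonarchimedeanLocalField F] [Field E] [ValuativeRel E] [TopologicalSpace E]
  [IsNonarchimedeanLocalField E] [CharZero E] [Algebra F E] {σ : E ≃ₐ[F] E}

/-! ### Reduction of relative orbital integrals -/

theorem map_prodProdProdComm {A B C D : Type*} [Group A] [Group B] [Group C] [Group D]
    [TopologicalSpace A] [TopologicalSpace B] [TopologicalSpace C] [TopologicalSpace D]
    [MeasurableSpace A] [MeasurableSpace B] [MeasurableSpace C] [MeasurableSpace D]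
    (μA : Measure A) (μB : Measure B) (μC : Measure C) (μD : Measure D)
    [SFinite μA] [SFinite μB] [SFinite μC] [SFinite μD] :
    ((μA.prod μB).prod (μC.prod μD)).map (prodProdProdComm A B C D) =
      (μA.prod μC).prod (μB.prod μD) := by
  have hm : Measurable (prodProdProdComm A B C D) :=
    (((measurable_fst.comp measurable_fst).prodMk (measurable_fst.comp measurable_snd)).prodMk
      ((measurable_snd.comp measurable_fst).prodMk (measurable_snd.comp measurable_snd)))
  refine Measure.ext_of_lintegral _ fun f hf => ?_
  have h1 : Measurable fun p : (A × B) × (C × D) => f ((p.1.1, p.2.1), (p.1.2, p.2.2)) :=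
    hf.comp hm
  rw [lintegral_map hf hm]
  change ∫⁻ p, f ((p.1.1, p.2.1), (p.1.2, p.2.2)) ∂((μA.prod μB).prod (μC.prod μD)) = _
  rw [lintegral_prod _ h1.aemeasurable, lintegral_prod _ h1.lintegral_prod_right'.aemeasurable,
    lintegral_prod _ hf.aemeasurable, lintegral_prod _ hf.lintegral_prod_right'.aemeasurable]
  refine lintegral_congr fun x => ?_
  have h2 : ∀ y, ∫⁻ q : C × D, f ((x, q.1), (y, q.2)) ∂(μC.prod μD) =
      ∫⁻ z, ∫⁻ w, f ((x, z), (y, w)) ∂μD ∂μC := fun y =>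
    lintegral_prod _ (hf.comp ((measurable_const.prodMk measurable_fst).prodMk
      (measurable_const.prodMk measurable_snd))).aemeasurable
  have h3 : ∀ z, ∫⁻ q : B × D, f ((x, z), q) ∂(μB.prod μD) =
      ∫⁻ y, ∫⁻ w, f ((x, z), (y, w)) ∂μD ∂μB := fun z =>
    lintegral_prod _ (hf.comp (measurable_const.prodMk measurable_id)).aemeasurable
  simp only [h2, h3]
  refine lintegral_lintegral_swap ?_
  have h4 : Measurable fun p : (B × C) × D => f ((x, p.1.2), (p.1.1, p.2)) :=
    hf.comp ((measurable_const.prodMk (measurable_snd.comp measurable_fst)).prodMk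
      ((measurable_fst.comp measurable_fst).prodMk measurable_snd))
  exact h4.lintegral_prod_right'.aemeasurable

theorem exists_of_rPush_ne_zero {n : ℕ} {f : Matrix (Fin n) (Fin n) E → ℂ} {h : Herm (sig σ) n}
    (h0 : rPush (sig σ) f h ≠ 0) : ∃ X : GL (Fin n) E, X.val * conjT (sig σ) X.val = h.1 := by
  by_contra hX
  exact h0 (by rw [rPush, dif_neg hX])

theorem isClosed_stab_hermAction {n : ℕ} (y : Herm (sig σ) n) :
    IsClosed (stab (hermAction (sig σ) n) y : Set (unitary (n := n) (sig σ) 1)) := by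
  have h1 : (stab (hermAction (sig σ) n) y : Set (unitary (n := n) (sig σ) 1)) =
      {u | u.1.val * y.1 * (u.1⁻¹).val = y.1} := by
    ext u
    exact Subtype.ext_iff
  rw [h1]
  exact isClosed_eq (((continuous_GL_val.comp continuous_subtype_val).mul continuous_const).mul
    (continuous_GL_val.comp continuous_subtype_val.inv)) continuous_const

theorem measurable_oneEnd_homAction {n : ℕ} (X : Matrix (Fin n) (Fin n) E) :
    Measurable fun g : unitary (n := n) (sig σ) (1 : Matrix (Fin n) (Fin n) E) ×
        unitary (n := n) (sig σ) (1 : Matrix (Fin n) (Fin n) E) =>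
      (intMat E n n).indicator (1 : Matrix (Fin n) (Fin n) E → ENNReal)
        (homAction (sig σ) 1 g X) := by
  have h1 : IsOpen ((fun g : unitary (n := n) (sig σ) (1 : Matrix (Fin n) (Fin n) E) ×
      unitary (n := n) (sig σ) (1 : Matrix (Fin n) (Fin n) E) => g.1.1.val * X * (g.2.1⁻¹).val) ⁻¹'
      intMat E n n) :=
    (isOpen_intMat n n).preimage (((continuous_GL_val.comp (continuous_subtype_val.comp
      continuous_fst)).mul continuous_const).mul
      (continuous_GL_val.comp (continuous_subtype_val.comp continuous_snd).inv))
  exact measurable_one.indicator h1.measurableSet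

theorem relKappaOrb_eq (hσ : ∀ x : E, sig σ (sig σ x) = x)
    (hso : ∀ x, ord E (sig σ x) = ord E x) {n b : ℕ} (yb : Herm (sig σ) b)
    {X : Matrix (Fin n) (Fin n) E} (hX : X.det ≠ 0) :
    relKappaOrb σ hσ yb (oneEnd E n) X =
      kappaOrb σ yb (rPush (sig σ) (oneEnd E n))
        (contraction hσ (HermForm.one (sig σ) n) X) := by
  haveI := locallyCompactSpace_unitary hso (1 : Matrix (Fin n) (Fin n) E)
  haveI := isHaarMeasure_muU hso n
  haveI := isMulRightInvariant_muU hσ hso n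
  have hfib : ∀ X : Matrix (Fin n) (Fin n) E, ∫⁻ h, (intMat E n n).indicator 1
      (homAction (sig σ) 1 (1, h) X) ∂(muU (sig σ) n) = muU (sig σ) n (fiberSet (sig σ) X) := by
    intro X
    rw [← lintegral_indicator_one (isOpen_fiberSet X).measurableSet]
    refine lintegral_congr fun u => ?_
    change (intMat E n n).indicator 1 ((1 : Matrix (Fin n) (Fin n) E) * X * _) = _
    rw [one_mul]
    rfl
  refine (isTorsorMap_contraction hσ n).weightedOrbInt_eq (muU (sig σ) n) (muU (sig σ) n) _ ?_
    (isOpen_unitaryK n) (isCompact_unitaryK hso n) isClosed_stab_hermAction _ _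
    ((intMat E n n).indicator 1) ?_ ?_ measurable_oneEnd_homAction ?_ ?_ ?_ _ _ _ _
    (fun g y h => h.smul g) (fun X' => relStablyConj_one_iff hσ hX) (fun g y => kappa_smul σ _ _ _ g)
    (fun _ => rfl)
  · exact Measure.map_id
  · intro X
    rw [oneEnd]
    by_cases h : X ∈ intMat E n n <;> simp [h]
  · intro X
    by_cases h : X ∈ intMat E n n <;> simp [h]
  · intro X hX
    lift X to GL (Fin n) E using (Matrix.isUnit_iff_isUnit_det X).2 (Ne.isUnit hX)
    exact (hfib X.val).trans_ne (muU_fiberSet_ne_top hso X)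
  · intro X hX
    lift X to GL (Fin n) E using (Matrix.isUnit_iff_isUnit_det X).2 (Ne.isUnit hX)
    rw [rPush_oneEnd_eq hσ hso X _ (contraction_one_val hσ X.val).symm]
    congr 2
    exact (hfib X.val).symm
  · intro y hy
    rw [rPush, dif_neg]
    rintro ⟨X, hX⟩
    exact hy ⟨X.val, det_ne_zero_GL X, Subtype.ext ((contraction_one_val hσ X.val).trans hX)⟩

theorem relStableOrb_eq (hσ : ∀ x : E, sig σ (sig σ x) = x)
    (hso : ∀ x, ord E (sig σ x) = ord E x) {a b : ℕ}
    {Xa : Matrix (Fin a) (Fin a) E} {Xb : Matrix (Fin b) (Fin b) E} (hXa : Xa.det ≠ 0)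
    (hXb : Xb.det ≠ 0) :
    relStableOrb σ (HermForm.one (sig σ) a) (HermForm.one (sig σ) b) (muU (sig σ) a)
        (muU (sig σ) b) (oneEnd₂ E a b) (Xa, Xb) =
      stableOrb σ (fun y => rPush (sig σ) (oneEnd E a) y.1 * rPush (sig σ) (oneEnd E b) y.2)
        (contraction hσ (HermForm.one (sig σ) a) Xa,
          contraction hσ (HermForm.one (sig σ) b) Xb) := by
  haveI := locallyCompactSpace_unitary hso (1 : Matrix (Fin a) (Fin a) E)
  haveI := isHaarMeasure_muU hso a
  haveI := isMulRightInvariant_muU hσ hso a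
  haveI := locallyCompactSpace_unitary hso (1 : Matrix (Fin b) (Fin b) E)
  haveI := isHaarMeasure_muU hso b
  haveI := isMulRightInvariant_muU hσ hso b
  let μ := (muU (sig σ) a).prod (muU (sig σ) b)
  haveI : SFinite (muU (sig σ) a) := inferInstance
  haveI : SFinite (muU (sig σ) b) := inferInstance
  haveI hμ : μ.IsHaarMeasure := Measure.prod.instIsHaarMeasure _ _
  haveI hμr : μ.IsMulRightInvariant := Measure.prod.instIsMulRightInvariant
  have hfib : ∀ X : Matrix (Fin a) (Fin a) E × Matrix (Fin b) (Fin b) E,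
      ∫⁻ h, (intMat E a a ×ˢ intMat E b b).indicator 1
        (prodAction (homAction (sig σ) 1) (homAction (sig σ) 1)
          ((prodProdProdComm _ _ _ _).symm (1, h)) X) ∂μ =
      muU (sig σ) a (fiberSet (sig σ) X.1) * muU (sig σ) b (fiberSet (sig σ) X.2) := by
    intro X
    rw [← Measure.prod_prod, ← lintegral_indicator_one
      ((isOpen_fiberSet X.1).prod (isOpen_fiberSet X.2)).measurableSet]
    refine lintegral_congr fun u => ?_
    change (intMat E a a ×ˢ intMat E b b).indicator 1
      (((1 : Matrix (Fin a) (Fin a) E) * X.1 * _, (1 : Matrix (Fin b) (Fin b) E) * X.2 * _)) = _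
    rw [one_mul, one_mul]
    rfl
  refine ((isTorsorMap_contraction hσ a).prod (isTorsorMap_contraction hσ b)).weightedOrbInt_eq
    (S := {X : Matrix (Fin a) (Fin a) E | X.det ≠ 0} ×ˢ {X : Matrix (Fin b) (Fin b) E | X.det ≠ 0})
    μ μ _ ?_ (K := (unitaryK (sig σ) a).prod (unitaryK (sig σ) b))
    ((isOpen_unitaryK a).prod (isOpen_unitaryK b))
    ((isCompact_unitaryK hso a).prod (isCompact_unitaryK hso b)) ?_ _ _
    ((intMat E a a ×ˢ intMat E b b).indicator 1) ?_ ?_ ?_ ?_ ?_ ?_ _ _ _ _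
    (fun g y h => ⟨h.1.smul g.1, h.2.smul g.2⟩) ?_ (fun _ _ => rfl) (fun _ => rfl)
  · exact map_prodProdProdComm (muU (sig σ) a) (muU (sig σ) a) (muU (sig σ) b) (muU (sig σ) b)
  · intro y
    have h1 : (stab (prodAction (hermAction (sig σ) a) (hermAction (sig σ) b)) y : Set
        (unitary (n := a) (sig σ) (1 : Matrix (Fin a) (Fin a) E) ×
          unitary (n := b) (sig σ) (1 : Matrix (Fin b) (Fin b) E))) =
        (stab (hermAction (sig σ) a) y.1 : Set _) ×ˢ (stab (hermAction (sig σ) b) y.2 : Set _) := by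
      ext u
      exact Prod.ext_iff
    rw [h1]
    exact (isClosed_stab_hermAction y.1).prod (isClosed_stab_hermAction y.2)
  · intro X
    rw [oneEnd₂, oneEnd, oneEnd]
    by_cases h : X.1 ∈ intMat E a a <;> by_cases h' : X.2 ∈ intMat E b b <;>
      simp [h, h', Set.mem_prod]
  · intro X
    by_cases h : X ∈ intMat E a a ×ˢ intMat E b b <;> simp [h]
  · intro X
    have h1 : ∀ Y : Matrix (Fin a) (Fin a) E × Matrix (Fin b) (Fin b) E,
        (intMat E a a ×ˢ intMat E b b).indicator
            (1 : Matrix (Fin a) (Fin a) E × Matrix (Fin b) (Fin b) E → ENNReal) Y =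
          (intMat E a a).indicator 1 Y.1 * (intMat E b b).indicator 1 Y.2 := by
      intro Y
      by_cases h : Y.1 ∈ intMat E a a <;> by_cases h' : Y.2 ∈ intMat E b b <;>
        simp [h, h', Set.mem_prod]
    simp only [h1]
    exact ((measurable_oneEnd_homAction X.1).comp measurable_fst).mul
      ((measurable_oneEnd_homAction X.2).comp measurable_snd)
  · rintro ⟨X₁, X₂⟩ ⟨hX₁, hX₂⟩
    lift X₁ to GL (Fin a) E using (Matrix.isUnit_iff_isUnit_det X₁).2 (Ne.isUnit hX₁)
    lift X₂ to GL (Fin b) E using (Matrix.isUnit_iff_isUnit_det X₂).2 (Ne.isUnit hX₂)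
    exact (hfib (X₁.val, X₂.val)).trans_ne
      (ENNReal.mul_ne_top (muU_fiberSet_ne_top hso X₁) (muU_fiberSet_ne_top hso X₂))
  · rintro ⟨X₁, X₂⟩ ⟨hX₁, hX₂⟩
    lift X₁ to GL (Fin a) E using (Matrix.isUnit_iff_isUnit_det X₁).2 (Ne.isUnit hX₁)
    lift X₂ to GL (Fin b) E using (Matrix.isUnit_iff_isUnit_det X₂).2 (Ne.isUnit hX₂)
    have h1 := congrArg (fun x : ENNReal => (x.toReal : ℂ)) (hfib (X₁.val, X₂.val)).symm
    refine Eq.trans ?_ h1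
    simp only [Prod.map]
    rw [rPush_oneEnd_eq hσ hso X₁ _ (contraction_one_val hσ X₁.val).symm,
      rPush_oneEnd_eq hσ hso X₂ _ (contraction_one_val hσ X₂.val).symm, ENNReal.toReal_mul,
      Complex.ofReal_mul]
  · rintro ⟨y₁, y₂⟩ hy
    by_contra h0
    have h1 := left_ne_zero_of_mul h0
    have h2 := right_ne_zero_of_mul h0
    obtain ⟨X₁, e₁⟩ := exists_of_rPush_ne_zero h1
    obtain ⟨X₂, e₂⟩ := exists_of_rPush_ne_zero h2
    exact hy ⟨(X₁.val, X₂.val), ⟨det_ne_zero_GL X₁, det_ne_zero_GL X₂⟩,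
      Prod.ext (Subtype.ext ((contraction_one_val hσ X₁.val).trans e₁))
        (Subtype.ext ((contraction_one_val hσ X₂.val).trans e₂))⟩
  · rintro ⟨X₁, X₂⟩
    have h1 := relStablyConj_one_iff hσ (X' := X₁) hXa
    have h2 := relStablyConj_one_iff hσ (X' := X₂) hXb
    constructor
    · rintro ⟨h, h'⟩
      exact ⟨⟨(h1.1 h).1, (h2.1 h').1⟩, (h1.1 h).2, (h2.1 h').2⟩
    · rintro ⟨⟨h, h'⟩, k, k'⟩
      exact ⟨h1.2 ⟨h, k⟩, h2.2 ⟨h', k'⟩⟩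

end RelativeOrbitalIntegrals


section RegularSemisimple

open Polynomial

/-! ### Regular semisimple elements -/

theorem charpoly_comp {R : Type*} [CommRing R] {n : ℕ} (M : Matrix (Fin n) (Fin n) R) (p : R[X]) :
    M.charpoly.comp p = (Matrix.diagonal (fun _ => p) - M.map C).det := by
  have h := RingHom.map_det (compRingHom p) M.charmatrix
  rw [coe_compRingHom_apply] at h
  rw [Matrix.charpoly, h]
  congr 1
  ext1 i j
  rw [RingHom.mapMatrix_apply, Matrix.map_apply, Matrix.charmatrix_apply]
  simp only [coe_compRingHom_apply, sub_comp, C_comp, Matrix.sub_apply, Matrix.map_apply,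
    Matrix.diagonal_apply]
  split_ifs <;> simp

theorem charpoly_fromBlocks_zero {R : Type*} [CommRing R] [IsDomain R] {n : ℕ}
    (A B : Matrix (Fin n) (Fin n) R) :
    (Matrix.fromBlocks 0 A (-B) 0).charpoly = (-1) ^ n * (A * B).charpoly.comp (-X ^ 2) := by
  let t : Matrix (Fin n) (Fin n) R[X] := Matrix.diagonal fun _ => X
  have h1 : (Matrix.fromBlocks 0 A (-B) 0).charmatrix =
      Matrix.fromBlocks t (-A.map C) (B.map C) t := by
    have h0 : (0 : Matrix (Fin n) (Fin n) R).charmatrix = t := by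
      ext1 i j; rw [Matrix.charmatrix_apply, Matrix.zero_apply, map_zero, sub_zero]
    have hB : -((-B).map C) = B.map C := by
      ext1 i j
      rw [Matrix.neg_apply, Matrix.map_apply, Matrix.map_apply, Matrix.neg_apply, map_neg, neg_neg]
    rw [Matrix.charmatrix_fromBlocks, h0, hB]
  have hcomm : t * B.map C = B.map C * t := by
    ext1 i j
    rw [Matrix.diagonal_mul, Matrix.mul_diagonal, mul_comm]
  have h2 : Matrix.fromBlocks t (-A.map C) (B.map C) t * Matrix.fromBlocks t 0 (-B.map C) 1 =
      Matrix.fromBlocks (t * t + A.map C * B.map C) (-A.map C) 0 t := by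
    rw [Matrix.fromBlocks_multiply]
    congr 1
    · simp
    · simp
    · rw [Matrix.mul_neg, hcomm, add_neg_cancel]
    · simp
  have h3 : t.det ≠ 0 := by
    simp only [t, Matrix.det_diagonal, Finset.prod_const]
    exact pow_ne_zero _ X_ne_zero
  have h4 := congrArg Matrix.det h2
  rw [Matrix.det_mul, Matrix.det_fromBlocks_zero₁₂, Matrix.det_fromBlocks_zero₂₁, Matrix.det_one,
    mul_one] at h4
  rw [Matrix.charpoly, h1, mul_right_cancel₀ h3 h4, charpoly_comp]
  have h5 : Matrix.diagonal (fun _ => -X ^ 2) - (A * B).map C =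
      -(t * t + A.map C * B.map C) := by
    rw [← Matrix.map_mul, Matrix.diagonal_mul_diagonal, neg_add, Matrix.diagonal_neg, sub_eq_add_neg]
    congr 2
    ext1 i
    simp [sq]
  rw [h5, Matrix.det_neg, ← mul_assoc, Fintype.card_fin, ← mul_pow]
  simp

variable {K : Type*} [Field K] [CharZero K] {s : K →+* K} {n : ℕ}

theorem separable_charpoly_fromBlocks_iff (A B : Matrix (Fin n) (Fin n) K) :
    (Matrix.fromBlocks 0 A (-B) 0).charpoly.Separable ↔
      ((A * B).charpoly.comp (-X ^ 2)).Separable := by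
  rw [charpoly_fromBlocks_zero]
  have hu : IsUnit ((-1 : K[X]) ^ n) := (isUnit_one.neg).pow n
  obtain ⟨u, hu⟩ := hu
  rw [← hu]
  constructor
  · exact fun h => h.of_mul_right
  · intro h
    exact h.unit_mul u.isUnit

theorem det_ne_zero_of_isRelRSS (α : HermForm s n) {X : Matrix (Fin n) (Fin n) K}
    (h : IsRelRSS α X) : X.det ≠ 0 := by
  intro h0
  have h1 := ((separable_charpoly_fromBlocks_iff _ _).1 h).squarefree
  have h2 : Polynomial.X ∣ (X * adj α X).charpoly := by
    have h2 := Matrix.det_eq_sign_charpoly_coeff (X * adj α X)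
    rw [Matrix.det_mul, h0, zero_mul, eq_comm, mul_eq_zero] at h2
    exact X_dvd_iff.2 (h2.resolve_left (pow_ne_zero _ (neg_ne_zero.2 one_ne_zero)))
  obtain ⟨q, hq⟩ := h2
  rw [hq, mul_comp, Polynomial.X_comp] at h1
  have h3 := h1 Polynomial.X ⟨-q.comp (-Polynomial.X ^ 2), by ring⟩
  exact not_isUnit_X h3

theorem isRelRSS_of_separable (α : HermForm s n) {X : Matrix (Fin n) (Fin n) K}
    (h : (X * adj α X).charpoly.Separable) (hX : (X * adj α X).det ≠ 0) : IsRelRSS α X := by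
  rw [IsRelRSS, separable_charpoly_fromBlocks_iff]
  set p := (X * adj α X).charpoly with hp
  have h0 : p.coeff 0 ≠ 0 := by
    intro h0
    apply hX
    rw [Matrix.det_eq_sign_charpoly_coeff, ← hp, h0, mul_zero]
  rw [Separable, derivative_comp]
  refine IsCoprime.mul_right ?_ ?_
  · have h1 : derivative (-Polynomial.X ^ 2 : K[X]) = -(2 * Polynomial.X) := by
      rw [derivative_neg, derivative_X_pow]; simp
      exact map_ofNat C 2
    have h2 : p.comp (-Polynomial.X ^ 2) =
        -(p.divX.comp (-Polynomial.X ^ 2) * Polynomial.X ^ 2) + C (p.coeff 0) := by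
      conv_lhs => rw [← p.divX_mul_X_add]
      rw [add_comp, mul_comp, Polynomial.X_comp, C_comp]
      ring
    have h3 : C (p.coeff 0)⁻¹ * C (p.coeff 0) = 1 := by
      rw [← C_mul, inv_mul_cancel₀ h0, C_1]
    have h4 : (C (1 / 2) : K[X]) * 2 = 1 := by
      rw [← C_ofNat, ← C_mul]; simp
    rw [h1, h2]
    refine ⟨C (p.coeff 0)⁻¹, -(C (p.coeff 0)⁻¹ * C (1 / 2) * p.divX.comp (-Polynomial.X ^ 2) *
      Polynomial.X), ?_⟩
    linear_combination h3 + C (p.coeff 0)⁻¹ * p.divX.comp (-Polynomial.X ^ 2) * Polynomial.X ^ 2 * h4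
  · exact IsCoprime.map h (compRingHom (-Polynomial.X ^ 2 : K[X]))

end RegularSemisimple


section TestFunctions

variable {K : Type*} [Field K] [ValuativeRel K] [TopologicalSpace K] [IsNonarchimedeanLocalField K]

theorem isTestFunction_indicator {Y : Type*} [TopologicalSpace Y] [T2Space Y] {S : Set Y}
    (ho : IsOpen S) (hc : IsCompact S) : IsTestFunction (S.indicator (1 : Y → ℂ)) := by
  classical
  constructor
  · refine IsLocallyConstant.iff_exists_open _ |>.2 fun x => ?_
    by_cases hx : x ∈ S
    · exact ⟨S, ho, hx, fun y hy => by simp [hx, hy]⟩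
    · exact ⟨Sᶜ, hc.isClosed.isOpen_compl, hx, fun y hy => by
        rw [Set.indicator_of_notMem hx, Set.indicator_of_notMem hy]⟩
  · exact HasCompactSupport.intro hc fun x hx => Set.indicator_of_notMem hx _

theorem isTestFunction_oneEnd (n : ℕ) : IsTestFunction (oneEnd K n) :=
  isTestFunction_indicator (isOpen_intMat n n) (isCompact_intMat n n)

theorem isTestFunction_oneEnd₂ (a b : ℕ) : IsTestFunction (oneEnd₂ K a b) := by
  have h : oneEnd₂ K a b = (intMat K a a ×ˢ intMat K b b).indicator 1 := by
    funext X
    rw [oneEnd₂, oneEnd, oneEnd]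
    by_cases h : X.1 ∈ intMat K a a <;> by_cases h' : X.2 ∈ intMat K b b <;>
      simp [h, h', Set.mem_prod]
  rw [h]
  exact isTestFunction_indicator ((isOpen_intMat a a).prod (isOpen_intMat b b))
    ((isCompact_intMat a a).prod (isCompact_intMat b b))

theorem continuous_of_mul_left_invariant {G β : Type*} [Group G] [TopologicalSpace G]
    [IsTopologicalGroup G] [TopologicalSpace β] {H : Subgroup G} (hH : IsOpen (H : Set G))
    {φ : G → β} (hφ : ∀ k ∈ H, ∀ g, φ (k * g) = φ g) : Continuous φ := by
  refine IsLocallyConstant.continuous (IsLocallyConstant.iff_exists_open _ |>.2 fun x => ?_)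
  refine ⟨(fun g => g * x⁻¹) ⁻¹' (H : Set G), hH.preimage (continuous_id.mul continuous_const),
    by simp, fun y hy => ?_⟩
  have := hφ _ hy x
  rwa [inv_mul_cancel_right] at this

variable {s : K →+* K}

theorem integrable_convOne_oneD {n : ℕ} (d : ℕ) (y : Herm s n) :
    Integrable (fun g => oneD K n d g⁻¹ * oneZero s n (g.val * y.1 * conjT s g.val))
      (muGL K n) := by
  refine Continuous.integrable_of_hasCompactSupport ?_ ?_
  · refine continuous_of_mul_left_invariant (isOpen_maxK n) fun k hk g => ?_
    rw [mul_inv_rev, Units.val_mul, conjT_mul]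
    congr 1
    · simpa using oneD_mul_maxK n d g⁻¹ (one_mem _) (inv_mem hk)
    · rw [← oneZero_mul_mul (g.val * y.1 * conjT s g.val) hk]
      simp only [mul_assoc]
  · have h1 : HasCompactSupport fun g : GL (Fin n) K => oneD K n d g⁻¹ :=
      (hasCompactSupport_oneD n d).comp_homeomorph (Homeomorph.inv (GL (Fin n) K))
    exact h1.mul_right

theorem convOne₂_xi_oneD {a b : ℕ} (d : ℕ) (y : Herm s a × Herm s b) :
    convOne₂ s (xi (a := a) (b := b) (oneD K (a + b) d)) y =
      ∑ p ∈ Finset.HasAntidiagonal.antidiagonal d,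
        convOne s (oneD K a p.1) y.1 * convOne s (oneD K b p.2) y.2 := by
  rw [convOne₂]
  simp only [xi_oneD, Finset.sum_mul]
  rw [integral_finsetSum]
  · refine Finset.sum_congr rfl fun p _ => ?_
    rw [convOne, convOne, ← integral_prod_mul]
    congr 1
    funext g
    simp only [Prod.fst_inv, Prod.snd_inv]
    ring
  · intro p _
    have := (integrable_convOne_oneD p.1 y.1).mul_prod (integrable_convOne_oneD p.2 y.2)
    refine this.congr (Filter.Eventually.of_forall fun g => ?_)
    simp only [Prod.fst_inv, Prod.snd_inv]
    ring

theorem convOne₂_xi_oneD_eq (hso : ∀ x, ord K (s x) = ord K x) {a b : ℕ} (d : ℕ)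
    (y : Herm s a × Herm s b) (hd : ord K y.1.1.det + ord K y.2.1.det = 2 * d) :
    convOne₂ s (xi (a := a) (b := b) (oneD K (a + b) d)) y =
      rPush s (oneEnd K a) y.1 * rPush s (oneEnd K b) y.2 := by
  rw [convOne₂_xi_oneD]
  by_cases h : ∃ i j : ℕ, ord K y.1.1.det = 2 * i ∧ ord K y.2.1.det = 2 * j
  · obtain ⟨i, j, hi, hj⟩ := h
    rw [Finset.sum_eq_single_of_mem (i, j), convOne_oneD hso i _ hi, convOne_oneD hso j _ hj]
    · rw [Finset.HasAntidiagonal.mem_antidiagonal]; omega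
    · rintro ⟨i', j'⟩ - hne
      by_cases h1 : ord K y.1.1.det = 2 * i'
      · rw [convOne_oneD_eq_zero hso j', mul_zero]
        intro h2
        apply hne
        ext <;> simp only <;> omega
      · rw [convOne_oneD_eq_zero hso i' _ h1, zero_mul]
  · have h0 : rPush s (oneEnd K a) y.1 * rPush s (oneEnd K b) y.2 = 0 := by
      by_contra h0
      have h1 := mt (rPush_oneEnd_eq_zero hso y.1) (left_ne_zero_of_mul h0)
      have h2 := mt (rPush_oneEnd_eq_zero hso y.2) (right_ne_zero_of_mul h0)
      push Not at h1 h2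
      obtain ⟨i, hi⟩ := Int.not_odd_iff_even.1 h1.2
      obtain ⟨j, hj⟩ := Int.not_odd_iff_even.1 h2.2
      exact h ⟨i.toNat, j.toNat, by omega, by omega⟩
    rw [h0]
    refine Finset.sum_eq_zero fun p _ => ?_
    by_cases h1 : ord K y.1.1.det = 2 * p.1
    · rw [convOne_oneD_eq_zero hso p.2, mul_zero]
      exact fun h2 => h ⟨_, _, h1, h2⟩
    · rw [convOne_oneD_eq_zero hso p.1 _ h1, zero_mul]

end TestFunctions

section FundamentalLemma

variable {F E : Type*} [Field F] [ValuativeRel F] [TopologicalSpace F]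
  [IsNonarchimedeanLocalField F] [Field E] [ValuativeRel E] [TopologicalSpace E]
  [IsNonarchimedeanLocalField E] [CharZero E] [Algebra F E] {σ : E ≃ₐ[F] E}

/-! ### The relative fundamental lemma -/

theorem hermDiag_det {a b : ℕ} (ya : Herm (sig σ) a) (yb : Herm (sig σ) b) :
    (hermDiag ya yb).1.det = ya.1.det * yb.1.det := det_blk _ _ _

theorem Match.det_eq {a b : ℕ} {y : Herm (sig σ) (a + b)} {ya : Herm (sig σ) a}
    {yb : Herm (sig σ) b} (h : Match y ya yb) : y.1.det = ya.1.det * yb.1.det := by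
  obtain ⟨g, hg⟩ := h
  have h1 := congrArg Matrix.det hg
  rw [Matrix.det_mul, Matrix.det_mul, hermDiag_det, mul_comm] at h1
  exact mul_right_cancel₀ (det_ne_zero_GL g) h1

theorem Match.charpoly_eq {a b : ℕ} {y : Herm (sig σ) (a + b)} {ya : Herm (sig σ) a}
    {yb : Herm (sig σ) b} (h : Match y ya yb) : y.1.charpoly = (hermDiag ya yb).1.charpoly := by
  obtain ⟨g, hg⟩ := h
  have h1 : y.1 = (g⁻¹).val * (hermDiag ya yb).1 * g.val := by
    rw [mul_assoc, ← hg, ← mul_assoc, g.inv_mul, one_mul]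
  rw [h1, Matrix.coe_units_inv]
  exact Matrix.charpoly_units_conj' g (hermDiag ya yb).1

theorem contraction_det_ne_zero (hσ : ∀ x : E, sig σ (sig σ x) = x) {n : ℕ}
    (α : HermForm (sig σ) n) {X : Matrix (Fin n) (Fin n) E} (hX : X.det ≠ 0) :
    (contraction hσ α X).1.det ≠ 0 := by
  change (X * ((α.1⁻¹).val * conjT (sig σ) X)).det ≠ 0
  rw [Matrix.det_mul, Matrix.det_mul, det_conjT]
  exact mul_ne_zero hX (mul_ne_zero (det_ne_zero_GL _) (fun h => hX (by simpa using h)))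

theorem ord_contraction_det (hσ : ∀ x : E, sig σ (sig σ x) = x)
    (hso : ∀ x, ord E (sig σ x) = ord E x) {n : ℕ}
    (α : HermForm (sig σ) n) {X : Matrix (Fin n) (Fin n) E} (hX : X.det ≠ 0) :
    ord E (contraction hσ α X).1.det = 2 * ord E X.det - ord E α.1.val.det := by
  change ord E (X * ((α.1⁻¹).val * conjT (sig σ) X)).det = _
  have h1 : sig σ X.det ≠ 0 := fun h => hX (by simpa using h)
  rw [Matrix.det_mul, Matrix.det_mul, det_conjT, ord_mul hX (mul_ne_zero (det_ne_zero_GL _) h1),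
    ord_mul (det_ne_zero_GL _) h1, hso, ord_det_inv_GL]
  ring

/-- The key identity: the stable orbital integrals of `r_!(𝟏) ⊗ r_!(𝟏)` are the endoscopic orbital
integrals of `r_!(𝟏)`. -/
theorem stableOrb_rPush {a b : ℕ} (hso : ∀ x, ord E (sig σ x) = ord E x)
    (hA : EndoscopicBaseChange σ a b) {y : Herm (sig σ) (a + b)} {ya : Herm (sig σ) a}
    {yb : Herm (sig σ) b} (hy : IsRSS (hermDiag ya yb).1) (hm : Match y ya yb)
    (ha : ya.1.det ≠ 0) (hb : yb.1.det ≠ 0) :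
    stableOrb σ (fun y => rPush (sig σ) (oneEnd E a) y.1 * rPush (sig σ) (oneEnd E b) y.2)
        (ya, yb) =
      transferFactor σ ya yb y * kappaOrb σ yb (rPush (sig σ) (oneEnd E (a + b))) y := by
  have hdet : ord E y.1.det = ord E ya.1.det + ord E yb.1.det := by
    rw [hm.det_eq, ord_mul ha hb]
  have hst : ∀ (g : unitary (n := a) (sig σ) (1 : Matrix (Fin a) (Fin a) E) ×
      unitary (n := b) (sig σ) (1 : Matrix (Fin b) (Fin b) E)) (y' : Herm (sig σ) a × Herm (sig σ) b),
      StablyConj σ ya y'.1 ∧ StablyConj σ yb y'.2 →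
      StablyConj σ ya (prodAction (hermAction (sig σ) a) (hermAction (sig σ) b) g y').1 ∧
        StablyConj σ yb (prodAction (hermAction (sig σ) a) (hermAction (sig σ) b) g y').2 :=
    fun g y' h => ⟨h.1.smul g.1, h.2.smul g.2⟩
  by_cases hd : ∃ d : ℕ, ord E y.1.det = 2 * d
  · obtain ⟨d, hd⟩ := hd
    have h1 := (hA (oneD E (a + b) d) (isSpherical_oneD _ _)).1 y ya yb
      (by rw [IsRSS, hm.charpoly_eq]; exact hy) hy hm
    have h2 : stableOrb σ (fun y => rPush (sig σ) (oneEnd E a) y.1 *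
        rPush (sig σ) (oneEnd E b) y.2) (ya, yb) =
        stableOrb σ (convOne₂ (sig σ) (xi (oneD E (a + b) d))) (ya, yb) := by
      refine weightedOrbInt_congr _ _ _ _ _ _ hst fun y' h' => ?_
      rw [convOne₂_xi_oneD_eq hso]
      rw [h'.1.det_eq, h'.2.det_eq, ← hdet, hd]
    have h3 : kappaOrb σ yb (rPush (sig σ) (oneEnd E (a + b))) y =
        kappaOrb σ yb (convOne (sig σ) (oneD E (a + b) d)) y := by
      refine weightedOrbInt_congr _ _ _ _ _ _ (fun g y' h => h.smul g) fun y' h' => ?_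
      rw [convOne_oneD hso d]
      rw [h'.det_eq, hd]
    rw [h2, h3, h1]
  · have hno : ∀ z : ℤ, z = ord E y.1.det → z < 0 ∨ Odd z := by
      rintro z rfl
      by_contra! hcon
      obtain ⟨c, hc⟩ := Int.not_odd_iff_even.1 hcon.2
      exact hd ⟨c.toNat, by omega⟩
    have h2 : stableOrb σ (fun y => rPush (sig σ) (oneEnd E a) y.1 *
        rPush (sig σ) (oneEnd E b) y.2) (ya, yb) = 0 := by
      refine weightedOrbInt_eq_zero _ _ _ _ _ hst fun y' h' => ?_
      by_contra h0
      have h1 := mt (rPush_oneEnd_eq_zero hso y'.1) (left_ne_zero_of_mul h0)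
      have h2 := mt (rPush_oneEnd_eq_zero hso y'.2) (right_ne_zero_of_mul h0)
      rw [h'.1.det_eq] at h1
      rw [h'.2.det_eq] at h2
      push Not at h1 h2
      dsimp only at h1 h2
      rcases hno _ hdet.symm with h3 | h3
      · omega
      · exact Int.not_odd_iff_even.2 ((Int.not_odd_iff_even.1 h1.2).add
          (Int.not_odd_iff_even.1 h2.2)) h3
    have h3 : kappaOrb σ yb (rPush (sig σ) (oneEnd E (a + b))) y = 0 := by
      refine weightedOrbInt_eq_zero _ _ _ _ _ (fun g y' h => h.smul g) fun y' h' => ?_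
      exact rPush_oneEnd_eq_zero hso y' (hno _ (by rw [h'.det_eq]))
    rw [h2, h3, mul_zero]

theorem relativeFundamentalLemma_of_endoscopicBaseChange
    (hσ : ∀ x : E, sig σ (sig σ x) = x) (hso : ∀ x, ord E (sig σ x) = ord E x)
    (hodd : ∀ {n : ℕ} (α : HermForm (sig σ) n), ¬ α.IsSplit → Odd (ord E α.1.val.det))
    {a b : ℕ} (hA : EndoscopicBaseChange σ a b) : RelativeFundamentalLemma σ hσ a b := by
  refine ⟨isTestFunction_oneEnd _, isTestFunction_oneEnd₂ _ _, ⟨?_, ?_⟩, ?_⟩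
  · intro X Xa Xb hX hXab hm
    have dX := det_ne_zero_of_isRelRSS _ hX
    have da := det_ne_zero_of_isRelRSS _ hXab.1
    have db := det_ne_zero_of_isRelRSS _ hXab.2.1
    rw [relStableOrb_eq hσ hso da db, relKappaOrb_eq hσ hso _ dX]
    exact stableOrb_rPush hso hA hXab.2.2 hm (contraction_det_ne_zero hσ _ da)
      (contraction_det_ne_zero hσ _ db)
  · intro Xa Xb hXab hno
    exfalso
    have da := det_ne_zero_of_isRelRSS _ hXab.1
    have db := det_ne_zero_of_isRelRSS _ hXab.2.1
    have h1 : contraction hσ (HermForm.one (sig σ) (a + b)) (blk Xa 0 0 Xb) =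
        hermDiag (contraction hσ (HermForm.one (sig σ) a) Xa)
          (contraction hσ (HermForm.one (sig σ) b) Xb) := by
      apply Subtype.ext
      rw [contraction_one_val]
      change _ = blk (contraction hσ (HermForm.one (sig σ) a) Xa).1 0 0
        (contraction hσ (HermForm.one (sig σ) b) Xb).1
      rw [contraction_one_val, contraction_one_val, conjT_blk, blk_mul]
      simp
    refine hno ⟨blk Xa 0 0 Xb, ?_, 1, ?_⟩
    · refine isRelRSS_of_separable _ ?_ ?_
      · change (contraction hσ (HermForm.one (sig σ) (a + b)) (blk Xa 0 0 Xb)).1.charpoly.Separable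
        rw [h1]
        exact hXab.2.2
      · refine contraction_det_ne_zero hσ (HermForm.one (sig σ) (a + b)) ?_
        rw [det_blk]
        exact mul_ne_zero da db
    · rw [h1]; simp
  · intro α β hαβ μα μβ _ _
    have h0 : ∀ X, relStableOrb σ α β μα μβ 0 X = 0 := by
      intro X
      rw [relStableOrb, weightedOrbInt]
      refine finsum_eq_zero_of_forall_eq_zero fun ω => ?_
      split_ifs
      · rw [orbInt_eq_zero _ _ _ _ fun g => rfl, mul_zero]
      · rfl
    refine ⟨?_, fun Xa Xb _ _ => h0 _⟩
    intro X Xa Xb hX hXab hm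
    have dX := det_ne_zero_of_isRelRSS _ hX
    have da := det_ne_zero_of_isRelRSS _ hXab.1
    have db := det_ne_zero_of_isRelRSS _ hXab.2.1
    rw [h0, relKappaOrb_eq hσ hso _ dX, ← stableOrb_rPush hso hA hXab.2.2 hm
      (contraction_det_ne_zero hσ _ da) (contraction_det_ne_zero hσ _ db)]
    symm
    refine weightedOrbInt_eq_zero _ _ _ _ _ (fun g y' h => ⟨h.1.smul g.1, h.2.smul g.2⟩)
      fun y' h' => ?_
    by_contra hne
    have h1 := mt (rPush_oneEnd_eq_zero hso y'.1) (left_ne_zero_of_mul hne)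
    have h2 := mt (rPush_oneEnd_eq_zero hso y'.2) (right_ne_zero_of_mul hne)
    rw [h'.1.det_eq, ord_contraction_det hσ hso _ da] at h1
    rw [h'.2.det_eq, ord_contraction_det hσ hso _ db] at h2
    push Not at h1 h2
    refine hαβ ⟨?_, ?_⟩
    · by_contra hα
      obtain ⟨c, hc⟩ := hodd α hα
      exact h1.2 ⟨ord E Xa.det - c - 1, by rw [hc]; ring⟩
    · by_contra hβ
      obtain ⟨c, hc⟩ := hodd β hβ
      exact h2.2 ⟨ord E Xb.det - c - 1, by rw [hc]; ring⟩

end FundamentalLemma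


section OrdGe

variable {K : Type*} [Field K] [ValuativeRel K] [TopologicalSpace K] [IsNonarchimedeanLocalField K]

/-! ### The valuation filtration -/

theorem zero_or_le_ord_iff_mul_mem {n : ℤ} {t x : K} (ht : t ≠ 0) (htn : ord K t = -n) :
    (x = 0 ∨ n ≤ ord K x) ↔ t * x ∈ 𝒪[K] := by
  by_cases hx : x = 0
  · simp [hx]
  · rw [mem_integer_iff_of_ne (mul_ne_zero ht hx), ord_mul ht hx, htn]
    simp only [hx, false_or]
    constructor <;> intro h <;> linarith

variable (K) in
/-- The fractional ideal of elements of valuation at least `n`. -/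
def ordGe (n : ℤ) : AddSubgroup K where
  carrier := {x | x = 0 ∨ n ≤ ord K x}
  zero_mem' := Or.inl rfl
  add_mem' := by
    intro x y hx hy
    obtain ⟨t, ht⟩ := exists_ord_eq (K := K) (-n)
    refine (zero_or_le_ord_iff_mul_mem t.ne_zero ht).2 ?_
    rw [mul_add]
    exact add_mem ((zero_or_le_ord_iff_mul_mem t.ne_zero ht).1 hx)
      ((zero_or_le_ord_iff_mul_mem t.ne_zero ht).1 hy)
  neg_mem' := by
    intro x hx
    simpa using hx

theorem mem_ordGe {n : ℤ} {x : K} : x ∈ ordGe K n ↔ x = 0 ∨ n ≤ ord K x := Iff.rfl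

theorem mem_ordGe_zero {x : K} : x ∈ ordGe K 0 ↔ x ∈ 𝒪[K] := mem_integer_iff.symm

theorem mul_mem_ordGe {m n k : ℤ} {x y : K} (hx : x ∈ ordGe K m) (hy : y ∈ ordGe K n)
    (hk : k ≤ m + n) : x * y ∈ ordGe K k := by
  by_cases hx0 : x = 0
  · rw [hx0, zero_mul]; exact zero_mem _
  by_cases hy0 : y = 0
  · rw [hy0, mul_zero]; exact zero_mem _
  right
  rw [ord_mul hx0 hy0]
  have h1 := hx.resolve_left hx0
  have h2 := hy.resolve_left hy0
  omega

theorem ordGe_mono {m n : ℤ} (h : m ≤ n) {x : K} (hx : x ∈ ordGe K n) : x ∈ ordGe K m :=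
  hx.imp_right h.trans

theorem ord_eq_of_sub_mem_ordGe {x y : K} (hx : x ≠ 0) (h : y - x ∈ ordGe K (ord K x + 1)) :
    y ≠ 0 ∧ ord K y = ord K x := by
  have hxm : x ∈ ordGe K (ord K x) := Or.inr le_rfl
  have hy : y ∈ ordGe K (ord K x) := by
    have := add_mem (ordGe_mono (by omega) h) hxm
    rwa [sub_add_cancel] at this
  have h2 : y ∉ ordGe K (ord K x + 1) := fun h3 => by
    have h4 := sub_mem h3 h
    rw [sub_sub_cancel] at h4
    rcases h4 with h4 | h4
    · exact hx h4
    · omega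
  have hy0 : y ≠ 0 := fun h0 => h2 (Or.inl h0)
  refine ⟨hy0, ?_⟩
  have h3 := hy.resolve_left hy0
  have h4 : ¬ ord K x + 1 ≤ ord K y := fun h => h2 (Or.inr h)
  omega

theorem mem_of_isClosed_of_approx {S : Set K} (hS : IsClosed S) {z : K}
    (h : ∀ N : ℕ, ∃ x ∈ S, x - z ∈ ordGe K N) : z ∈ S := by
  choose x hxS hx using h
  refine hS.mem_of_tendsto (f := x) (b := Filter.atTop) ?_ (Filter.Eventually.of_forall hxS)
  rw [← tendsto_sub_nhds_zero_iff]
  refine hasBasis_nhds_zero_ord.tendsto_right_iff.2 fun n _ => ?_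
  filter_upwards [Filter.eventually_ge_atTop n] with N hN
  exact ordGe_mono (by exact_mod_cast hN) (hx N)

end OrdGe

/-! ### Unramified quadratic extensions -/

/-- `E/F` is an unramified quadratic extension and `σ` its non-trivial automorphism. -/
structure UnramifiedQuadratic {F E : Type*}
    [Field F] [ValuativeRel F] [TopologicalSpace F] [IsNonarchimedeanLocalField F]
    [Field E] [ValuativeRel E] [TopologicalSpace E] [IsNonarchimedeanLocalField E]
    [Algebra F E] (σ : E ≃ₐ[F] E) : Prop where
  finrank_eq : Module.finrank F E = 2
  unramified : IsUnramified F E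
  invol : ∀ x : E, σ (σ x) = x
  nontrivial : ∃ x : E, σ x ≠ x

section Quadratic

variable {F E : Type*}
  [Field F] [ValuativeRel F] [TopologicalSpace F] [IsNonarchimedeanLocalField F]
  [Field E] [ValuativeRel E] [TopologicalSpace E] [IsNonarchimedeanLocalField E]
  [Algebra F E] {σ : E ≃ₐ[F] E}

namespace UnramifiedQuadratic

theorem exists_algebraMap_eq (H : UnramifiedQuadratic σ) {z : E} (hz : σ z = z) :
    ∃ f : F, algebraMap F E f = z := by
  by_contra hne
  obtain ⟨w, hw⟩ := H.nontrivial
  have hli : LinearIndependent F ![(1 : E), z] := by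
    rw [LinearIndependent.pair_iff]
    intro s t hst
    have ht : t = 0 := by
      by_contra ht
      apply hne
      refine ⟨-s / t, ?_⟩
      have ht' : algebraMap F E t ≠ 0 := by simpa using ht
      rw [map_div₀, map_neg, div_eq_iff ht']
      rw [Algebra.smul_def, Algebra.smul_def, mul_one] at hst
      linear_combination -hst
    subst ht
    simpa [Algebra.smul_def] using hst
  haveI : FiniteDimensional F E := Module.finite_of_finrank_pos (by rw [H.finrank_eq]; norm_num)
  have hsp := hli.span_eq_top_of_card_eq_finrank' (by simp [H.finrank_eq])
  have hwm : w ∈ Submodule.span F (Set.range ![(1 : E), z]) := hsp ▸ Submodule.mem_top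
  simp only [Matrix.range_cons, Matrix.range_empty, Set.union_empty, Set.singleton_union] at hwm
  obtain ⟨s, t, rfl⟩ := Submodule.mem_span_pair.1 hwm
  exact hw (by simp [hz])

theorem continuous_algebraMap (H : UnramifiedQuadratic σ) : Continuous (algebraMap F E) := by
  refine continuous_of_continuousAt_zero (algebraMap F E) ?_
  rw [ContinuousAt, map_zero]
  refine (hasBasis_nhds_zero_ord.tendsto_iff hasBasis_nhds_zero_ord).2 fun n _ => ⟨n, trivial, ?_⟩
  rintro x (rfl | hx)
  · exact Or.inl (map_zero _)
  · exact Or.inr (by rwa [H.unramified])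

theorem exists_uniformizer (H : UnramifiedQuadratic σ) (n : ℤ) :
    ∃ t : E, t ≠ 0 ∧ σ t = t ∧ ord E t = n := by
  obtain ⟨t, ht⟩ := exists_ord_eq (K := F) n
  exact ⟨algebraMap F E t, by simp, σ.commutes _, by rw [H.unramified, ht]⟩

theorem algebraMap_mem_integer_iff (H : UnramifiedQuadratic σ) {x : F} :
    algebraMap F E x ∈ 𝒪[E] ↔ x ∈ 𝒪[F] := by
  rw [mem_integer_iff, mem_integer_iff, H.unramified]; simp

theorem fixed_of_approx (H : UnramifiedQuadratic σ) {z : E}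
    (h : ∀ N : ℕ, ∃ x, σ x = x ∧ x - z ∈ ordGe E N) : σ z = z := by
  obtain ⟨n, hn⟩ := exists_mul_integer z
  obtain ⟨t, ht0, hts, htn⟩ := H.exists_uniformizer n
  have hz : t * z ∈ 𝒪[E] := hn t ht0 htn.ge
  have hcl : IsClosed (algebraMap F E '' (𝒪[F] : Set F)) :=
    (isCompact_integer.image H.continuous_algebraMap).isClosed
  have : t * z ∈ algebraMap F E '' (𝒪[F] : Set F) := by
    refine mem_of_isClosed_of_approx hcl fun N => ?_
    obtain ⟨x, hx, hxz⟩ := h N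
    obtain ⟨f, hf⟩ := H.exists_algebraMap_eq (z := t * x) (by rw [map_mul, hts, hx])
    have h1 : t * x - t * z ∈ ordGe E N := by
      rw [← mul_sub]
      exact mul_mem_ordGe (Or.inr htn.ge) hxz (by omega)
    refine ⟨t * x, ⟨f, ?_, hf⟩, h1⟩
    refine H.algebraMap_mem_integer_iff.1 ?_
    rw [hf]
    have h2 := add_mem (mem_ordGe_zero.1 (ordGe_mono (by omega) h1)) hz
    rwa [sub_add_cancel] at h2
  obtain ⟨f, -, hf⟩ := this
  have h3 : σ (t * z) = t * z := by rw [← hf, σ.commutes]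
  rw [map_mul, hts] at h3
  exact mul_left_cancel₀ ht0 h3

theorem ord_le (H : UnramifiedQuadratic σ) [CharZero E] {x : E} (hx : x ≠ 0) :
    ord E x ≤ ord E (σ x) := by
  by_contra! hlt
  have hsx : σ x ≠ 0 := by simpa using hx
  set u := x / σ x with hu
  have hu0 : u ≠ 0 := div_ne_zero hx hsx
  have hus : σ u = u⁻¹ := by rw [hu, map_div₀, H.invol, inv_div]
  have huo : 1 ≤ ord E u := by
    rw [hu, div_eq_mul_inv, ord_mul hx (inv_ne_zero hsx), ord_inv]; omega
  obtain ⟨e, he⟩ := H.nontrivial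
  set δ := e - σ e with hδ
  have hδ0 : δ ≠ 0 := sub_ne_zero.2 he.symm
  have hδs : σ δ = -δ := by rw [hδ, map_sub, H.invol]; ring
  have key : σ δ⁻¹ = δ⁻¹ := by
    refine H.fixed_of_approx fun N => ?_
    set m : ℕ := (N + ord E δ).toNat + 1 + (ord E (2 : E)).natAbs with hm
    set v := u ^ m with hv
    have hv0 : v ≠ 0 := pow_ne_zero _ hu0
    have hvs : σ v = v⁻¹ := by rw [hv, map_pow, hus, inv_pow]
    have hvo : (m : ℤ) ≤ ord E v := by
      rw [hv, ord_pow hu0]; nlinarith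
    have h1v : 1 + v ≠ 0 ∧ ord E (1 + v) = ord E (1 : E) := by
      refine ord_eq_of_sub_mem_ordGe one_ne_zero ?_
      rw [add_sub_cancel_left, ord_one]
      exact Or.inr (by omega)
    rw [ord_one] at h1v
    have h1v' : v + 1 ≠ 0 := by rw [add_comm]; exact h1v.1
    refine ⟨(1 - v) / (1 + v) * δ⁻¹, ?_, ?_⟩
    · rw [map_mul, map_div₀, map_sub, map_add, map_one, map_inv₀, hδs, hvs]
      have : 1 + v⁻¹ ≠ 0 := by
        rw [← mul_ne_zero_iff_right hv0]
        field_simp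
        exact h1v'
      have h1 := h1v.1
      field_simp
      ring
    · have h2 : (1 - v) / (1 + v) * δ⁻¹ - δ⁻¹ = v * (-2 * (1 + v)⁻¹ * δ⁻¹) := by
        have h1 := h1v.1
        field_simp
        ring
      rw [h2]
      have h20 : (-2 : E) ≠ 0 := by norm_num
      refine mul_mem_ordGe (Or.inr hvo) (Or.inr le_rfl) ?_
      rw [ord_mul (mul_ne_zero h20 (inv_ne_zero h1v.1)) (inv_ne_zero hδ0),
        ord_mul h20 (inv_ne_zero h1v.1), ord_inv, ord_inv, h1v.2, ord_neg]
      omega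
  rw [map_inv₀, hδs, inv_inj] at key
  exact hδ0 (self_eq_neg.1 key.symm)

theorem ord_apply (H : UnramifiedQuadratic σ) [CharZero E] (x : E) : ord E (σ x) = ord E x := by
  by_cases hx : x = 0
  · rw [hx, map_zero]
  · refine le_antisymm ?_ (H.ord_le hx)
    have := H.ord_le (x := σ x) (by simpa using hx)
    rwa [H.invol] at this

end UnramifiedQuadratic

end Quadratic


section Norms

variable {F E : Type*}
  [Field F] [ValuativeRel F] [TopologicalSpace F] [IsNonarchimedeanLocalField F]
  [Field E] [ValuativeRel E] [TopologicalSpace E] [IsNonarchimedeanLocalField E]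
  [Algebra F E] {σ : E ≃ₐ[F] E}

namespace UnramifiedQuadratic

/-! ### Norms from an unramified quadratic extension -/

theorem map_mem_ordGe (H : UnramifiedQuadratic σ) [CharZero E] {n : ℤ} {x : E}
    (hx : x ∈ ordGe E n) : σ x ∈ ordGe E n :=
  hx.imp (fun h => by rw [h, map_zero]) fun h => by rwa [H.ord_apply]

theorem map_mem_integer (H : UnramifiedQuadratic σ) [CharZero E] {x : E} (hx : x ∈ 𝒪[E]) :
    σ x ∈ 𝒪[E] := mem_ordGe_zero.1 (H.map_mem_ordGe (mem_ordGe_zero.2 hx))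

theorem exists_integer_eq (H : UnramifiedQuadratic σ) {z : E} (hz : σ z = z) (hi : z ∈ 𝒪[E]) :
    ∃ f : 𝒪[F], algebraMap F E f = z := by
  obtain ⟨f, rfl⟩ := H.exists_algebraMap_eq hz
  exact ⟨⟨f, H.algebraMap_mem_integer_iff.1 hi⟩, rfl⟩

theorem residue_eq_iff (H : UnramifiedQuadratic σ) {x y : 𝒪[F]} :
    IsLocalRing.residue 𝒪[F] x = IsLocalRing.residue 𝒪[F] y ↔
      algebraMap F E x - algebraMap F E y ∈ ordGe E 1 := by
  rw [← sub_eq_zero, ← map_sub, residue_eq_zero_iff_ord, ← map_sub, mem_ordGe, H.unramified,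
    map_eq_zero]
  rfl

theorem exists_sq_sub_mem (H : UnramifiedQuadratic σ) (h2 : (2 : E) ∈ ordGe E 1) {z : E}
    (hz : σ z = z) (hi : z ∈ 𝒪[E]) : ∃ f ∈ 𝒪[E], σ f = f ∧ f ^ 2 - z ∈ ordGe E 1 := by
  obtain ⟨w, rfl⟩ := H.exists_integer_eq hz hi
  have h2' : (2 : 𝓀[F]) = 0 := by
    have : IsLocalRing.residue 𝒪[F] 2 = IsLocalRing.residue 𝒪[F] 0 := by
      rw [H.residue_eq_iff]
      have h3 : algebraMap F E ((2 : 𝒪[F]) : F) = 2 := map_ofNat (algebraMap F E) 2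
      rw [h3]
      simpa using h2
    rwa [map_zero, map_ofNat] at this
  have hc : ringChar 𝓀[F] = 2 := by
    haveI : CharP 𝓀[F] 2 := CharTwo.of_one_ne_zero_of_two_eq_zero one_ne_zero h2'
    exact ringChar.eq_iff.2 inferInstance
  obtain ⟨r, hr⟩ := FiniteField.isSquare_of_char_two hc (IsLocalRing.residue 𝒪[F] w)
  obtain ⟨f, rfl⟩ := IsLocalRing.residue_surjective r
  refine ⟨algebraMap F E f, H.algebraMap_mem_integer_iff.2 f.2, σ.commutes _, ?_⟩
  rw [← map_mul, H.residue_eq_iff] at hr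
  have h3 : algebraMap F E ((f * f : 𝒪[F]) : F) = algebraMap F E f ^ 2 := by
    rw [Subring.coe_mul, map_mul, sq]
  rw [h3] at hr
  rw [← neg_sub]
  exact neg_mem hr

theorem mem_ordGe_one_of_sq {x : E} (h : x ^ 2 ∈ ordGe E 1) : x ∈ ordGe E 1 := by
  by_cases hx : x = 0
  · exact Or.inl hx
  · have h1 := h.resolve_left (pow_ne_zero 2 hx)
    rw [ord_pow hx] at h1
    right
    push_cast at h1
    omega

theorem exists_sub_unit (H : UnramifiedQuadratic σ) [CharZero E] :
    ∃ z ∈ 𝒪[E], z - σ z ≠ 0 ∧ ord E (z - σ z) = 0 := by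
  by_contra! hno
  have hsub : ∀ z ∈ 𝒪[E], z - σ z ∈ ordGe E 1 := by
    intro z hz
    by_cases h0 : z - σ z = 0
    · exact Or.inl h0
    have h1 := hno z hz h0
    have h2 := (mem_ordGe_zero.2 (sub_mem hz (H.map_mem_integer hz))).resolve_left h0
    exact Or.inr (by omega)
  have step : ∀ z ∈ 𝒪[E], ∃ f ∈ 𝒪[E], σ f = f ∧ z - f ∈ ordGe E 1 := by
    intro z hz
    have hsz := H.map_mem_integer hz
    by_cases h2 : (2 : E) ∈ ordGe E 1
    · obtain ⟨f, hf, hfs, h⟩ := H.exists_sq_sub_mem h2 (z := z * σ z)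
        (by rw [map_mul, H.invol, mul_comm]) (mul_mem hz hsz)
      refine ⟨f, hf, hfs, mem_ordGe_one_of_sq ?_⟩
      have : (z - f) ^ 2 = (f ^ 2 - z * σ z) + (z - σ z) * z + 2 * (z * (σ z - f)) := by ring
      rw [this]
      exact add_mem (add_mem h (mul_mem_ordGe (hsub z hz) (mem_ordGe_zero.2 hz) (by omega)))
        (mul_mem_ordGe h2 (mem_ordGe_zero.2 (mul_mem hz (sub_mem hsz hf))) (by omega))
    · have h20 : (2 : E) ≠ 0 := two_ne_zero
      have ho : ord E (2⁻¹ : E) = 0 := by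
        have h3 : (2 : E) ∈ 𝒪[E] := by
          rw [← one_add_one_eq_two]; exact add_mem (one_mem _) (one_mem _)
        have h4 := (mem_integer_iff_of_ne h20).1 h3
        have h5 : ¬ 1 ≤ ord E (2 : E) := fun h => h2 (Or.inr h)
        rw [ord_inv]; omega
      have hi : (2⁻¹ : E) ∈ ordGe E 0 := Or.inr ho.ge
      refine ⟨2⁻¹ * (z + σ z), mul_mem (mem_ordGe_zero.1 hi) (add_mem hz hsz), ?_, ?_⟩
      · rw [map_mul, map_inv₀, map_ofNat, map_add, H.invol, add_comm]
      · have : z - 2⁻¹ * (z + σ z) = 2⁻¹ * (z - σ z) := by field_simp; ring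
        rw [this]
        exact mul_mem_ordGe hi (hsub z hz) (by omega)
  have approx : ∀ (N : ℕ) (z : E), z ∈ 𝒪[E] → ∃ x, σ x = x ∧ x - z ∈ ordGe E N := by
    intro N
    induction N with
    | zero => exact fun z hz => ⟨0, map_zero _, by
        rw [zero_sub]; exact neg_mem (mem_ordGe_zero.2 hz)⟩
    | succ N ih =>
      intro z hz
      obtain ⟨f, hf, hfs, h⟩ := step z hz
      obtain ⟨t, ht0, hts, hto⟩ := H.exists_uniformizer 1
      have h1 : t⁻¹ * (z - f) ∈ 𝒪[E] := by
        refine mem_ordGe_zero.1 (mul_mem_ordGe (m := -1) (Or.inr ?_) h (by omega))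
        rw [ord_inv, hto]
      obtain ⟨x, hx, hxz⟩ := ih _ h1
      refine ⟨f + t * x, by rw [map_add, map_mul, hfs, hts, hx], ?_⟩
      have : f + t * x - z = t * (x - t⁻¹ * (z - f)) := by
        field_simp; ring
      rw [this]
      exact mul_mem_ordGe (m := 1) (Or.inr hto.ge) hxz (by push_cast; omega)
  obtain ⟨e, he⟩ := H.nontrivial
  obtain ⟨n, hn⟩ := exists_mul_integer e
  obtain ⟨t, ht0, hts, hto⟩ := H.exists_uniformizer n
  have h1 := H.fixed_of_approx fun N => approx N _ (hn t ht0 hto.ge)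
  rw [map_mul, hts] at h1
  exact he (mul_left_cancel₀ ht0 h1)

theorem exists_trace_eq (H : UnramifiedQuadratic σ) [CharZero E] {w : E} (hw : w ∈ 𝒪[E])
    (hs : σ w = w) : ∃ z ∈ 𝒪[E], z + σ z = w := by
  have key : ∃ z ∈ 𝒪[E], z + σ z ≠ 0 ∧ ord E (z + σ z) = 0 := by
    by_cases h2 : (2 : E) ∈ ordGe E 1
    · obtain ⟨z, hz, h0, ho⟩ := H.exists_sub_unit
      refine ⟨z, hz, ?_⟩
      rw [← ho]
      refine ord_eq_of_sub_mem_ordGe h0 ?_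
      rw [ho]
      have : z + σ z - (z - σ z) = 2 * σ z := by ring
      rw [this]
      exact mul_mem_ordGe h2 (mem_ordGe_zero.2 (H.map_mem_integer hz)) (by omega)
    · refine ⟨1, one_mem _, ?_⟩
      rw [map_one, one_add_one_eq_two]
      have h3 : (2 : E) ∈ 𝒪[E] := by
        rw [← one_add_one_eq_two]; exact add_mem (one_mem _) (one_mem _)
      have h4 := (mem_integer_iff_of_ne two_ne_zero).1 h3
      have h5 : ¬ 1 ≤ ord E (2 : E) := fun h => h2 (Or.inr h)
      exact ⟨two_ne_zero, by omega⟩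
  obtain ⟨z, hz, h0, ho⟩ := key
  refine ⟨w * (z + σ z)⁻¹ * z, mul_mem (mul_mem hw ?_) hz, ?_⟩
  · rw [mem_integer_iff_of_ne (inv_ne_zero h0), ord_inv, ho, neg_zero]
  · rw [map_mul, map_mul, map_inv₀, map_add, H.invol, hs, add_comm (σ z) z]
    field_simp

theorem exists_norm_sub_mem (H : UnramifiedQuadratic σ) [CharZero E] {u : E} (hu : u ∈ 𝒪[E])
    (hs : σ u = u) : ∃ c ∈ 𝒪[E], u - c * σ c ∈ ordGe E 1 := by
  by_cases h2 : (2 : E) ∈ ordGe E 1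
  · obtain ⟨f, hf, hfs, h⟩ := H.exists_sq_sub_mem h2 hs hu
    refine ⟨f, hf, ?_⟩
    rw [hfs, ← neg_sub, ← sq]
    exact neg_mem h
  · obtain ⟨z, hz, h0, ho⟩ := H.exists_sub_unit
    set δ := z - σ z with hδ
    have hδi : δ ∈ 𝒪[E] := sub_mem hz (H.map_mem_integer hz)
    have hδs : σ δ = -δ := by rw [hδ, map_sub, H.invol]; ring
    obtain ⟨d, hd⟩ := H.exists_integer_eq (z := δ ^ 2) (by rw [map_pow, hδs]; ring)
      (pow_mem hδi 2)
    obtain ⟨v, hv⟩ := H.exists_integer_eq hs hu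
    have hc : ringChar 𝓀[F] ≠ 2 := by
      intro hc
      apply h2
      haveI : CharP 𝓀[F] 2 := ringChar.eq_iff.1 hc
      have h3 : IsLocalRing.residue 𝒪[F] 2 = IsLocalRing.residue 𝒪[F] 0 := by
        rw [map_zero, map_ofNat, CharTwo.two_eq_zero]
      rw [H.residue_eq_iff] at h3
      have h4 : algebraMap F E ((2 : 𝒪[F]) : F) = 2 := map_ofNat (algebraMap F E) 2
      rw [h4] at h3
      simpa using h3
    have hd0 : IsLocalRing.residue 𝒪[F] d ≠ 0 := by
      rw [Ne, residue_eq_zero_iff_ord, not_or]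
      constructor
      · intro h
        rw [h, map_zero] at hd
        exact h0 (pow_eq_zero_iff two_ne_zero |>.1 hd.symm)
      · rw [← H.unramified, hd, ord_pow h0, ho]; norm_num
    letI := Fintype.ofFinite 𝓀[F]
    obtain ⟨x, y, hxy⟩ := FiniteField.exists_root_sum_quadratic
      (f := Polynomial.X ^ 2 - Polynomial.C (IsLocalRing.residue 𝒪[F] v))
      (g := Polynomial.C (-IsLocalRing.residue 𝒪[F] d) * Polynomial.X ^ 2)
      (Polynomial.degree_X_pow_sub_C (by norm_num) _)
      (Polynomial.degree_C_mul_X_pow 2 (neg_ne_zero.2 hd0))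
      (FiniteField.odd_card_of_char_ne_two hc)
    obtain ⟨x, rfl⟩ := IsLocalRing.residue_surjective x
    obtain ⟨y, rfl⟩ := IsLocalRing.residue_surjective y
    have hxy' : IsLocalRing.residue 𝒪[F] v = IsLocalRing.residue 𝒪[F] (x ^ 2 - d * y ^ 2) := by
      simp only [Polynomial.eval_sub, Polynomial.eval_pow, Polynomial.eval_X, Polynomial.eval_C,
        Polynomial.eval_mul] at hxy
      rw [map_sub, map_mul, map_pow, map_pow]
      linear_combination -hxy
    rw [H.residue_eq_iff, hv] at hxy'
    refine ⟨algebraMap F E x + algebraMap F E y * δ,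
      add_mem (H.algebraMap_mem_integer_iff.2 x.2)
        (mul_mem (H.algebraMap_mem_integer_iff.2 y.2) hδi), ?_⟩
    have h5 : algebraMap F E ((x ^ 2 - d * y ^ 2 : 𝒪[F]) : F) =
        algebraMap F E x ^ 2 - δ ^ 2 * algebraMap F E y ^ 2 := by
      rw [← hd]
      push_cast
      rfl
    rw [h5] at hxy'
    rw [map_add, map_mul, σ.commutes, σ.commutes, hδs]
    convert hxy' using 1
    ring

theorem exists_norm_eq_of_unit (H : UnramifiedQuadratic σ) [CharZero E] {u : E} (hu0 : u ≠ 0)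
    (hu : ord E u = 0) (hs : σ u = u) : ∃ c ∈ 𝒪[E], c * σ c = u := by
  have hui : u ∈ 𝒪[E] := (mem_integer_iff_of_ne hu0).2 hu.ge
  have approx : ∀ N : ℕ, ∃ c ∈ 𝒪[E], u - c * σ c ∈ ordGe E (N + 1) := by
    intro N
    induction N with
    | zero => simpa using H.exists_norm_sub_mem hui hs
    | succ N ih =>
      obtain ⟨c, hc, h⟩ := ih
      obtain ⟨t, ht0, hts, hto⟩ := H.exists_uniformizer (N + 1)
      have hn : c * σ c ≠ 0 ∧ ord E (c * σ c) = 0 := by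
        rw [← hu]
        refine ord_eq_of_sub_mem_ordGe hu0 ?_
        rw [← neg_sub, hu]
        exact neg_mem (ordGe_mono (by omega) h)
      obtain ⟨z, hz, hzw⟩ := H.exists_trace_eq
        (w := (c * σ c)⁻¹ * (t⁻¹ * (u - c * σ c)))
        (mem_ordGe_zero.1 <| mul_mem_ordGe (m := 0) (Or.inr (by rw [ord_inv, hn.2]; simp))
          (mul_mem_ordGe (m := -(N + 1)) (Or.inr (by rw [ord_inv, hto])) h le_rfl) (by omega))
        (by simp only [map_mul, map_inv₀, map_sub, H.invol, hts, hs, mul_comm (σ c) c])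
      refine ⟨c * (1 + t * z), mul_mem hc (add_mem (one_mem _) (mul_mem
        ((mem_integer_iff_of_ne ht0).2 (by omega)) hz)), ?_⟩
      have hsz := H.map_mem_integer hz
      have : u - c * (1 + t * z) * σ (c * (1 + t * z)) =
          t * (t * (-(c * σ c * (z * σ z)))) := by
        simp only [map_mul, map_add, map_one, hts]
        have h3 : c * σ c * t * (z + σ z) = u - c * σ c := by
          rw [hzw]
          have := hn.1
          field_simp
          exact mul_div_cancel_left₀ _ this
        linear_combination -h3
      rw [this]
      have hto' : t ∈ ordGe E (N + 1) := Or.inr hto.ge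
      refine mul_mem_ordGe hto' (mul_mem_ordGe (k := N + 1) hto' (n := 0) ?_ (by omega))
        (by push_cast; omega)
      exact mem_ordGe_zero.2 (neg_mem (mul_mem (mul_mem hc (H.map_mem_integer hc))
        (mul_mem hz hsz)))
  have hcont : Continuous σ := continuous_of_ord (s := (σ : E →+* E)) H.ord_apply
  have hcl : IsClosed ((fun c => c * σ c) '' (𝒪[E] : Set E)) :=
    (isCompact_integer.image (continuous_id.mul hcont)).isClosed
  have := mem_of_isClosed_of_approx hcl (z := u) fun N => by
    obtain ⟨c, hc, h⟩ := approx N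
    refine ⟨c * σ c, ⟨c, hc, rfl⟩, ?_⟩
    rw [← neg_sub]
    exact neg_mem (ordGe_mono (by omega) h)
  obtain ⟨c, hc, h⟩ := this
  exact ⟨c, hc, h⟩

theorem exists_norm_eq (H : UnramifiedQuadratic σ) [CharZero E] {x : E} (hx : x ≠ 0)
    (hs : σ x = x) (he : Even (ord E x)) : ∃ c, σ c * c = x := by
  obtain ⟨k, hk⟩ := he
  obtain ⟨t, ht0, hts, hto⟩ := H.exists_uniformizer k
  obtain ⟨c, -, hc⟩ := H.exists_norm_eq_of_unit (u := x * (t⁻¹ * t⁻¹))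
    (mul_ne_zero hx (mul_ne_zero (inv_ne_zero ht0) (inv_ne_zero ht0)))
    (by rw [ord_mul hx (mul_ne_zero (inv_ne_zero ht0) (inv_ne_zero ht0)),
      ord_mul (inv_ne_zero ht0) (inv_ne_zero ht0), ord_inv, hto, hk]; ring)
    (by simp only [map_mul, map_inv₀, hts, hs])
  refine ⟨c * t, ?_⟩
  rw [map_mul, hts]
  have : σ c * t * (c * t) = c * σ c * (t * t) := by ring
  rw [this, hc]
  field_simp

end UnramifiedQuadratic

end Norms


section HermForms

variable {k : Type*} [Field k] {s : k →+* k}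

/-! ### Diagonalizing Hermitian forms -/

/-- The value at `v` of the Hermitian form with matrix `A`. -/
def hermValue (s : k →+* k) {n : ℕ} (A : Matrix (Fin n) (Fin n) k) (v : Fin n → k) : k :=
  ∑ i, ∑ j, s (v i) * A i j * v j

theorem hermValue_eq_dotProduct {n : ℕ} (A : Matrix (Fin n) (Fin n) k) (v : Fin n → k) :
    hermValue s A v = (s ∘ v) ⬝ᵥ (A *ᵥ v) := by
  simp only [hermValue, dotProduct, Matrix.mulVec, Finset.mul_sum, Function.comp_apply, mul_assoc]

theorem hermValue_conj {n : ℕ} (A g : Matrix (Fin n) (Fin n) k) (v : Fin n → k) :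
    hermValue s (conjT s g * A * g) v = hermValue s A (g *ᵥ v) := by
  rw [hermValue_eq_dotProduct, hermValue_eq_dotProduct, mul_assoc, ← Matrix.mulVec_mulVec,
    Matrix.dotProduct_mulVec, ← Matrix.mulVec_mulVec]
  congr 1
  rw [conjT, Matrix.vecMul_transpose]
  funext i
  exact (RingHom.map_mulVec s g v i).symm

theorem hermValue_single {n : ℕ} (A : Matrix (Fin n) (Fin n) k) (i : Fin n) :
    hermValue s A (Pi.single i 1) = A i i := by
  have : s ∘ (Pi.single i 1 : Fin n → k) = Pi.single i 1 := by
    funext j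
    by_cases h : j = i
    · subst h; simp
    · simp [h]
  rw [hermValue_eq_dotProduct, this]
  simp

theorem hermValue_smul {n : ℕ} (A : Matrix (Fin n) (Fin n) k) (y : k) (v : Fin n → k) :
    hermValue s A (y • v) = s y * y * hermValue s A v := by
  simp only [hermValue, Finset.mul_sum, Pi.smul_apply, smul_eq_mul, map_mul]
  exact Finset.sum_congr rfl fun i _ => Finset.sum_congr rfl fun j _ => by ring

theorem map_hermValue (hs : ∀ x, s (s x) = x) {n : ℕ} {A : Matrix (Fin n) (Fin n) k}
    (hA : conjT s A = A) (v : Fin n → k) : s (hermValue s A v) = hermValue s A v := by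
  simp only [hermValue, map_sum, map_mul, hs]
  rw [Finset.sum_comm]
  refine Finset.sum_congr rfl fun i _ => Finset.sum_congr rfl fun j _ => ?_
  have : s (A j i) = A i j := congrFun (congrFun hA i) j
  rw [this]; ring

theorem hermValue_blk {n : ℕ} (c : k) (A : Matrix (Fin n) (Fin n) k) (x : k) (v : Fin n → k) :
    hermValue s (blk (c • (1 : Matrix (Fin 1) (Fin 1) k)) 0 0 A) (Fin.append (fun _ => x) v) =
      s x * x * c + hermValue s A v := by
  simp only [hermValue, Fin.sum_univ_add, Fin.append_left, Fin.append_right, blk_castAdd_castAdd,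
    blk_castAdd_natAdd, blk_natAdd_castAdd, blk_natAdd_natAdd]
  simp
  ring

theorem exists_hermValue_ne_zero [CharZero k] {n : ℕ} {A : Matrix (Fin n) (Fin n) k}
    (hA : conjT s A = A) (h0 : A ≠ 0) : ∃ v, hermValue s A v ≠ 0 := by
  by_contra! hv
  apply h0
  have hd : ∀ i, A i i = 0 := fun i => (hermValue_single A i).symm.trans (hv _)
  ext i j
  by_contra hij
  change A i j ≠ 0 at hij
  have hne : i ≠ j := fun h => hij (h ▸ hd i)
  have hji : s (A i j) = A j i := congrFun (congrFun hA j) i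
  have h1 := hv (Pi.single i 1 + Pi.single j (A i j)⁻¹)
  have h2 : s ∘ (Pi.single i 1 + Pi.single j (A i j)⁻¹ : Fin n → k) =
      Pi.single i 1 + Pi.single j (s (A i j))⁻¹ := by
    funext l
    by_cases hl : l = i <;> by_cases hl' : l = j <;>
      simp_all
  rw [hermValue_eq_dotProduct, h2, Matrix.mulVec_add, dotProduct_add, add_dotProduct,
    add_dotProduct] at h1
  have hji0 : A j i ≠ 0 := by rw [← hji]; simpa using hij
  simp [hd, hji, hij, hji0] at h1

theorem exists_GL_col {n : ℕ} {v : Fin n → k} (hv : v ≠ 0) (j : Fin n) :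
    ∃ g : GL (Fin n) k, g.val *ᵥ Pi.single j 1 = v := by
  obtain ⟨i, hi⟩ := Function.ne_iff.1 hv
  have hdet : (((1 : Matrix (Fin n) (Fin n) k).updateCol i v).submatrix id
      (Equiv.swap i j)).det ≠ 0 := by
    rw [Matrix.det_permute', ← Matrix.cramer_apply, Matrix.cramer_one]
    refine mul_ne_zero ?_ hi
    rcases Int.units_eq_one_or (Equiv.Perm.sign (Equiv.swap i j)) with h | h <;> simp [h]
  refine ⟨Matrix.GeneralLinearGroup.mkOfDetNeZero _ hdet, ?_⟩
  funext l
  change ((((1 : Matrix (Fin n) (Fin n) k).updateCol i v).submatrix id (Equiv.swap i j)) *ᵥ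
    Pi.single j 1) l = v l
  simp

theorem conjT_conj_herm (hs : ∀ x, s (s x) = x) {n : ℕ} {A : Matrix (Fin n) (Fin n) k}
    (hA : conjT s A = A) (g : Matrix (Fin n) (Fin n) k) :
    conjT s (conjT s g * A * g) = conjT s g * A * g := by
  rw [conjT_mul, conjT_mul, conjT_conjT s hs, hA, mul_assoc]

theorem exists_split_hermValue (hs : ∀ x, s (s x) = x) {n : ℕ}
    {A : Matrix (Fin (1 + n)) (Fin (1 + n)) k} (hA : conjT s A = A) {v : Fin (1 + n) → k}
    (hv : hermValue s A v ≠ 0) :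
    ∃ (g : GL (Fin (1 + n)) k) (A' : Matrix (Fin n) (Fin n) k), conjT s A' = A' ∧
      conjT s g.val * A * g.val =
        blk (hermValue s A v • (1 : Matrix (Fin 1) (Fin 1) k)) 0 0 A' := by
  have hv0 : v ≠ 0 := fun h => hv (by simp [h, hermValue])
  obtain ⟨g, hg⟩ := exists_GL_col hv0 (Fin.castAdd n 0)
  set B := conjT s g.val * A * g.val with hB
  have hBs : conjT s B = B := conjT_conj_herm hs hA _
  set c := hermValue s A v with hc
  have hcs : s c = c := map_hermValue hs hA v
  have hB0 : B (Fin.castAdd n 0) (Fin.castAdd n 0) = c := by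
    refine (hermValue_single (s := s) B _).symm.trans ?_
    rw [hB, hermValue_conj, hg]
  let r : Matrix (Fin 1) (Fin n) k := Matrix.of fun i j => B (Fin.castAdd n i) (Fin.natAdd 1 j)
  let D : Matrix (Fin n) (Fin n) k := Matrix.of fun i j => B (Fin.natAdd 1 i) (Fin.natAdd 1 j)
  have hBb : B = blk (c • (1 : Matrix (Fin 1) (Fin 1) k)) r (conjT s r) D := by
    apply blk_ext
    · intro i j
      rw [Subsingleton.elim i 0, Subsingleton.elim j 0, hB0]; simp
    · intro i j; simp [r]
    · intro i j
      rw [blk_natAdd_castAdd]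
      exact (congrFun (congrFun hBs (Fin.natAdd 1 i)) (Fin.castAdd n j)).symm
    · intro i j; simp [D]
  let g₁ : Matrix (Fin (1 + n)) (Fin (1 + n)) k := blk 1 (-c⁻¹ • r) 0 1
  have hg₁ : g₁.det ≠ 0 := by simp [g₁, det_blk]
  have hg₁s : conjT s g₁ = blk 1 0 (-c⁻¹ • conjT s r) 1 := by
    apply blk_ext <;> intro i j <;> simp [g₁, conjT, hcs, Matrix.one_apply, eq_comm]

  have hprod : conjT s g₁ * B * g₁ = blk (c • (1 : Matrix (Fin 1) (Fin 1) k)) 0 0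
      (D - c⁻¹ • (conjT s r * r)) := by
    rw [hg₁s, hBb, blk_mul, blk_mul]
    congr 1
    · simp
    · simp [smul_smul, hv]
    · simp [smul_smul, hv]
    · simp [smul_smul, hv, sub_eq_neg_add]
  refine ⟨g * Matrix.GeneralLinearGroup.mkOfDetNeZero g₁ hg₁, D - c⁻¹ • (conjT s r * r), ?_, ?_⟩
  · have h := conjT_conj_herm hs hBs g₁
    rw [hprod] at h
    ext i j
    have := congrFun (congrFun h (Fin.natAdd 1 i)) (Fin.natAdd 1 j)
    simpa [conjT] using this
  · rw [← hprod, Units.val_mul, conjT_mul]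
    change conjT s g₁ * conjT s g.val * A * (g.val * g₁) = _
    simp only [hB, mul_assoc]

end HermForms

section Quadratic

variable {F E : Type*}
  [Field F] [ValuativeRel F] [TopologicalSpace F] [IsNonarchimedeanLocalField F]
  [Field E] [ValuativeRel E] [TopologicalSpace E] [IsNonarchimedeanLocalField E]
  [Algebra F E] {σ : E ≃ₐ[F] E}

namespace UnramifiedQuadratic

theorem exists_sum_two_norms (H : UnramifiedQuadratic σ) [CharZero E] {w : E} (hw : w ≠ 0)
    (hs : σ w = w) (ho : Odd (ord E w)) : ∃ x y, σ x * x + σ y * y = w := by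
  obtain ⟨k, hk⟩ := ho
  obtain ⟨t, ht0, hts, hto⟩ := H.exists_uniformizer (-k)
  have h1 : t * t * w ≠ 0 := mul_ne_zero (mul_ne_zero ht0 ht0) hw
  have h2 : t * t * w - 1 ≠ 0 ∧ ord E (t * t * w - 1) = ord E (-1 : E) := by
    refine ord_eq_of_sub_mem_ordGe (by simp) (Or.inr ?_)
    have h3 : t * t * w - 1 - -1 = t * t * w := by ring
    rw [h3, ord_neg, ord_one, ord_mul (mul_ne_zero ht0 ht0) hw, ord_mul ht0 ht0, hto, hk]
    omega
  rw [ord_neg, ord_one] at h2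
  obtain ⟨y, hy⟩ := H.exists_norm_eq h2.1 (by simp only [map_sub, map_mul, map_one, hts, hs])
    (by rw [h2.2]; exact Even.zero)
  refine ⟨t⁻¹, t⁻¹ * y, ?_⟩
  rw [map_mul, map_inv₀, hts]
  have : t⁻¹ * t⁻¹ + t⁻¹ * σ y * (t⁻¹ * y) = t⁻¹ * t⁻¹ * (1 + σ y * y) := by ring
  rw [this, hy]
  field_simp
  ring

theorem ord_det_conj (H : UnramifiedQuadratic σ) [CharZero E] {n : ℕ}
    {A : Matrix (Fin n) (Fin n) E} (hA : A.det ≠ 0) (g : GL (Fin n) E) :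
    (conjT (sig σ) g.val * A * g.val).det ≠ 0 ∧
      ord E (conjT (sig σ) g.val * A * g.val).det = ord E A.det + 2 * ord E g.val.det := by
  have h0 := det_ne_zero_GL g
  have h1 : sig σ g.val.det ≠ 0 := by simpa using h0
  rw [Matrix.det_mul, Matrix.det_mul, det_conjT]
  refine ⟨mul_ne_zero (mul_ne_zero h1 hA) h0, ?_⟩
  rw [ord_mul (mul_ne_zero h1 hA) h0, ord_mul h1 hA]
  have : ord E (sig σ g.val.det) = ord E g.val.det := H.ord_apply _
  rw [this]; ring

theorem exists_hermValue_eq_one (H : UnramifiedQuadratic σ) [CharZero E] {n : ℕ}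
    {A : Matrix (Fin (1 + n)) (Fin (1 + n)) E} (hA : conjT (sig σ) A = A) (hd : A.det ≠ 0)
    (he : Even (ord E A.det)) : ∃ v, hermValue (sig σ) A v = 1 := by
  have even_case : ∀ {m : ℕ} {B : Matrix (Fin m) (Fin m) E} (_ : conjT (sig σ) B = B)
      (v : Fin m → E), hermValue (sig σ) B v ≠ 0 → Even (ord E (hermValue (sig σ) B v)) →
      ∃ v, hermValue (sig σ) B v = 1 := by
    intro m B hB v h0 hv
    obtain ⟨c, hc⟩ := H.exists_norm_eq h0 (map_hermValue H.invol hB v) hv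
    refine ⟨c⁻¹ • v, ?_⟩
    rw [hermValue_smul, ← hc, map_inv₀]
    have hc0 : c ≠ 0 := fun h => h0 (by rw [← hc, h, mul_zero])
    have hsc : σ c ≠ 0 := by simpa using hc0
    change (σ c)⁻¹ * c⁻¹ * (σ c * c) = 1
    field_simp
  haveI : Nonempty (Fin (1 + n)) := ⟨Fin.castAdd n 0⟩
  obtain ⟨v, hv⟩ := exists_hermValue_ne_zero hA (fun h => hd (by rw [h, Matrix.det_zero]))
  by_cases hve : Even (ord E (hermValue (sig σ) A v))
  · exact even_case hA v hv hve
  obtain ⟨g, A', hA', hg⟩ := exists_split_hermValue H.invol hA hv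
  have has := map_hermValue H.invol hA v
  set a := hermValue (sig σ) A v with ha
  have transfer : (∃ w, hermValue (sig σ) (blk (a • (1 : Matrix (Fin 1) (Fin 1) E)) 0 0 A') w = 1) →
      ∃ v, hermValue (sig σ) A v = 1 := by
    rintro ⟨w, hw⟩
    rw [← hg, hermValue_conj] at hw
    exact ⟨_, hw⟩
  have hdd := H.ord_det_conj hd g
  rw [hg, det_blk, Matrix.det_smul] at hdd
  simp only [Fintype.card_fin, pow_one, Matrix.det_one, mul_one] at hdd
  have hd' := right_ne_zero_of_mul hdd.1
  have hodd : Odd (ord E A'.det) := by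
    have h2 := hdd.2
    rw [ord_mul hv hd'] at h2
    rw [Int.not_even_iff_odd] at hve
    obtain ⟨p, hp⟩ := hve
    obtain ⟨q, hq⟩ := he
    exact ⟨q + ord E g.val.det - p - 1, by omega⟩
  have hA'0 : A' ≠ 0 := by
    rintro rfl
    cases n with
    | zero => simp at hodd
    | succ n => exact hd' Matrix.det_zero
  obtain ⟨v', hv'⟩ := exists_hermValue_ne_zero hA' hA'0
  by_cases hve' : Even (ord E (hermValue (sig σ) A' v'))
  · obtain ⟨w, hw⟩ := even_case hA' v' hv' hve'
    exact transfer ⟨Fin.append (fun _ => 0) w, by rw [hermValue_blk, hw]; simp⟩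
  · rw [Int.not_even_iff_odd] at hve hve'
    have hbs := map_hermValue H.invol hA' v'
    set b := hermValue (sig σ) A' v' with hb
    obtain ⟨x, y, hxy⟩ := H.exists_sum_two_norms (inv_ne_zero hv)
      (by rw [map_inv₀]; exact congrArg _ has) (by rw [ord_inv]; exact hve.neg)
    obtain ⟨c, hc⟩ := H.exists_norm_eq (x := a / b) (div_ne_zero hv hv')
      (by rw [map_div₀]; exact congrArg₂ _ has hbs) (by
        rw [div_eq_mul_inv, ord_mul hv (inv_ne_zero hv'), ord_inv]
        exact hve.add_odd hve'.neg)
    refine transfer ⟨Fin.append (fun _ => x) ((y * c) • v'), ?_⟩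
    rw [hermValue_blk, hermValue_smul, ← hb]
    change σ x * x * a + σ (y * c) * (y * c) * b = 1
    have : σ x * x * a + σ (y * c) * (y * c) * b = σ x * x * a + σ y * y * ((σ c * c) * b) := by
      rw [map_mul]; ring
    rw [this, hc, div_mul_cancel₀ _ hv', ← add_mul, hxy, inv_mul_cancel₀ hv]

theorem exists_conj_eq_one (H : UnramifiedQuadratic σ) [CharZero E] (n : ℕ) :
    ∀ A : Matrix (Fin n) (Fin n) E, conjT (sig σ) A = A → A.det ≠ 0 → Even (ord E A.det) →
      ∃ g : GL (Fin n) E, conjT (sig σ) g.val * A * g.val = 1 := by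
  induction n with
  | zero => exact fun A _ _ _ => ⟨1, Subsingleton.elim _ _⟩
  | succ n ih =>
    rw [add_comm n 1]
    intro A hA hd he
    obtain ⟨v, hv⟩ := H.exists_hermValue_eq_one hA hd he
    obtain ⟨g, A', hA', hg⟩ := exists_split_hermValue H.invol hA (v := v) (by rw [hv]; simp)
    rw [hv, one_smul] at hg
    have hdd := H.ord_det_conj hd g
    rw [hg, det_blk, Matrix.det_one, one_mul] at hdd
    obtain ⟨g', hg'⟩ := ih A' hA' hdd.1 (by
      rw [hdd.2]; exact he.add (even_two_mul _))
    have hdet : (blk (1 : Matrix (Fin 1) (Fin 1) E) 0 0 g'.val).det ≠ 0 := by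
      rw [det_blk, Matrix.det_one, one_mul]; exact det_ne_zero_GL g'
    refine ⟨g * Matrix.GeneralLinearGroup.mkOfDetNeZero _ hdet, ?_⟩
    rw [Units.val_mul, conjT_mul]
    change conjT (sig σ) (blk 1 0 0 g'.val) * conjT (sig σ) g.val * A * (g.val * blk 1 0 0 g'.val)
      = 1
    calc _ = conjT (sig σ) (blk 1 0 0 g'.val) * (conjT (sig σ) g.val * A * g.val) *
          blk 1 0 0 g'.val := by simp only [mul_assoc]
      _ = 1 := by
        rw [hg, conjT_blk, blk_mul, blk_mul, conjT_one]
        simp only [Matrix.mul_zero, Matrix.zero_mul, add_zero, zero_add, mul_one, hg',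
          blk_one]

theorem odd_ord_det_of_not_isSplit (H : UnramifiedQuadratic σ) [CharZero E] {n : ℕ}
    (α : HermForm (sig σ) n) (hα : ¬ α.IsSplit) : Odd (ord E α.1.val.det) := by
  rw [← Int.not_even_iff_odd]
  intro he
  obtain ⟨g, hg⟩ := H.exists_conj_eq_one n α.1.val α.2 (det_ne_zero_GL _) he
  apply hα
  have hdet : (conjT (sig σ) (g⁻¹).val).det ≠ 0 := by
    rw [det_conjT]; simpa using det_ne_zero_GL g⁻¹
  refine ⟨Matrix.GeneralLinearGroup.mkOfDetNeZero _ hdet, ?_⟩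
  change conjT (sig σ) (g⁻¹).val * conjT (sig σ) (conjT (sig σ) (g⁻¹).val) = α.1.val
  rw [conjT_conjT (sig σ) H.invol]
  calc conjT (sig σ) (g⁻¹).val * (g⁻¹).val
      = conjT (sig σ) (g⁻¹).val * (conjT (sig σ) g.val * α.1.val * g.val) * (g⁻¹).val := by
        rw [hg, mul_one]
    _ = conjT (sig σ) (g.val * (g⁻¹).val) * α.1.val * (g.val * (g⁻¹).val) := by
        rw [conjT_mul]; simp only [mul_assoc]
    _ = α.1.val := by rw [Units.mul_inv, conjT_one, one_mul, mul_one]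

end UnramifiedQuadratic

end Quadratic

end

end RelFL

theorem mainTheorem10 {F E : Type*}
    [Field F] [ValuativeRel F] [TopologicalSpace F] [IsNonarchimedeanLocalField F] [CharZero F]
    [Field E] [ValuativeRel E] [TopologicalSpace E] [IsNonarchimedeanLocalField E]
    [Algebra F E] [ValuativeExtension F E]
    (hdeg : Module.finrank F E = 2) (hunr : RelFL.IsUnramified F E)
    (σ : E ≃ₐ[F] E) (hσ : ∀ x : E, RelFL.sig σ (RelFL.sig σ x) = x) (hσ1 : ∃ x : E, σ x ≠ x)
    (a b : ℕ) :
    (RelFL.EndoscopicBaseChange σ a b → RelFL.RelativeFundamentalLemma σ hσ a b) ∧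
    (∀ (m : ℤ) (h : RelFL.Herm (RelFL.sig σ) (a + b)), (Odd m ∨ m < 0) →
      RelFL.phiGraded (RelFL.sig σ) m h = 0) ∧
    (∀ (d : ℕ) (h : RelFL.Herm (RelFL.sig σ) (a + b)),
      RelFL.phiGraded (RelFL.sig σ) (2 * d) h =
        RelFL.convOne (RelFL.sig σ) (RelFL.oneD E (a + b) d) h) ∧
    (∀ h : RelFL.Herm (RelFL.sig σ) (a + b),
      HasSum (fun d : ℕ => RelFL.convOne (RelFL.sig σ) (RelFL.oneD E (a + b) d) h)
        (RelFL.rPush (RelFL.sig σ) (RelFL.oneEnd E (a + b)) h)) ∧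
    (∀ f : GL (Fin (a + b)) E → ℂ, RelFL.IsSpherical f →
      ∀ (sa : Fin a → ℂ) (sb : Fin b → ℂ),
        RelFL.satake₂ (RelFL.xi (a := a) (b := b) f) sa sb =
          RelFL.satake f (Fin.append (fun i => sa i + (b : ℂ) / 2) (fun j => sb j + (a : ℂ) / 2))) ∧
    (∀ (d : ℕ) (m : GL (Fin a) E × GL (Fin b) E),
      RelFL.xi (RelFL.oneD E (a + b) d) m =
        ∑ p ∈ Finset.HasAntidiagonal.antidiagonal d, RelFL.oneD E a p.1 m.1 * RelFL.oneD E b p.2 m.2) := by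
  haveI : CharZero E := charZero_of_injective_algebraMap (algebraMap F E).injective
  have H : RelFL.UnramifiedQuadratic σ := ⟨hdeg, hunr, hσ, hσ1⟩
  have hso : ∀ x, RelFL.ord E (RelFL.sig σ x) = RelFL.ord E x := H.ord_apply
  exact ⟨RelFL.relativeFundamentalLemma_of_endoscopicBaseChange hσ hso
      fun α hα => H.odd_ord_det_of_not_isSplit α hα,
    fun m h hm => RelFL.phiGraded_eq_zero hso m h hm,
    fun d h => RelFL.phiGraded_two_mul hso d h,
    fun h => RelFL.hasSum_convOne_oneD hso h,
    fun f hf sa sb => RelFL.satake_xi hf sa sb,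
    fun d m => RelFL.xi_oneD d m⟩
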